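/- **Conventions.** In a Lorentz space $\mathbb R^{1,N-1}$ (bilinear form of signature $(1,N-1)$, written $x\cdot y$; $N=n+2$), a vector $\mathbf n$ with $\mathbf n\cdot\mathbf n<0$ represents the hyperbolic plane $\mathbf n\cdot x=0$ with the half-space $\mathbf n\cdot x>0$, hence an oriented sphere in $\mathbb R^{n}$; positive multiples represent the same sphere. Put $R_{\mathbf n}(x)=x-2\frac{\mathbf n\cdot x}{\mathbf n\cdot\mathbf n}\mathbf n$. Two distinct planes are tangent if $|\mathbf n\cdot\mathbf m|=\|\mathbf n\|\,\|\mathbf m\|$, where $\|\mathbf n\|=\sqrt{-\mathbf n\cdot\mathbf n}$. A *sphere packing* in $\mathbb R^n$ is a non-empty $\mathcal P\subset\mathbb R^{1,N-1}$, not of the form $\{\mathbf n,-\mathbf n\}$, such that for some $k>0$ all $\mathbf n\in\mathcal P$ have $\mathbf n\cdot\mathbf n=-k$, and $\mathbf n\cdot\mathbf n'\ge k$ for distinct $\mathbf n,\mathbf n'\in\mathcal P$. It is *of lattice type* if $\mathcal P\mathbb Z$ is a lattice (the integer span of a basis of $\mathbb R^{1,N-1}$), and *of general lattice type* if $\mathcal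 P$ spans $\mathbb R^{1,N-1}$ and there is a lattice that contains a non-zero multiple of every $\mathbf n\in\mathcal P$. It is *maximal* if there is no $e$ with $e\cdot e<0$ and $e\cdot\mathbf n\ge\|e\|\,\|\mathbf n\|$ for all $\mathbf n\in\mathcal P$. It is *crystallographic* if $\mathcal P=\{\gamma\mathbf n/\|\gamma\mathbf n\|:\gamma\in\Gamma,\ \mathbf n\in S\}$ for a finite subset $S$ of a lattice $\Lambda$ and a group $\Gamma$ of isometries that preserve $\Lambda$ and hyperbolic space $\mathbb H^{N-1}$ (a sheet of $x\cdot x=1$), where $\Gamma$ has a convex fundamental domain in $\mathbb H^{N-1}$ with finitely many faces. It is *weakly Apollonian* if it is crystallographic and maximal and contains a cluster of $N$ mutually tangent spheres, but not every sphere of it belongs to such a cluster. For vectors $v_1,\dots,v_N$ forming a basis, the *weight* $w_i$ is defined by $w_i\cdot v_j=\delta_{ij}$. A basis *has the Coxeter graph* $G$ (with regular edges) if $v_i\cdot v_i=-2$, $v_i\cdot v_j=1$ when $ij$ is an edge, and $v_i\cdot v_j=0$ otherwise; *the packing with Coxeter graph $G$* consists of the normalized vectors $\gamma w_i/\|w_i\|$,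 where $\gamma\in\langle R_{v_1},\dots,R_{v_N}\rangle$ and $w_i\cdot w_i<0$. Let $\beta_0,\dots,\beta_9$ be the basis of $\mathbb R^{1,9}$ whose Coxeter graph is $T_{246}$: the path $\beta_1-\beta_2-\cdots-\beta_9$ together with an edge $\beta_0-\beta_4$. Let $\Gamma=\langle R_{\beta_0},\dots,R_{\beta_9}\rangle$, let $\nu=2w_9=[2,1,2,3,4,3,2,1,0,-1]$ and $\mathcal P_\beta=\Gamma(\nu)$. Put $s_0=\nu$ and $s_{k+1}=R_{\beta_{9-k}}(s_k)$ for $0\le k\le 8$. For $h\neq0$ the *cross section* of $\mathcal P_\beta$ by the hyperplane $H=\{x: h\cdot x=0\}$ is the set of all $\mathbf n\in H$ with $\mathbf n\cdot\mathbf n=-1$ whose half-space in $H$ is $\{x\in H: t\cdot x>0\}$ for some $t\in\mathcal P_\beta$. **Theorem.** (1) $s_0,\dots,s_9\in\mathcal P_\beta$ are ten mutually tangent spheres. (2) Let $t_0,\dots,t_9\in\mathcal P_\beta$ be any cluster of ten mutually tangent spheres, and let $H$ be the hyperplane whose normal vector $h\ne0$ is orthogonal to nine of them. Then the cross section of $\mathcal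 P_\beta$ by $H$ is a sphere packing in $\mathbb R^7$; it is the packing with the Coxeter graph consisting of a path on nine nodes with one further edge joining the first node to the seventh (a 7-cycle with a tail of two nodes). It is weakly Apollonian and of general lattice type, but not of lattice type. (3) If $H$ is the hyperplane orthogonal to $s_0,\dots,s_8$, put $\beta_1'=[2,1,1,2,3,2,1,0,0,0]$. Then $\beta_1',\beta_2,\dots,\beta_9$ lie in $H$ and have the Coxeter graph of (2) (nodes in this order). Let $w_1',\dots,w_9'\in H$ be their weights. Exactly $w_3'$, $w_4'$ and $w_9'$ have negative norm, $s_0=2w_9'$, and the cross section is, after normalization, $\Gamma_7(\{s_0,w_3',w_4'\})$ with $\Gamma_7=\langle R_{\beta_1'},R_{\beta_2},\dots,R_{\beta_9}\rangle$. -/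

import Mathlib

namespace SpherePacking

section General

variable {V : Type*} [AddCommGroup V] [Module ℝ V]

/-- `(V, B)` is the Lorentz space `ℝ^{1,m}` with the negative Lorentz product
(one plus sign, `m` minus signs). -/
def IsLorentz (m : ℕ) (B : LinearMap.BilinForm ℝ V) : Prop :=
  ∃ e : Module.Basis (Fin (m + 1)) ℝ V,
    ∀ i j, B (e i) (e j) = if i = j then (if i = 0 then 1 else -1) else 0

/-- The reflection `R_n (x) = x - 2 (n·x)/(n·n) n`. -/
noncomputable def refl (B : LinearMap.BilinForm ℝ V) (n x : V) : V :=
  x - (2 * B n x / B n n) • n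

/-- The group generated by the reflections `R_n`, `n ∈ S` (used for `n·n < 0`). -/
def reflGroup (B : LinearMap.BilinForm ℝ V) (S : Set V) : Subgroup (V ≃ₗ[ℝ] V) :=
  Subgroup.closure {g | ∃ n ∈ S, ∀ x, g x = refl B n x}

/-- `Γ(S)`. -/
def orbit (Γ : Subgroup (V ≃ₗ[ℝ] V)) (S : Set V) : Set V :=
  {x | ∃ g ∈ Γ, ∃ y ∈ S, x = g y}

/-- `n / ‖n‖` with `‖n‖ = √(-n·n)` (used for `n·n < 0`). -/
noncomputable def normalize (B : LinearMap.BilinForm ℝ V) (n : V) : V :=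
  (√(-(B n n)))⁻¹ • n

/-- A (non-trivial) packing of oriented spheres in `ℝ^d`, given by the normal vectors in
`ℝ^{1,d+1}` of the corresponding hyperbolic planes: all normals have the same norm `-k < 0`, and
`n·n' ≥ k` for distinct members.  The last clause excludes the trivial packing `{n, -n}`. -/
def IsSpherePacking (d : ℕ) (B : LinearMap.BilinForm ℝ V) (P : Set V) : Prop :=
  IsLorentz (d + 1) B ∧ P.Nonempty ∧
    (∃ k : ℝ, 0 < k ∧ ∀ n ∈ P, B n n = -k ∧ ∀ n' ∈ P, n' ≠ n → k ≤ B n n') ∧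
    ∀ n ∈ P, -n ∉ P

/-- A lattice in `V`: the integer span of a real basis. -/
def IsLattice (L : AddSubgroup V) : Prop :=
  ∃ b : Module.Basis (Fin (Module.finrank ℝ V)) ℝ V, L = AddSubgroup.closure (Set.range b)

/-- For a packing `P` (so all vectors of `P` have the same norm): `Pℤ` is a lattice. -/
def IsLatticeType (P : Set V) : Prop := IsLattice (AddSubgroup.closure P)

/-- Every vector of `P` has a (non-zero) multiple in one common lattice, and `P` spans. -/
def IsGeneralLatticeType (P : Set V) : Prop :=
  (∃ L : AddSubgroup V, IsLattice L ∧ ∀ n ∈ P, ∃ c : ℝ, c ≠ 0 ∧ c • n ∈ L) ∧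
    Submodule.span ℝ P = ⊤

/-- The sheet `𝓗 : x·x = 1, x·D > 0`, a model of hyperbolic space. -/
def sheet (B : LinearMap.BilinForm ℝ V) (D : V) : Set V := {x | B x x = 1 ∧ 0 < B x D}

/-- `O_Λ^+`: the linear isometries that preserve `𝓗` and the lattice. -/
def latticeIsometries (B : LinearMap.BilinForm ℝ V) (D : V) (L : AddSubgroup V) :
    Set (V ≃ₗ[ℝ] V) :=
  {g | (∀ x y, B (g x) (g y) = B x y) ∧ g '' sheet B D = sheet B D ∧ g '' (L : Set V) = L}

/-- `Γ` has a convex fundamental domain in `𝓗` with finitely many faces: a finite intersection of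
closed half-spaces whose `Γ`-translates cover `𝓗` and have pairwise disjoint interiors. -/
def IsGeometricallyFinite (B : LinearMap.BilinForm ℝ V) (D : V)
    (Γ : Subgroup (V ≃ₗ[ℝ] V)) : Prop :=
  ∃ W : Finset V, (∀ v ∈ W, B v v < 0) ∧
    (∀ x ∈ sheet B D, ∃ g ∈ Γ, ∀ v ∈ W, 0 ≤ B v (g x)) ∧
    (∀ g ∈ Γ, g ≠ 1 → ∀ x ∈ sheet B D, (∀ v ∈ W, 0 < B v x) → ¬ ∀ v ∈ W, 0 < B v (g x))

/-- `P = Γ(S)`, normalized, for a geometrically finite `Γ ≤ O_Λ^+` and a finite `S ⊆ Λ`. -/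
def IsCrystallographic (B : LinearMap.BilinForm ℝ V) (P : Set V) : Prop :=
  ∃ (D : V) (L : AddSubgroup V) (Γ : Subgroup (V ≃ₗ[ℝ] V)) (S : Finset V),
    0 < B D D ∧ IsLattice L ∧ (∀ g ∈ Γ, g ∈ latticeIsometries B D L) ∧
    IsGeometricallyFinite B D Γ ∧ (∀ n ∈ S, n ∈ L ∧ B n n < 0) ∧
    P = normalize B '' orbit Γ S

/-- No further sphere fits: every oriented sphere `e` overlaps some sphere of `P`. -/
def IsMaximal (B : LinearMap.BilinForm ℝ V) (P : Set V) : Prop :=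
  ∀ e : V, B e e < 0 → ∃ n ∈ P, B e n < √(B e e * B n n)

/-- The distinct planes `H_n` and `H_m` are tangent at infinity: `|n·m| = ‖n‖‖m‖`. -/
def AreTangent (B : LinearMap.BilinForm ℝ V) (n m : V) : Prop :=
  LinearIndependent ℝ ![n, m] ∧ |B n m| = √(B n n * B m m)

/-- `c` is a cluster of `N` mutually tangent spheres of `P`. -/
def IsCluster (B : LinearMap.BilinForm ℝ V) (P : Set V) {N : ℕ} (c : Fin N → V) : Prop :=
  (∀ i, c i ∈ P) ∧ ∀ i j, i ≠ j → AreTangent B (c i) (c j)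

/-- In `ℝ^{1,N-1}`, `P` contains a cluster of `N` mutually tangent spheres. -/
def HasWeakApollonianProperty (B : LinearMap.BilinForm ℝ V) (P : Set V) : Prop :=
  ∃ c : Fin (Module.finrank ℝ V) → V, IsCluster B P c

/-- In `ℝ^{1,N-1}`, every sphere of `P` belongs to a cluster of `N` mutually tangent spheres. -/
def HasApollonianProperty (B : LinearMap.BilinForm ℝ V) (P : Set V) : Prop :=
  ∀ n ∈ P, ∃ c : Fin (Module.finrank ℝ V) → V, IsCluster B P c ∧ n ∈ Set.range c

/-- Crystallographic, maximal, with the weak Apollonian property but not the Apollonian property. -/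
def IsWeaklyApollonian (B : LinearMap.BilinForm ℝ V) (P : Set V) : Prop :=
  IsCrystallographic B P ∧ IsMaximal B P ∧ HasWeakApollonianProperty B P ∧
    ¬ HasApollonianProperty B P

/-- The vector hyperplane `h·x = 0`. -/
abbrev hyperplane (B : LinearMap.BilinForm ℝ V) (h : V) : Submodule ℝ V := LinearMap.ker (B h)

/-- The Lorentz product restricted to the hyperplane `h·x = 0`. -/
abbrev hyperplaneForm (B : LinearMap.BilinForm ℝ V) (h : V) :
    LinearMap.BilinForm ℝ (hyperplane B h) := B.restrict (hyperplane B h)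

/-- The cross section of `P` by the hyperplane `h·x = 0`, as a set of unit normals in that
hyperplane: `n` is in it when the half-space of `n` in the hyperplane is the trace of the half-space
of some `t ∈ P`.  (The trace is the half-space of the projection of `t`; a `t` whose plane is
tangent to the hyperplane, or misses it, has a projection of norm `≥ 0` and contributes nothing.) -/
def crossSection (B : LinearMap.BilinForm ℝ V) (P : Set V) (h : V) : Set (hyperplane B h) :=
  {n | B n n = -1 ∧ ∃ t ∈ P, ∀ x : hyperplane B h, 0 < B n x ↔ 0 < B t x}

open Classical in
/-- The incidence matrix of a Coxeter graph all of whose edges are regular (angle `π/3`), the nodes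
having norm `-2`. -/
noncomputable def incidenceMatrix {ι : Type*} (G : SimpleGraph ι) : Matrix ι ι ℝ :=
  Matrix.of fun i j => if i = j then -2 else if G.Adj i j then 1 else 0

/-- The vectors `v i` are the nodes of the Coxeter graph `G`. -/
def HasCoxeterGraph {ι : Type*} (B : LinearMap.BilinForm ℝ V) (v : ι → V)
    (G : SimpleGraph ι) : Prop :=
  ∀ i j, B (v i) (v j) = incidenceMatrix G i j

/-- `w` is the weight at the node `v i`: `w·v_j = δ_{ij}`. -/
def IsWeight {ι : Type*} (B : LinearMap.BilinForm ℝ V) (v : ι → V) (i : ι) (w : V) : Prop :=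
  B w (v i) = 1 ∧ ∀ j, j ≠ i → B w (v j) = 0

/-- The configuration generated by the nodes `v`: the orbits, under the group generated by the
reflections in the nodes, of the weights that represent planes (those of negative norm),
normalized. -/
def coxeterPacking {ι : Type*} (B : LinearMap.BilinForm ℝ V) (v : ι → V) : Set V :=
  normalize B '' orbit (reflGroup B (Set.range v)) {w | (∃ i, IsWeight B v i w) ∧ B w w < 0}

end General

/-- The graph `T_{246}` on the nodes `β_0, …, β_9`: a path `β_1 - ⋯ - β_9`, and `β_0` joined to
`β_4`. -/
def graphT246 : SimpleGraph (Fin 10) :=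
  SimpleGraph.fromRel fun i j => (1 ≤ i.val ∧ i.val + 1 = j.val) ∨ (i = 0 ∧ j = 4)

/-- The Coxeter graph for `N = 9`: a path on nine nodes (numbered `0, …, 8`) with one more edge, from
the node `0` to the node `6`; that is, a 7-cycle with a tail of two nodes. -/
def graphN9 : SimpleGraph (Fin 9) :=
  SimpleGraph.fromRel fun i j => i.val + 1 = j.val ∨ (i = 0 ∧ j = 6)

/-- The Lorentz product on `ℝ^{1,9}`, in the basis `β_0, …, β_9`. -/
noncomputable def formβ : LinearMap.BilinForm ℝ (Fin 10 → ℝ) :=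
  Matrix.toBilin' (incidenceMatrix graphT246)

/-- The basis vector `β_i`. -/
def β (i : Fin 10) : Fin 10 → ℝ := Pi.single i 1

/-- `ν = 2 w_9`, twice the weight at `β_9`. -/
def ν : Fin 10 → ℝ := ![2, 1, 2, 3, 4, 3, 2, 1, 0, -1]

/-- `Γ = ⟨R_{β_0}, …, R_{β_9}⟩`. -/
noncomputable def Γβ : Subgroup ((Fin 10 → ℝ) ≃ₗ[ℝ] (Fin 10 → ℝ)) :=
  reflGroup formβ (Set.range β)

/-- `P_β = Γ(ν)`. -/
noncomputable def Pβ : Set (Fin 10 → ℝ) := orbit Γβ {ν}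

/-- `s_0 = ν`, `s_{k+1} = R_{β_{9-k}}(s_k)` for `k ≤ 8`. -/
noncomputable def sphereSeq : ℕ → (Fin 10 → ℝ)
  | 0 => ν
  | k + 1 => refl formβ (β (Fin.ofNat 10 (9 - k))) (sphereSeq k)

/-- The ten spheres `s_0, …, s_9`. -/
noncomputable def s (i : Fin 10) : Fin 10 → ℝ := sphereSeq i

/-- The nodes `β_1', β_2, …, β_9`, where `β_1' = [2,1,1,2,3,2,1,0,0,0]`. -/
def β' (i : Fin 9) : Fin 10 → ℝ :=
  if i = 0 then ![2, 1, 1, 2, 3, 2, 1, 0, 0, 0] else β i.succ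

/-- `Γ_7 = ⟨R_{β_1'}, R_{β_2}, …, R_{β_9}⟩`. -/
noncomputable def Γ7 : Subgroup ((Fin 10 → ℝ) ≃ₗ[ℝ] (Fin 10 → ℝ)) :=
  reflGroup formβ (Set.range β')

end SpherePacking

/-! The cross section is pinned down by a squeeze. Let `H` be the hyperplane orthogonal to `s_0, …,
s_8`, with normal vector `N`, `N·N = -14`. (a) The cross section contains the Coxeter packing. The
vector `β_1'` is a root of `Γ`, so `Γ_7` lies in `Γ`; it also fixes `N`, and twice each of the
weights `w_3'`, `w_4'`, `w_9'` is the projection to `H` of some `t ∈ P_β`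
(`IsClusterHyperplane.coxeterPacking_subset`). (b) The cross section is itself a packing. Every `t ∈
P_β` has `t·N ∈ 4ℤ`, and its projection has negative norm only for `t·N = 0, ±4`; in these cases
`t·t' ≥ 2` forces the unit normals of the projections to have product at least `1`
(`IsClusterHyperplane.one_le_bilin`). (c) The Coxeter packing is maximal
(`isMaximal_coxeterPackingN9`). A packing that contains a maximal one equals it. For (c), suppose
that a sphere `e` could be added. A point far behind its plane is moved by the reflection group into
the fundamental chamber. Tangent pairs of weight spheres keep that point well away from the planes
of all three weight orbits, but the chamber truncated by those planes forces a norm larger than that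
of the point. An arbitrary cluster is reduced to `s_0, …, s_9` as follows. The sum `x` of its
members can be moved into the chamber. Its products with the members then force `x` to be a multiple
of the weight `w_0`, and so each member to be one of the `s_k` (`exists_eq_s_of_dominant`). The
reflections in `β_1, …, β_9` permute the `s_k` in all ways (`exists_map_s_eq`), so the choice of the
omitted sphere is immaterial. The basic facts on reflection groups are positivity of roots
(`mem_posCone_of_wordLength_le`) and the existence of a chamber representative (`exists_dominant`).
The other claims rest on residues of products of weights modulo `1` and on the irrationality of
`√21`. -/

namespace SpherePacking

/-! ### Lorentz geometry: cones and signature -/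

section Lorentz

variable {V : Type*} [AddCommGroup V] [Module ℝ V] {B : LinearMap.BilinForm ℝ V}

/-- A symmetric form that is negative definite on the orthogonal complement of every vector of
positive norm. -/
structure IsHyperbolic (B : LinearMap.BilinForm ℝ V) : Prop where
  symm : ∀ x y, B x y = B y x
  neg : ∀ D x, 0 < B D D → B D x = 0 → x ≠ 0 → B x x < 0

theorem bilin_eq_sum {ι : Type*} [Fintype ι] (v : Module.Basis ι ℝ V) (x y : V) :
    B x y = ∑ i, ∑ j, v.repr x i * v.repr y j * B (v i) (v j) := by
  conv_lhs => rw [← v.sum_repr x, ← v.sum_repr y]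
  simp only [map_sum, LinearMap.sum_apply, map_smul, LinearMap.smul_apply, smul_eq_mul]
  rw [Finset.sum_comm (s := Finset.univ) (t := Finset.univ) (f := fun i j => _ * _ * _)]
  refine Finset.sum_congr rfl fun i _ => ?_
  rw [Finset.mul_sum]
  exact Finset.sum_congr rfl fun j _ => by ring

theorem bilin_symm_of_basis {ι : Type*} [Fintype ι] (v : Module.Basis ι ℝ V)
    (h : ∀ i j, B (v i) (v j) = B (v j) (v i)) (x y : V) : B x y = B y x := by
  rw [bilin_eq_sum v x y, bilin_eq_sum v y x, Finset.sum_comm]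
  refine Finset.sum_congr rfl fun i _ => Finset.sum_congr rfl fun j _ => ?_
  rw [h]; ring

/-- Cauchy-Schwarz on the space-like coordinates: orthogonality equates the product of the time
coordinates with the product of the space parts, while the space part of `D` is shorter than its
time part. -/
theorem IsLorentz.isHyperbolic {m : ℕ} (h : IsLorentz m B) : IsHyperbolic B := by
  obtain ⟨e, he⟩ := h
  have key : ∀ x y, B x y =
      e.repr x 0 * e.repr y 0 - ∑ i : Fin m, e.repr x i.succ * e.repr y i.succ := by
    intro x y
    rw [bilin_eq_sum e]
    have : ∀ i, ∑ j, e.repr x i * e.repr y j * B (e i) (e j)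
        = e.repr x i * e.repr y i * (if i = 0 then 1 else -1) := by
      intro i
      rw [Finset.sum_eq_single i]
      · simp [he]
      · intro j _ hj
        rw [he, if_neg hj.symm, mul_zero]
      · simp
    simp only [this, Fin.sum_univ_succ, if_true, Fin.succ_ne_zero, if_false, mul_neg, mul_one,
      Finset.sum_neg_distrib]
    ring
  refine ⟨fun x y => ?_, fun D x hD hx hx0 => ?_⟩
  · rw [key, key]
    simp only [mul_comm]
  · rw [key] at hD hx ⊢
    set a := e.repr D 0
    set b := e.repr x 0
    have cs := Finset.sum_mul_sq_le_sq_mul_sq Finset.univ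
      (fun i : Fin m => e.repr D i.succ) (fun i => e.repr x i.succ)
    simp only [← pow_two] at hD ⊢
    set p := ∑ i : Fin m, (e.repr D i.succ) ^ 2
    set q := ∑ i : Fin m, (e.repr x i.succ) ^ 2 with hq
    have hp0 : 0 ≤ p := Finset.sum_nonneg fun i _ => sq_nonneg _
    have hq0 : 0 ≤ q := Finset.sum_nonneg fun i _ => sq_nonneg _
    have hab : (a * b) ^ 2 ≤ p * q := by
      rw [sub_eq_zero.mp hx]; exact cs
    by_contra hcon
    have hbq : q ≤ b ^ 2 := by linarith
    have ha : 0 < a ^ 2 := by linarith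
    have h1 : a ^ 2 * q ≤ p * q := by nlinarith
    have hqz : q = 0 := by
      by_contra hne
      have : 0 < q := lt_of_le_of_ne hq0 (Ne.symm hne)
      nlinarith
    have hb : b = 0 := by
      have : (a * b) ^ 2 ≤ 0 := by rw [hqz, mul_zero] at hab; exact hab
      have h2 : a * b = 0 := by
        apply pow_eq_zero_iff (two_ne_zero) |>.mp
        exact le_antisymm this (sq_nonneg _)
      rcases mul_eq_zero.mp h2 with h | h
      · rw [h] at ha; norm_num at ha
      · exact h
    apply hx0
    apply e.repr.injective
    rw [map_zero]
    ext i
    refine Fin.cases hb (fun i => ?_) i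
    have := (Finset.sum_eq_zero_iff_of_nonneg (fun i _ => sq_nonneg _)).mp (hq ▸ hqz) i
      (Finset.mem_univ _)
    simpa using this

namespace IsHyperbolic

theorem nonpos (hB : IsHyperbolic B) {D x : V} (hD : 0 < B D D) (h : B D x = 0) :
    B x x ≤ 0 := by
  by_cases hx : x = 0
  · simp [hx]
  · exact (hB.neg D x hD h hx).le

/-- The combination `(y·D) x - (x·D) y` is orthogonal to `D`, so its norm is at most `0`; a negative
`x·y` would make that norm positive. -/
theorem nonneg_of_forward (hB : IsHyperbolic B) {D x y : V} (hD : 0 < B D D) (hx : 0 ≤ B x x)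
    (hy : 0 ≤ B y y) (hxD : 0 < B x D) (hyD : 0 < B y D) : 0 ≤ B x y := by
  by_contra! h
  have h1 : B D (B y D • x - B x D • y) = 0 := by
    rw [hB.symm, map_sub, map_smul, map_smul]
    simp only [LinearMap.sub_apply, LinearMap.smul_apply, smul_eq_mul]
    ring
  have h2 := hB.nonpos hD h1
  simp only [map_sub, map_smul, smul_eq_mul, LinearMap.sub_apply, LinearMap.smul_apply,
    hB.symm y x] at h2
  have h3 : 0 < B y D * B x D := mul_pos hyD hxD
  nlinarith [mul_nonneg (sq_nonneg (B y D)) hx, mul_nonneg (sq_nonneg (B x D)) hy,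
    mul_pos_of_neg_of_neg (neg_neg_of_pos h3) h]

theorem pos_of_forward (hB : IsHyperbolic B) {D x y : V} (hD : 0 < B D D) (hx : 0 < B x x)
    (hy : 0 ≤ B y y) (hxD : 0 < B x D) (hyD : 0 < B y D) : 0 < B x y := by
  refine lt_of_le_of_ne (hB.nonneg_of_forward hD hx.le hy hxD hyD) fun h => ?_
  have : y ≠ 0 := by rintro rfl; simp at hyD
  linarith [hB.neg x y hx h.symm this]

theorem ne_zero_of_forward (hB : IsHyperbolic B) {D x : V} (hD : 0 < B D D) (hx : 0 ≤ B x x)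
    (hx0 : x ≠ 0) : B x D ≠ 0 := fun h => by
  linarith [hB.neg D x hD (by rw [hB.symm, h]) hx0]

/-- The Cauchy-Schwarz inequality on the orthogonal complement of a vector of positive norm. -/
theorem sq_le_of_orthogonal (hB : IsHyperbolic B) {D a b : V} (hD : 0 < B D D) (ha : B D a = 0)
    (hb : B D b = 0) : (B a b) ^ 2 ≤ B a a * B b b := by
  by_cases hb0 : b = 0
  · simp [hb0]
  have hbb := hB.neg D b hD hb hb0
  have h := hB.nonpos hD (show B D (B b b • a - B a b • b) = 0 by simp [ha, hb])
  simp only [map_sub, map_smul, smul_eq_mul, LinearMap.sub_apply, LinearMap.smul_apply,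
    hB.symm b a] at h
  nlinarith

end IsHyperbolic

/-- An orthogonal family of the right signature and size shows that the space is Lorentzian. -/
theorem isLorentz_of_orthogonal {m : ℕ} (hfin : Module.finrank ℝ V = m + 1)
    (e : Fin (m + 1) → V) (hort : ∀ i j, i ≠ j → B (e i) (e j) = 0)
    (h0 : 0 < B (e 0) (e 0)) (hneg : ∀ i, i ≠ 0 → B (e i) (e i) < 0) : IsLorentz m B := by
  have hne : ∀ i, B (e i) (e i) ≠ 0 := fun i => by
    by_cases hi : i = 0
    · rw [hi]; exact h0.ne'
    · exact (hneg i hi).ne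
  have hsq : ∀ i, 0 < √|B (e i) (e i)| := fun i => Real.sqrt_pos.mpr (abs_pos.mpr (hne i))
  let f : Fin (m + 1) → V := fun i => (√|B (e i) (e i)|)⁻¹ • e i
  have hf : ∀ i j, B (f i) (f j) = if i = j then (if i = 0 then 1 else -1) else 0 := by
    intro i j
    simp only [f, map_smul, LinearMap.smul_apply, smul_eq_mul]
    split_ifs with hij hi
    · subst hij
      have h2 : |B (e i) (e i)| = B (e i) (e i) := by rw [hi]; exact abs_of_pos h0
      rw [← mul_assoc, ← mul_inv, Real.mul_self_sqrt (abs_nonneg _), h2, inv_mul_cancel₀ (hne i)]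
    · subst hij
      have h2 : |B (e i) (e i)| = -B (e i) (e i) := abs_of_neg (hneg i hi)
      rw [← mul_assoc, ← mul_inv, Real.mul_self_sqrt (abs_nonneg _), h2, inv_neg, neg_mul,
        inv_mul_cancel₀ (hne i)]
    · rw [hort i j hij]; simp
  have hli : LinearIndependent ℝ f := by
    rw [Fintype.linearIndependent_iff]
    intro g hg i
    have h1 : B (f i) (∑ j, g j • f j) = 0 := by rw [hg, map_zero]
    simp only [map_sum, map_smul, smul_eq_mul, hf] at h1
    simp only [mul_ite, mul_zero, Finset.sum_ite_eq, Finset.mem_univ, if_true] at h1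
    split_ifs at h1 <;> linarith
  refine ⟨basisOfLinearIndependentOfCardEqFinrank hli (by simp [hfin]), fun i j => ?_⟩
  simp only [coe_basisOfLinearIndependentOfCardEqFinrank]
  exact hf i j

end Lorentz

/-! ### Simply laced reflection groups: words, roots and chambers -/

section Coxeter

variable {V : Type*} [AddCommGroup V] [Module ℝ V] {B : LinearMap.BilinForm ℝ V} {ι : Type*}

/-- The products of the nodes of a Coxeter graph with regular edges. -/
structure IsSimplyLaced (B : LinearMap.BilinForm ℝ V) (v : ι → V) : Prop where
  symm : ∀ x y, B x y = B y x
  norm : ∀ i, B (v i) (v i) = -2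
  edge : ∀ i j, i ≠ j → B (v i) (v j) = 0 ∨ B (v i) (v j) = 1

/-- The reflection in a vector of norm `-2`, as a linear equivalence. -/
noncomputable def reflEquiv {n : V} (hn : B n n = -2) : V ≃ₗ[ℝ] V :=
  Module.reflection (x := n) (f := -(B n)) (by simp [hn])

theorem reflEquiv_apply {n : V} (hn : B n n = -2) (x : V) :
    reflEquiv hn x = x + B n x • n := by
  simp [reflEquiv, Module.reflection_apply]

theorem refl_eq {n : V} (hn : B n n = -2) (x : V) : refl B n x = x + B n x • n := by
  rw [refl, hn, sub_eq_add_neg, ← neg_smul]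
  congr 2
  ring

theorem reflEquiv_mem {n : V} (hn : B n n = -2) {S : Set V} (h : n ∈ S) :
    reflEquiv hn ∈ reflGroup B S :=
  Subgroup.subset_closure ⟨n, h, fun x => by rw [reflEquiv_apply, refl_eq hn]⟩

/-- Reflections are involutions, so words in the generators without inverses exhaust the group. -/
theorem reflGroup_induction {v : ι → V} (hv : ∀ i, B (v i) (v i) = -2)
    {p : (V ≃ₗ[ℝ] V) → Prop} (one : p 1)
    (mul : ∀ i g, p g → p (reflEquiv (hv i) * g)) :
    ∀ g ∈ reflGroup B (Set.range v), p g := by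
  have hgen : ∀ g, (∃ n ∈ Set.range v, ∀ x, g x = refl B n x) → ∃ i, g = reflEquiv (hv i) := by
    rintro g ⟨_, ⟨i, rfl⟩, hg⟩
    exact ⟨i, LinearEquiv.ext fun x => by rw [hg, reflEquiv_apply, refl_eq (hv i)]⟩
  have hinv : ∀ i, (reflEquiv (hv i))⁻¹ = reflEquiv (hv i) := by
    intro i
    rw [inv_eq_iff_mul_eq_one]
    ext x
    simp only [LinearEquiv.mul_apply, reflEquiv_apply, map_add, map_smul, hv,
      LinearEquiv.coe_one, id]
    module
  intro g hg
  induction hg using Subgroup.closure_induction_left with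
  | one => exact one
  | mul_left x hx y _ ih =>
    obtain ⟨i, rfl⟩ := hgen x hx
    exact mul i y ih
  | inv_mul_cancel x hx y _ ih =>
    obtain ⟨i, rfl⟩ := hgen x hx
    rw [hinv]
    exact mul i y ih

theorem reflGroup_isometry {v : ι → V} (hs : ∀ x y, B x y = B y x)
    (hv : ∀ i, B (v i) (v i) = -2) :
    ∀ g ∈ reflGroup B (Set.range v), ∀ x y, B (g x) (g y) = B x y := by
  refine reflGroup_induction hv (fun x y => rfl) fun i g ih x y => ?_
  simp only [LinearEquiv.mul_apply, reflEquiv_apply, map_add, map_smul, LinearMap.add_apply,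
    LinearMap.smul_apply, smul_eq_mul, hv, ih, hs (g x) (v i)]
  ring

theorem inv_apply_bilin {v : ι → V} (hs : ∀ x y, B x y = B y x)
    (hv : ∀ i, B (v i) (v i) = -2) {g : V ≃ₗ[ℝ] V} (hg : g ∈ reflGroup B (Set.range v))
    (x y : V) : B (g⁻¹ x) y = B x (g y) := by
  rw [← reflGroup_isometry hs hv g hg]
  congr 1
  exact congrArg B (g.apply_symm_apply x)

/-- For a reflection `R` in `v`, `R y · y = y·y + (v·y)² > 0`, so `R y` stays in the same half of
the cone as `y`. -/
theorem reflGroup_forward {v : ι → V} (hB : IsHyperbolic B) (hv : ∀ i, B (v i) (v i) = -2)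
    {D x : V} (hD : 0 < B D D) (hx : 0 < B x x) (hxD : 0 < B x D) :
    ∀ g ∈ reflGroup B (Set.range v), 0 < B (g x) D := by
  intro g hg
  suffices 0 < B (g x) D ∧ 0 < B (g x) (g x) from this.1
  revert g
  refine reflGroup_induction hv ⟨hxD, hx⟩ fun i g ih => ?_
  set y := g x
  have h1 : B (reflEquiv (hv i) y) (reflEquiv (hv i) y) = B y y := by
    exact reflGroup_isometry hB.symm hv _ (reflEquiv_mem (hv i) ⟨i, rfl⟩) y y
  have h2 : 0 < B (reflEquiv (hv i) y) y := by
    simp only [reflEquiv_apply, map_add, map_smul, LinearMap.add_apply,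
      LinearMap.smul_apply, smul_eq_mul]
    nlinarith [ih.2]
  refine ⟨?_, by rw [LinearEquiv.mul_apply, h1]; exact ih.2⟩
  rw [LinearEquiv.mul_apply]
  refine hB.pos_of_forward ih.2 (h1 ▸ ih.2) hD.le h2 ?_
  rw [hB.symm]; exact ih.1

/-- The product of the reflections in the nodes of a word. -/
noncomputable def wordProd {v : ι → V} (hv : ∀ i, B (v i) (v i) = -2) (l : List ι) : V ≃ₗ[ℝ] V :=
  (l.map fun i => reflEquiv (hv i)).prod

/-- The least length of a word that represents `g`. -/
noncomputable def wordLength {v : ι → V} (hv : ∀ i, B (v i) (v i) = -2) (g : V ≃ₗ[ℝ] V) : ℕ :=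
  sInf {n | ∃ l : List ι, l.length = n ∧ wordProd hv l = g}

theorem wordLength_le {v : ι → V} (hv : ∀ i, B (v i) (v i) = -2) (l : List ι) :
    wordLength hv (wordProd hv l) ≤ l.length :=
  Nat.sInf_le ⟨l, rfl, rfl⟩

theorem exists_word {v : ι → V} (hv : ∀ i, B (v i) (v i) = -2) {g : V ≃ₗ[ℝ] V}
    (hg : g ∈ reflGroup B (Set.range v)) :
    ∃ l : List ι, l.length = wordLength hv g ∧ wordProd hv l = g := by
  have : ∀ g ∈ reflGroup B (Set.range v), ∃ l : List ι, wordProd hv l = g := by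
    refine reflGroup_induction hv ⟨[], by simp [wordProd]⟩ ?_
    rintro i g ⟨l, rfl⟩
    exact ⟨i :: l, by simp [wordProd]⟩
  obtain ⟨l, hl⟩ := this g hg
  exact Nat.sInf_mem (s := {n | ∃ l : List ι, l.length = n ∧ wordProd hv l = g})
    ⟨l.length, l, rfl, hl⟩

theorem wordProd_mem {v : ι → V} (hv : ∀ i, B (v i) (v i) = -2) (l : List ι) :
    wordProd hv l ∈ reflGroup B (Set.range v) := by
  refine Subgroup.list_prod_mem _ fun g hg => ?_
  obtain ⟨i, -, rfl⟩ := List.mem_map.mp hg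
  exact reflEquiv_mem (hv i) ⟨i, rfl⟩

theorem reflEquiv_mul_self {n : V} (hn : B n n = -2) : reflEquiv hn * reflEquiv hn = 1 := by
  ext x
  simp only [LinearEquiv.mul_apply, reflEquiv_apply, map_add, map_smul, hn, LinearEquiv.coe_one, id]
  module

theorem wordLength_mul_le {v : ι → V} (hv : ∀ i, B (v i) (v i) = -2) {g : V ≃ₗ[ℝ] V}
    (hg : g ∈ reflGroup B (Set.range v)) (i : ι) :
    wordLength hv (g * reflEquiv (hv i)) ≤ wordLength hv g + 1 := by
  obtain ⟨l, hl, rfl⟩ := exists_word hv hg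
  rw [← hl]
  simpa [wordProd] using wordLength_le hv (l ++ [i])

/-- Strips the last letter of a shortest word; this drives the inductions on length. -/
theorem exists_wordLength_succ {v : ι → V} (hv : ∀ i, B (v i) (v i) = -2) {g : V ≃ₗ[ℝ] V}
    (hg : g ∈ reflGroup B (Set.range v)) (h1 : g ≠ 1) :
    ∃ u ∈ reflGroup B (Set.range v), ∃ t, g = u * reflEquiv (hv t) ∧
      wordLength hv g = wordLength hv u + 1 := by
  obtain ⟨l, hl, hlg⟩ := exists_word hv hg
  rcases List.eq_nil_or_concat l with rfl | ⟨l', t, rfl⟩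
  · exact absurd hlg.symm (by simpa [wordProd] using h1)
  · have hgu : g = wordProd hv l' * reflEquiv (hv t) := by rw [← hlg]; simp [wordProd]
    refine ⟨wordProd hv l', wordProd_mem hv l', t, hgu, le_antisymm ?_ ?_⟩
    · have := wordLength_mul_le hv (wordProd_mem hv l') t
      rwa [← hgu] at this
    · have := wordLength_le hv l'
      simp at hl
      omega

theorem reflEquiv_comm {a b : V} (ha : B a a = -2) (hb : B b b = -2) (hab : B a b = 0)
    (hba : B b a = 0) : reflEquiv ha * reflEquiv hb = reflEquiv hb * reflEquiv ha := by
  ext x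
  simp only [LinearEquiv.mul_apply, reflEquiv_apply, map_add, map_smul, hab, hba]
  module

theorem reflEquiv_braid {a b : V} (ha : B a a = -2) (hb : B b b = -2) (hab : B a b = 1)
    (hba : B b a = 1) : reflEquiv ha * reflEquiv hb * reflEquiv ha =
      reflEquiv hb * reflEquiv ha * reflEquiv hb := by
  ext x
  simp only [LinearEquiv.mul_apply, reflEquiv_apply, map_add, map_smul, hab, hba, ha, hb]
  module

/-- The cone of non-negative combinations of a basis. -/
def posCone (v : Module.Basis ι ℝ V) : Set V := {x | ∀ i, 0 ≤ v.repr x i}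

theorem add_mem_posCone {v : Module.Basis ι ℝ V} {x y : V} (hx : x ∈ posCone v)
    (hy : y ∈ posCone v) : x + y ∈ posCone v := fun i => by
  simpa using add_nonneg (hx i) (hy i)

theorem smul_mem_posCone {v : Module.Basis ι ℝ V} {x : V} (hx : x ∈ posCone v) {c : ℝ}
    (hc : 0 ≤ c) : c • x ∈ posCone v := fun i => by
  simpa using mul_nonneg hc (hx i)

theorem eq_zero_of_mem_posCone {v : Module.Basis ι ℝ V} {x : V} (hx : x ∈ posCone v)
    (hx' : -x ∈ posCone v) : x = 0 := by
  apply v.repr.injective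
  rw [map_zero]
  ext i
  have := hx' i
  simp only [map_neg, Finsupp.coe_neg, Pi.neg_apply] at this
  exact le_antisymm (neg_nonneg.mp this) (hx i)

theorem bilin_nonneg_of_mem_posCone [Fintype ι] {v : Module.Basis ι ℝ V} {x y : V}
    (hx : x ∈ posCone v) (hy : ∀ i, 0 ≤ B y (v i)) : 0 ≤ B y x := by
  rw [← v.sum_repr x, map_sum]
  exact Finset.sum_nonneg fun i _ => by
    rw [map_smul, smul_eq_mul]; exact mul_nonneg (hx i) (hy i)

/-- Roots are positive or negative: if right multiplication by a simple reflection does not shorten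
`g`, then `g` sends the simple root to a positive root. -/
theorem mem_posCone_of_wordLength_le {v : Module.Basis ι ℝ V} (hL : IsSimplyLaced B v) (n : ℕ) :
    ∀ g ∈ reflGroup B (Set.range v), wordLength hL.norm g ≤ n → ∀ s,
      wordLength hL.norm g ≤ wordLength hL.norm (g * reflEquiv (hL.norm s)) →
      g (v s) ∈ posCone v := by
  classical
  have hone : ∀ s, v s ∈ posCone v := fun s i => by
    rw [v.repr_self, Finsupp.single_apply]; split_ifs <;> norm_num
  induction n with
  | zero =>
    intro g hg hn s _
    obtain ⟨l, hl, rfl⟩ := exists_word hL.norm hg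
    have : l = [] := List.length_eq_zero_iff.mp (by omega)
    subst this
    exact hone s
  | succ n ih =>
    intro g hg hn s hs
    by_cases h1 : g = 1
    · subst h1; exact hone s
    obtain ⟨u, hu, t, rfl, hl⟩ := exists_wordLength_succ hL.norm hg h1
    have hst : t ≠ s := by
      rintro rfl
      rw [mul_assoc, reflEquiv_mul_self, mul_one] at hs
      omega
    have hus := Subgroup.mul_mem _ hu (reflEquiv_mem (hL.norm s) ⟨s, rfl⟩)
    rcases hL.edge t s hst with h0 | h0
    · have h0' : B (v s) (v t) = 0 := by rw [hL.symm]; exact h0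
      have e1 : (u * reflEquiv (hL.norm t)) (v s) = u (v s) := by
        simp [LinearEquiv.mul_apply, reflEquiv_apply, h0]
      rw [e1]
      refine ih u hu (by omega) s ?_
      by_contra! hcon
      rw [mul_assoc, reflEquiv_comm _ _ h0 h0', ← mul_assoc] at hs
      have := wordLength_mul_le hL.norm hus t
      omega
    · have h0' : B (v s) (v t) = 1 := by rw [hL.symm]; exact h0
      have e1 : (u * reflEquiv (hL.norm t)) (v s) = u (v s) + u (v t) := by
        simp [LinearEquiv.mul_apply, reflEquiv_apply, h0]
      by_cases hcon : wordLength hL.norm u ≤ wordLength hL.norm (u * reflEquiv (hL.norm s))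
      · rw [e1]
        exact add_mem_posCone (ih u hu (by omega) s hcon) (ih u hu (by omega) t (by omega))
      · push Not at hcon
        -- Here `w` is shorter than `u`, and `g v_s = u v_s + u v_t = w v_t`, so the induction
        -- hypothesis is applied to `w` and `t`.
        obtain ⟨w, hw⟩ : ∃ w, w = u * reflEquiv (hL.norm s) := ⟨_, rfl⟩
        rw [← hw] at hcon hus
        have hwu : u = w * reflEquiv (hL.norm s) := by
          rw [hw, mul_assoc, reflEquiv_mul_self, mul_one]
        have hwl := wordLength_mul_le hL.norm hus s
        rw [← hwu] at hwl
        have e2 : u (v s) + u (v t) = w (v t) := by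
          rw [hwu]
          simp only [LinearEquiv.mul_apply, reflEquiv_apply, h0', hL.norm, map_add, map_smul]
          module
        rw [e1, e2]
        refine ih w hus (by omega) t ?_
        -- If `w R_t` were shorter than `w`, the braid relation `g R_s = w R_s R_t R_s = w R_t R_s
        -- R_t` would make `g R_s` shorter than `g`.
        by_contra! hcon2
        have hwt := Subgroup.mul_mem _ hus (reflEquiv_mem (hL.norm t) ⟨t, rfl⟩)
        have h3 := wordLength_mul_le hL.norm hwt s
        have h4 := wordLength_mul_le hL.norm
          (Subgroup.mul_mem _ hwt (reflEquiv_mem (hL.norm s) ⟨s, rfl⟩)) t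
        have e3 : u * reflEquiv (hL.norm t) * reflEquiv (hL.norm s) =
            w * reflEquiv (hL.norm t) * reflEquiv (hL.norm s) * reflEquiv (hL.norm t) := by
          conv_lhs => rw [hwu]
          simp only [mul_assoc]
          rw [← mul_assoc (reflEquiv (hL.norm s)), reflEquiv_braid _ _ h0' h0, mul_assoc]
        rw [e3] at hs
        omega

/-- With `g = u R_t` and `u` shorter, `g z - u z = (v_t·z) u(v_t)`, a non-negative multiple of a
positive root. -/
theorem sub_mem_posCone {v : Module.Basis ι ℝ V} (hL : IsSimplyLaced B v) {z : V}
    (hz : ∀ i, 0 ≤ B (v i) z) :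
    ∀ g ∈ reflGroup B (Set.range v), g z - z ∈ posCone v := by
  intro g hg
  obtain ⟨n, hn⟩ : ∃ n, wordLength hL.norm g ≤ n := ⟨_, le_rfl⟩
  induction n generalizing g with
  | zero =>
    obtain ⟨l, hl, rfl⟩ := exists_word hL.norm hg
    have : l = [] := List.length_eq_zero_iff.mp (by omega)
    subst this
    intro i
    simp [wordProd]
  | succ n ih =>
    by_cases h1 : g = 1
    · subst h1; intro i; simp
    obtain ⟨u, hu, t, rfl, hl⟩ := exists_wordLength_succ hL.norm hg h1
    have e1 : (u * reflEquiv (hL.norm t)) z - z = (u z - z) + B (v t) z • u (v t) := by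
      simp only [LinearEquiv.mul_apply, reflEquiv_apply, map_add, map_smul]
      module
    rw [e1]
    exact add_mem_posCone (ih u hu (by omega)) (smul_mem_posCone
      (mem_posCone_of_wordLength_le hL _ u hu le_rfl t (by omega)) (hz t))

/-- The open chamber meets each orbit at most once, with trivial stabilizers. -/
theorem eq_one_of_strictlyDominant {v : Module.Basis ι ℝ V} (hL : IsSimplyLaced B v) {z : V}
    (hz : ∀ i, 0 < B (v i) z) {g : V ≃ₗ[ℝ] V} (hg : g ∈ reflGroup B (Set.range v))
    (hgz : ∀ i, 0 < B (v i) (g z)) : g = 1 := by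
  have h1 := sub_mem_posCone hL (fun i => (hz i).le) g hg
  have h2 := sub_mem_posCone hL (fun i => (hgz i).le) g⁻¹ (inv_mem hg)
  have e : g⁻¹ (g z) = z := g.symm_apply_apply z
  rw [e, ← neg_sub] at h2
  have h3 := eq_zero_of_mem_posCone h1 h2
  -- Both differences lie in the cone, so `g z = z`. For a non-trivial `g` the last letter
  -- contributes a strictly positive multiple of the positive root `u(v_t)`, which nothing can
  -- cancel.
  by_contra hne
  obtain ⟨u, hu, t, rfl, hl⟩ := exists_wordLength_succ hL.norm hg hne
  have e1 : (u * reflEquiv (hL.norm t)) z - z = (u z - z) + B (v t) z • u (v t) := by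
    simp only [LinearEquiv.mul_apply, reflEquiv_apply, map_add, map_smul]
    module
  have h4 := sub_mem_posCone hL (fun i => (hz i).le) u hu
  have h5 := mem_posCone_of_wordLength_le hL _ u hu le_rfl t (by omega)
  have h6 : u (v t) = 0 := by
    refine eq_zero_of_mem_posCone h5 ?_
    have : -u (v t) = (B (v t) z)⁻¹ • (u z - z) := by
      rw [e1] at h3
      rw [eq_neg_of_add_eq_zero_left h3, smul_neg, smul_smul, inv_mul_cancel₀ (hz t).ne', one_smul]
    rw [this]
    exact smul_mem_posCone h4 (inv_nonneg.mpr (hz t).le)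
  exact v.ne_zero t ((map_eq_zero_iff u u.injective).mp h6)

end Coxeter

/-! ### Integrality of orbits and representatives in the chamber -/

section Chamber

variable {V : Type*} [AddCommGroup V] [Module ℝ V] {B : LinearMap.BilinForm ℝ V} {ι : Type*}

theorem repr_eq_bilin_dual [Fintype ι] [DecidableEq ι] {v : Module.Basis ι ℝ V} {w : ι → V}
    (hw : ∀ i k, B (v k) (w i) = if k = i then 1 else 0) (x : V) (i : ι) :
    v.repr x i = B x (w i) := by
  conv_rhs => rw [← v.sum_repr x]
  simp only [map_sum, LinearMap.sum_apply, map_smul, LinearMap.smul_apply, hw, smul_eq_mul, mul_ite,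
    mul_one, mul_zero, Finset.sum_ite_eq', Finset.mem_univ, if_true]

theorem exists_int_repr_of_mem_closure {v : Module.Basis ι ℝ V} {x : V}
    (hx : x ∈ AddSubgroup.closure (Set.range v)) (i : ι) : ∃ k : ℤ, v.repr x i = k := by
  classical
  induction hx using AddSubgroup.closure_induction with
  | mem x hx =>
    obtain ⟨j, rfl⟩ := hx
    rw [v.repr_self, Finsupp.single_apply]
    exact ⟨if j = i then 1 else 0, by push_cast; rfl⟩
  | zero => exact ⟨0, by simp⟩
  | add x y _ _ hx hy =>
    obtain ⟨a, ha⟩ := hx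
    obtain ⟨b, hb⟩ := hy
    exact ⟨a + b, by simp [ha, hb]⟩
  | neg x _ hx =>
    obtain ⟨a, ha⟩ := hx
    exact ⟨-a, by simp [ha]⟩

theorem exists_int_bilin_of_mem_closure {v : ι → V} (hL : IsSimplyLaced B v) {x : V}
    (hx : x ∈ AddSubgroup.closure (Set.range v)) (i : ι) : ∃ k : ℤ, B (v i) x = k := by
  induction hx using AddSubgroup.closure_induction with
  | mem x hx =>
    obtain ⟨j, rfl⟩ := hx
    by_cases hij : i = j
    · exact ⟨-2, by rw [hij, hL.norm]; norm_num⟩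
    · rcases hL.edge i j hij with h | h
      · exact ⟨0, by rw [h]; norm_num⟩
      · exact ⟨1, by rw [h]; norm_num⟩
  | zero => exact ⟨0, by simp⟩
  | add x y _ _ hx hy =>
    obtain ⟨a, ha⟩ := hx
    obtain ⟨b, hb⟩ := hy
    exact ⟨a + b, by simp [ha, hb]⟩
  | neg x _ hx =>
    obtain ⟨a, ha⟩ := hx
    exact ⟨-a, by simp [ha]⟩

/-- If `z` has integral products with the nodes, its orbit lies in its class modulo the lattice. -/
theorem sub_mem_closure_of_int {v : ι → V} (hL : IsSimplyLaced B v) {z : V}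
    (hz : ∀ i, ∃ k : ℤ, B (v i) z = k) :
    ∀ g ∈ reflGroup B (Set.range v), g z - z ∈ AddSubgroup.closure (Set.range v) := by
  refine reflGroup_induction hL.norm (by simp) fun i g ih => ?_
  obtain ⟨a, ha⟩ := hz i
  obtain ⟨b, hb⟩ := exists_int_bilin_of_mem_closure hL ih i
  have e : (reflEquiv (hL.norm i) * g) z - z = (g z - z) + (a + b) • v i := by
    have : B (v i) (g z) = ((a + b : ℤ) : ℝ) := by
      rw [map_sub, ha] at hb
      push_cast
      linarith
    rw [LinearEquiv.mul_apply, reflEquiv_apply, this, Int.cast_smul_eq_zsmul]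
    abel
  rw [e]
  exact add_mem ih (zsmul_mem (AddSubgroup.subset_closure (Set.mem_range_self i)) _)

theorem map_mem_closure {v : ι → V} (hL : IsSimplyLaced B v) {z : V}
    (hz : z ∈ AddSubgroup.closure (Set.range v)) {g : V ≃ₗ[ℝ] V}
    (hg : g ∈ reflGroup B (Set.range v)) : g z ∈ AddSubgroup.closure (Set.range v) := by
  have := add_mem (sub_mem_closure_of_int hL (exists_int_bilin_of_mem_closure hL hz) g hg) hz
  rwa [sub_add_cancel] at this

/-- Forward vectors `z` with `y·z ≤ c` form a bounded set. Cauchy-Schwarz on the orthogonal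
complement of `y` bounds the component `p` of `z·u`, and `|p| ≤ 1 + p²` avoids a square root. -/
theorem abs_bilin_le_of_forward (hB : IsHyperbolic B) {y z : V} (u : V) {c : ℝ} (hy : 0 < B y y)
    (hz : 0 < B z z) (h0 : 0 < B y z) (hc : B y z ≤ c) :
    |B z u| ≤ 1 + c ^ 2 / B y y * (-(B u u - B y u ^ 2 / B y y)) + c * |B y u| / B y y := by
  set Y := B y y with hY
  have hYne : Y ≠ 0 := hy.ne'
  have ea : B y (z - (B y z / Y) • y) = 0 := by
    rw [map_sub, map_smul, smul_eq_mul, ← hY]; field_simp; ring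
  have eb : B y (u - (B y u / Y) • y) = 0 := by
    rw [map_sub, map_smul, smul_eq_mul, ← hY]; field_simp; ring
  have cs := hB.sq_le_of_orthogonal hy ea eb
  have nb := hB.nonpos hy eb
  have e1 : B (z - (B y z / Y) • y) (u - (B y u / Y) • y) = B z u - B y z * B y u / Y := by
    simp only [map_sub, map_smul, LinearMap.sub_apply, LinearMap.smul_apply, smul_eq_mul,
      hB.symm z y, ← hY]
    field_simp; ring
  have e2 : B (z - (B y z / Y) • y) (z - (B y z / Y) • y) = B z z - B y z ^ 2 / Y := by
    simp only [map_sub, map_smul, LinearMap.sub_apply, LinearMap.smul_apply, smul_eq_mul,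
      hB.symm z y, ← hY]
    field_simp; ring
  have e3 : B (u - (B y u / Y) • y) (u - (B y u / Y) • y) = B u u - B y u ^ 2 / Y := by
    simp only [map_sub, map_smul, LinearMap.sub_apply, LinearMap.smul_apply, smul_eq_mul,
      hB.symm u y, ← hY]
    field_simp; ring
  rw [e1, e2, e3] at cs
  rw [e3] at nb
  set q := B u u - B y u ^ 2 / Y
  set p := B z u - B y z * B y u / Y with hp
  have hcq : B y z ^ 2 / Y ≤ c ^ 2 / Y := by gcongr
  have h1 : p ^ 2 ≤ c ^ 2 / Y * (-q) := by nlinarith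
  have h2 : |p| ≤ 1 + p ^ 2 := by
    rw [abs_le]; constructor <;> nlinarith [sq_nonneg (p - 1), sq_nonneg (p + 1)]
  have h3 : |B y z * B y u / Y| ≤ c * |B y u| / Y := by
    rw [abs_div, abs_mul, abs_of_pos h0, abs_of_pos hy]
    gcongr
  have h4 : B z u = p + B y z * B y u / Y := by rw [hp]; ring
  rw [h4]
  refine (abs_add_le _ _).trans ?_
  linarith

/-- Every vector of the open forward cone can be moved into the closed chamber. -/
theorem exists_dominant [Fintype ι] [DecidableEq ι] (hB : IsHyperbolic B)
    {v : Module.Basis ι ℝ V} (hL : IsSimplyLaced B v) {w : ι → V}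
    (hw : ∀ i k, B (v k) (w i) = if k = i then 1 else 0) {ρ : V}
    (hρL : ρ ∈ AddSubgroup.closure (Set.range v)) (hρ : 0 < B ρ ρ) (hρv : ∀ i, 0 < B (v i) ρ)
    {y : V} (hy : 0 < B y y) (hyρ : 0 < B y ρ) :
    ∃ g ∈ reflGroup B (Set.range v), ∀ i, 0 ≤ B (v i) (g y) := by
  -- The orbit of `ρ` is integral and a sublevel set of `z ↦ y·z` in it is bounded, hence finite, so
  -- a minimizer `g ρ` exists.
  set S : Set V := {z | (∃ g ∈ reflGroup B (Set.range v), z = g ρ) ∧ B y z ≤ B y ρ} with hS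
  have hfin : S.Finite := by
    set M : ι → ℤ := fun i => ⌈1 + B y ρ ^ 2 / B y y *
      (-(B (w i) (w i) - B y (w i) ^ 2 / B y y)) + B y ρ * |B y (w i)| / B y y⌉ with hM
    refine ((Set.finite_Icc (-M) M).image fun k : ι → ℤ => ∑ i, (k i : ℝ) • v i).subset ?_
    rintro z ⟨⟨g, hg, rfl⟩, hz⟩
    choose k hk using exists_int_repr_of_mem_closure (map_mem_closure hL hρL hg)
    have hb : ∀ i, |(k i : ℝ)| ≤ M i := fun i => by
      rw [← hk i, repr_eq_bilin_dual hw]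
      refine (abs_bilin_le_of_forward hB (w i) hy ?_ ?_ hz).trans (Int.le_ceil _)
      · rwa [reflGroup_isometry hB.symm hL.norm g hg]
      · rw [hB.symm]
        exact reflGroup_forward hB hL.norm hy hρ (by rwa [hB.symm]) g hg
    refine ⟨k, ⟨fun i => ?_, fun i => ?_⟩, ?_⟩
    · have := (abs_le.mp (hb i)).1
      rw [Pi.neg_apply]
      exact_mod_cast this
    · exact_mod_cast (abs_le.mp (hb i)).2
    · simp only [← hk]
      exact v.sum_repr _
  have hne : S.Nonempty := ⟨ρ, ⟨1, one_mem _, rfl⟩, le_rfl⟩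
  obtain ⟨z, ⟨⟨g, hg, rfl⟩, hz⟩, hmin⟩ := Set.exists_min_image S (fun z => B y z) hfin hne
  refine ⟨g⁻¹, inv_mem hg, fun i => ?_⟩
  rw [hB.symm, inv_apply_bilin hB.symm hL.norm hg]
  -- The competitor `g R_i ρ = g ρ + (v_i·ρ) g(v_i)` with `v_i·ρ > 0` turns minimality into
  -- `y·g(v_i) ≥ 0`.
  have hm : B y (g ρ) ≤ B y ((g * reflEquiv (hL.norm i)) ρ) := by
    by_cases h : B y ((g * reflEquiv (hL.norm i)) ρ) ≤ B y ρ
    · exact hmin _ ⟨⟨_, mul_mem hg (reflEquiv_mem (hL.norm i) ⟨i, rfl⟩), rfl⟩, h⟩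
    · linarith
  rw [LinearEquiv.mul_apply, reflEquiv_apply, map_add, map_smul, map_add, map_smul,
    smul_eq_mul] at hm
  have := hρv i
  by_contra! hcon
  nlinarith

end Chamber

/-! ### Integral coordinates for computation with Gram matrices -/

section IntegerCoordinates

variable {V : Type*} [AddCommGroup V] [Module ℝ V] {B : LinearMap.BilinForm ℝ V} {ι : Type*}
  [Fintype ι]

/-- The combination of the vectors `v` with integral coefficients `X`. -/
noncomputable def intComb (v : ι → V) (X : ι → ℤ) : V := ∑ i, (X i : ℝ) • v i

theorem bilin_intComb {v : ι → V} {G : Matrix ι ι ℤ} (hG : ∀ i j, B (v i) (v j) = (G i j : ℝ))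
    (X Y : ι → ℤ) : B (intComb v X) (intComb v Y) = ((X ⬝ᵥ (G.mulVec Y) : ℤ) : ℝ) := by
  simp only [intComb, map_sum, LinearMap.sum_apply, map_smul, LinearMap.smul_apply, smul_eq_mul,
    hG, dotProduct, Matrix.mulVec, Int.cast_sum, Int.cast_mul, Finset.mul_sum]
  rw [Finset.sum_comm]
  refine Finset.sum_congr rfl fun i _ => Finset.sum_congr rfl fun j _ => by ring

theorem intComb_single [DecidableEq ι] (v : ι → V) (i : ι) : intComb v (Pi.single i 1) = v i := by
  rw [intComb, Finset.sum_eq_single i]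
  · simp
  · intro j _ hj; simp [hj]
  · simp

theorem intComb_add (v : ι → V) (X Y : ι → ℤ) :
    intComb v (X + Y) = intComb v X + intComb v Y := by
  simp [intComb, add_smul, Finset.sum_add_distrib]

theorem intComb_smul (v : ι → V) (c : ℤ) (X : ι → ℤ) :
    intComb v (c • X) = (c : ℝ) • intComb v X := by
  simp [intComb, Finset.smul_sum, mul_smul]

theorem intComb_mem_closure (v : ι → V) (X : ι → ℤ) :
    intComb v X ∈ AddSubgroup.closure (Set.range v) :=
  sum_mem fun i _ => by
    rw [Int.cast_smul_eq_zsmul]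
    exact zsmul_mem (AddSubgroup.subset_closure (Set.mem_range_self i)) _

theorem repr_intComb (v : Module.Basis ι ℝ V) (X : ι → ℤ) (i : ι) :
    v.repr (intComb v X) i = X i := by
  classical
  simp [intComb, Finsupp.single_apply]

theorem bilin_single_intComb [DecidableEq ι] {v : ι → V} {G : Matrix ι ι ℤ}
    (hG : ∀ i j, B (v i) (v j) = (G i j : ℝ)) (i : ι) (Y : ι → ℤ) :
    B (v i) (intComb v Y) = ((G.mulVec Y i : ℤ) : ℝ) := by
  rw [← intComb_single v i, bilin_intComb hG]
  simp

theorem reflEquiv_intComb [DecidableEq ι] {v : ι → V} {G : Matrix ι ι ℤ}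
    (hG : ∀ i j, B (v i) (v j) = (G i j : ℝ)) (i : ι) (hi : B (v i) (v i) = -2) (Y : ι → ℤ) :
    reflEquiv hi (intComb v Y) = intComb v (Y + G.mulVec Y i • Pi.single i 1) := by
  rw [reflEquiv_apply, bilin_single_intComb hG, intComb_add, intComb_smul, intComb_single]

theorem HasCoxeterGraph.isSimplyLaced {v : Module.Basis ι ℝ V} {G : SimpleGraph ι}
    (h : HasCoxeterGraph B v G) : IsSimplyLaced B v := by
  refine ⟨bilin_symm_of_basis v fun i j => ?_, fun i => ?_, fun i j hij => ?_⟩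
  · rw [h, h]
    simp only [incidenceMatrix, Matrix.of_apply]
    by_cases hij : i = j
    · rw [if_pos hij, if_pos hij.symm]
    · rw [if_neg hij, if_neg (Ne.symm hij)]
      by_cases ha : G.Adj i j
      · rw [if_pos ha, if_pos ha.symm]
      · rw [if_neg ha, if_neg fun h => ha h.symm]
  · simp [h i i, incidenceMatrix]
  · rw [h i j]
    simp only [incidenceMatrix, Matrix.of_apply, if_neg hij]
    split_ifs <;> simp

end IntegerCoordinates

/-! ### The nine-node graph: Gram matrix, weights and signature -/

section GraphN9

/-- The Gram matrix of the nodes of `graphN9`. -/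
def gramN9 : Matrix (Fin 9) (Fin 9) ℤ := Matrix.of fun i j =>
  if i = j then -2 else
    if (i.val + 1 = j.val ∨ (i = 0 ∧ j = 6)) ∨ (j.val + 1 = i.val ∨ (j = 0 ∧ i = 6)) then 1 else 0

/-- `14` times the inverse of `gramN9`. -/
def dualN9 : Matrix (Fin 9) (Fin 9) ℤ :=
  !![9, 11, 13, 15, 17, 19, 21, 14, 7;
    11, 1, 5, 9, 13, 17, 21, 14, 7;
    13, 5, -3, 3, 9, 15, 21, 14, 7;
    15, 9, 3, -3, 5, 13, 21, 14, 7;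
    17, 13, 9, 5, 1, 11, 21, 14, 7;
    19, 17, 15, 13, 11, 9, 21, 14, 7;
    21, 21, 21, 21, 21, 21, 21, 14, 7;
    14, 14, 14, 14, 14, 14, 14, 0, 0;
    7, 7, 7, 7, 7, 7, 7, 0, -7]

/-- The coefficients of an orthogonal basis of the span of the nodes of `graphN9`. -/
def orthoN9 : Matrix (Fin 9) (Fin 9) ℤ := Matrix.of fun i j =>
  if i = 0 then dualN9 0 j else if j ≤ i then (j.val : ℤ) else 0

theorem gramN9_mulVec_dual : ∀ i k, gramN9.mulVec (dualN9 i) k = if k = i then 14 else 0 := by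
  decide +kernel

/-- The nodes `1, …, 8` form a path, and the partial sums `∑ j v_j` are its Gram-Schmidt vectors;
row `0` is a multiple of the weight `w_0`, which is orthogonal to all of these nodes. -/
theorem gramN9_ortho : ∀ i j, i ≠ j → orthoN9 i ⬝ᵥ gramN9.mulVec (orthoN9 j) = 0 := by
  decide +kernel

theorem gramN9_ortho_zero : 0 < orthoN9 0 ⬝ᵥ gramN9.mulVec (orthoN9 0) := by
  decide +kernel

theorem gramN9_ortho_neg : ∀ i, i ≠ 0 → orthoN9 i ⬝ᵥ gramN9.mulVec (orthoN9 i) < 0 := by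
  decide +kernel

variable {V : Type*} [AddCommGroup V] [Module ℝ V] {B : LinearMap.BilinForm ℝ V}

theorem incidenceMatrix_graphN9 (i j : Fin 9) :
    incidenceMatrix graphN9 i j = ((gramN9 i j : ℤ) : ℝ) := by
  simp only [incidenceMatrix, gramN9, Matrix.of_apply, graphN9, SimpleGraph.fromRel_adj]
  by_cases hij : i = j
  · simp [hij]
  · simp only [ne_eq, hij, not_false_eq_true, true_and]
    push_cast
    rfl

theorem HasCoxeterGraph.gramN9 {v : Fin 9 → V} (h : HasCoxeterGraph B v graphN9) (i j : Fin 9) :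
    B (v i) (v j) = ((gramN9 i j : ℤ) : ℝ) := by
  rw [h, incidenceMatrix_graphN9]

/-- The weights of the Coxeter graph `graphN9`. -/
noncomputable def weightN9 (v : Fin 9 → V) (i : Fin 9) : V := (14 : ℝ)⁻¹ • intComb v (dualN9 i)

theorem bilin_node_weightN9 {v : Fin 9 → V} (h : HasCoxeterGraph B v graphN9) (i k : Fin 9) :
    B (v k) (weightN9 v i) = if k = i then 1 else 0 := by
  rw [weightN9, map_smul, bilin_single_intComb h.gramN9, gramN9_mulVec_dual]
  split_ifs <;> simp

theorem dualN9_gram : ∀ i j, dualN9 i ⬝ᵥ gramN9.mulVec (dualN9 j) = 14 * dualN9 i j := by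
  decide +kernel

theorem bilin_weightN9 {v : Fin 9 → V} (h : HasCoxeterGraph B v graphN9) (i j : Fin 9) :
    B (weightN9 v i) (weightN9 v j) = (dualN9 i j : ℝ) / 14 := by
  simp only [weightN9, map_smul, LinearMap.smul_apply, bilin_intComb h.gramN9, dualN9_gram,
    smul_eq_mul]
  push_cast
  ring

theorem HasCoxeterGraph.isLorentzN9 {v : Module.Basis (Fin 9) ℝ V}
    (h : HasCoxeterGraph B v graphN9) : IsLorentz 8 B := by
  refine isLorentz_of_orthogonal (by simp [Module.finrank_eq_card_basis v])
    (fun i => intComb v (orthoN9 i)) (fun i j hij => ?_) ?_ (fun i hi => ?_)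
  · rw [bilin_intComb h.gramN9, gramN9_ortho i j hij, Int.cast_zero]
  · rw [bilin_intComb h.gramN9]
    exact_mod_cast gramN9_ortho_zero
  · rw [bilin_intComb h.gramN9]
    exact_mod_cast gramN9_ortho_neg i hi

end GraphN9

/-! ### Normalization and tangent pairs -/

section Packing

variable {V : Type*} [AddCommGroup V] [Module ℝ V] {B : LinearMap.BilinForm ℝ V}

theorem norm_normalize {x : V} (hx : B x x < 0) : B (normalize B x) (normalize B x) = -1 := by
  simp only [normalize, map_smul, LinearMap.smul_apply, smul_eq_mul]
  rw [← mul_assoc, ← mul_inv, Real.mul_self_sqrt (by linarith), inv_neg, neg_mul,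
    inv_mul_cancel₀ hx.ne]

theorem normalize_smul {c : ℝ} (hc : 0 < c) (x : V) : normalize B (c • x) = normalize B x := by
  have h : -(B (c • x) (c • x)) = c ^ 2 * -(B x x) := by
    simp only [map_smul, LinearMap.smul_apply, smul_eq_mul]; ring
  rw [normalize, normalize, h, Real.sqrt_mul (sq_nonneg c), Real.sqrt_sq hc.le, smul_smul, mul_inv,
    mul_right_comm, inv_mul_cancel₀ hc.ne', one_mul]

/-- If `w` and `w'` are tangent planes facing away from each other, and the plane `e` does not cut
into either of them, then neither do the half-spaces of `e` and `w` meet. -/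
theorem IsHyperbolic.nonneg_bilin_add (hB : IsHyperbolic B) {D e w w' y : V} {a : ℝ}
    (hD : 0 < B D D) (ha : 0 < a) (he : B e e = -1) (hw : B w w = -a ^ 2)
    (hw' : B w' w' = -a ^ 2) (hww' : B w w' = a ^ 2) (hDw : 0 < B (w + w') D)
    (h1 : a ≤ B e w) (h2 : a ≤ B e w') (hy : 0 < B y y) (hyD : 0 < B y D) :
    0 ≤ B y (a • e + w) := by
  have hf : 0 ≤ B (a • e + w) (a • e + w) := by
    simp only [map_add, map_smul, LinearMap.add_apply, LinearMap.smul_apply, smul_eq_mul, he, hw,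
      hB.symm w e]
    nlinarith
  have hq : B (w + w') (w + w') = 0 := by
    simp only [map_add, LinearMap.add_apply, hw, hw', hww', hB.symm w' w]
    ring
  rcases lt_trichotomy (B (a • e + w) D) 0 with h | h | h
  -- The tangent partner `w'` decides the direction of `a e + w`: `w + w'` is isotropic and forward,
  -- so a backward `a e + w` would give `e·w + e·w' ≤ 0`.
  · have h3 := hB.nonneg_of_forward hD (x := -(a • e + w)) (y := w + w')
      (by rwa [map_neg, map_neg, LinearMap.neg_apply, neg_neg])
      hq.ge (by rw [map_neg, LinearMap.neg_apply]; linarith) hDw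
    simp only [map_add, map_neg, map_smul, LinearMap.neg_apply, LinearMap.add_apply,
      LinearMap.smul_apply, smul_eq_mul, hw, hww'] at h3
    nlinarith
  · have : a • e + w = 0 := by
      by_contra hne
      exact hB.ne_zero_of_forward hD hf hne h
    rw [this, map_zero]
  · exact hB.nonneg_of_forward hD hy.le hf hyD h

end Packing

/-! ### Maximality of the nine-node packing -/

section GraphN9

variable {V : Type*} [AddCommGroup V] [Module ℝ V] {B : LinearMap.BilinForm ℝ V}

theorem repr_eq_bilin_weightN9 {v : Module.Basis (Fin 9) ℝ V} (h : HasCoxeterGraph B v graphN9)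
    (x : V) (i : Fin 9) : v.repr x i = B x (weightN9 v i) :=
  repr_eq_bilin_dual (bilin_node_weightN9 h) x i

theorem repr_weightN9 (v : Module.Basis (Fin 9) ℝ V) (i j : Fin 9) :
    v.repr (weightN9 v i) j = (dualN9 i j : ℝ) / 14 := by
  rw [weightN9, map_smul, Finsupp.smul_apply, repr_intComb, smul_eq_mul]
  ring

theorem isWeight_iff_eq_weightN9 {v : Module.Basis (Fin 9) ℝ V} (h : HasCoxeterGraph B v graphN9)
    (i : Fin 9) (w : V) : IsWeight B v i w ↔ w = weightN9 v i := by
  have hs := h.isSimplyLaced.symm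
  constructor
  · rintro ⟨h1, h2⟩
    have h3 : ∀ j, B (v j) (w - weightN9 v i) = 0 := by
      intro j
      rw [map_sub, bilin_node_weightN9 h, hs]
      split_ifs with hj
      · rw [hj, h1, sub_self]
      · rw [h2 j hj, sub_self]
    refine sub_eq_zero.mp (v.repr.injective (Finsupp.ext fun j => ?_))
    rw [repr_eq_bilin_weightN9 h, hs, ← v.sum_repr (weightN9 v j), map_sum, LinearMap.sum_apply]
    simp [h3]
  · rintro rfl
    refine ⟨?_, fun j hj => ?_⟩
    · rw [hs, bilin_node_weightN9 h, if_pos rfl]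
    · rw [hs, bilin_node_weightN9 h, if_neg hj]

theorem dualN9_neg_iff : ∀ i, dualN9 i i < 0 ↔ i = 2 ∨ i = 3 ∨ i = 8 := by
  decide +kernel

theorem norm_weightN9_neg_iff {v : Fin 9 → V} (h : HasCoxeterGraph B v graphN9) (i : Fin 9) :
    B (weightN9 v i) (weightN9 v i) < 0 ↔ i = 2 ∨ i = 3 ∨ i = 8 := by
  rw [bilin_weightN9 h, ← dualN9_neg_iff, div_neg_iff]
  constructor
  · rintro (h | h)
    · norm_num at h
    · exact_mod_cast h.1
  · intro h
    exact Or.inr ⟨by exact_mod_cast h, by norm_num⟩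

theorem mem_coxeterPackingN9 {v : Module.Basis (Fin 9) ℝ V} (h : HasCoxeterGraph B v graphN9)
    {x : V} : x ∈ coxeterPacking B v ↔ ∃ g ∈ reflGroup B (Set.range v), ∃ i,
      (i = 2 ∨ i = 3 ∨ i = 8) ∧ x = normalize B (g (weightN9 v i)) := by
  constructor
  · rintro ⟨_, ⟨g, hg, w, ⟨⟨i, hi⟩, hw⟩, rfl⟩, rfl⟩
    rw [isWeight_iff_eq_weightN9 h] at hi
    subst hi
    exact ⟨g, hg, i, (norm_weightN9_neg_iff h i).mp hw, rfl⟩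
  · rintro ⟨g, hg, i, hi, rfl⟩
    exact ⟨_, ⟨g, hg, _, ⟨⟨i, (isWeight_iff_eq_weightN9 h i _).mpr rfl⟩,
      (norm_weightN9_neg_iff h i).mpr hi⟩, rfl⟩, rfl⟩

/-- `14` times the sum of the weights, in integral coordinates. -/
def rhoN9 (j : Fin 9) : ℤ := ∑ i, dualN9 i j

theorem gramN9_rho : ∀ i, gramN9.mulVec rhoN9 i = 14 := by decide +kernel

theorem norm_rhoN9 : 0 < rhoN9 ⬝ᵥ gramN9.mulVec rhoN9 := by decide +kernel

theorem rhoN9_dual_zero : 0 < rhoN9 ⬝ᵥ gramN9.mulVec (dualN9 0) := by decide +kernel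

theorem norm_weightN9_zero {v : Fin 9 → V} (h : HasCoxeterGraph B v graphN9) :
    0 < B (weightN9 v 0) (weightN9 v 0) := by
  rw [bilin_weightN9 h]
  norm_num [dualN9]

theorem exists_dominantN9 {v : Module.Basis (Fin 9) ℝ V} (h : HasCoxeterGraph B v graphN9) {y : V}
    (hy : 0 < B y y) (hyD : 0 < B y (weightN9 v 0)) :
    ∃ g ∈ reflGroup B (Set.range v), ∀ i, 0 ≤ B (v i) (g y) := by
  have hB := h.isLorentzN9.isHyperbolic
  have hρ : 0 < B (intComb v rhoN9) (intComb v rhoN9) := by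
    rw [bilin_intComb h.gramN9]; exact_mod_cast norm_rhoN9
  refine exists_dominant hB h.isSimplyLaced (bilin_node_weightN9 h)
    (ρ := intComb v rhoN9) (intComb_mem_closure _ _) hρ (fun i => ?_) hy ?_
  · rw [bilin_single_intComb h.gramN9, gramN9_rho]; norm_num
  · refine hB.pos_of_forward (norm_weightN9_zero h) hy hρ.le hyD ?_
    rw [weightN9, map_smul, bilin_intComb h.gramN9]
    exact mul_pos (by norm_num) (by exact_mod_cast rhoN9_dual_zero)

theorem dualN9_eight_le : ∀ j, 2 * dualN9 8 j ≤ 14 := by decide +kernel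

/-- Rows of the inverse Gram matrix are compared entrywise because a vector of the chamber has
non-negative products with the nodes: its product with `w_8` then bounds its product with every
weight of non-negative norm. -/
theorem dualN9_eight_le_seven_mul :
    ∀ i, i ≠ 2 → i ≠ 3 → i ≠ 8 → ∀ j, dualN9 8 j ≤ 7 * dualN9 i j := by decide +kernel

/-- The chamber, cut off by the planes of the weights of negative norm, lies well within the
forward cone. -/
theorem le_norm_of_dominantN9 {v : Module.Basis (Fin 9) ℝ V} (h : HasCoxeterGraph B v graphN9)
    {y : V} (hy : ∀ i, 0 ≤ B (v i) y) {m : ℝ} (hm : 0 ≤ m) (h2 : m ≤ B y (weightN9 v 2))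
    (h3 : m ≤ B y (weightN9 v 3)) (h8 : m ≤ B y (weightN9 v 8)) : 2 / 7 * m ^ 2 ≤ B y y := by
  have hs := h.isSimplyLaced.symm
  have hw : ∀ i, B y (weightN9 v i) = ∑ j, (dualN9 i j : ℝ) / 14 * B (v j) y := by
    intro i
    conv_lhs => rw [← v.sum_repr (weightN9 v i)]
    rw [map_sum]
    refine Finset.sum_congr rfl fun j _ => ?_
    rw [map_smul, smul_eq_mul, repr_weightN9, hs y]
  have hall : ∀ i, m / 7 ≤ B y (weightN9 v i) := by
    intro i
    by_cases hi2 : i = 2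
    · subst hi2; linarith
    by_cases hi3 : i = 3
    · subst hi3; linarith
    by_cases hi8 : i = 8
    · subst hi8; linarith
    have : B y (weightN9 v 8) ≤ 7 * B y (weightN9 v i) := by
      rw [hw, hw, Finset.mul_sum]
      refine Finset.sum_le_sum fun j _ => ?_
      rw [← mul_assoc]
      refine mul_le_mul_of_nonneg_right ?_ (hy j)
      have : (dualN9 8 j : ℝ) ≤ 7 * dualN9 i j := by
        exact_mod_cast dualN9_eight_le_seven_mul i hi2 hi3 hi8 j
      linarith
    linarith
  have hsum : 2 * m ≤ ∑ j, B (v j) y := by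
    have : 2 * B y (weightN9 v 8) ≤ ∑ j, B (v j) y := by
      rw [hw, Finset.mul_sum]
      refine Finset.sum_le_sum fun j _ => ?_
      have h1 : (2 * dualN9 8 j : ℝ) ≤ 14 := by exact_mod_cast dualN9_eight_le j
      have := hy j
      nlinarith
    linarith
  -- Each factor `y·w_i` is at least `m/7` and the numbers `v_i·y` sum to at least `2m`; hence the
  -- constant `2/7`.
  have hyy : B y y = ∑ i, B y (weightN9 v i) * B (v i) y := by
    have : B y y = B y (∑ i, v.repr y i • v i) := by rw [v.sum_repr]
    rw [this, map_sum]
    refine Finset.sum_congr rfl fun i _ => ?_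
    rw [map_smul, smul_eq_mul, repr_eq_bilin_weightN9 h, hs y (v i)]
  have h4 : ∑ i, m / 7 * B (v i) y ≤ B y y := by
    rw [hyy]
    exact Finset.sum_le_sum fun i _ => mul_le_mul_of_nonneg_right (hall i) (hy i)
  rw [← Finset.mul_sum] at h4
  nlinarith

theorem isMaximal_coxeterPackingN9 {v : Module.Basis (Fin 9) ℝ V}
    (h : HasCoxeterGraph B v graphN9) : IsMaximal B (coxeterPacking B v) := by
  have hB := h.isLorentzN9.isHyperbolic
  have hL := h.isSimplyLaced
  have hs := hB.symm
  intro e₀ he₀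
  by_contra! hcon
  set D := weightN9 v 0 with hDdef
  have hD : 0 < B D D := norm_weightN9_zero h
  set e := normalize B e₀ with hedef
  have he : B e e = -1 := norm_normalize he₀
  have hc : 0 < √(-B e₀ e₀) := Real.sqrt_pos.mpr (by linarith)
  have hcut : ∀ g ∈ reflGroup B (Set.range v), ∀ i, i = 2 ∨ i = 3 ∨ i = 8 →
      √(-B (weightN9 v i) (weightN9 v i)) ≤ B e (g (weightN9 v i)) := by
    intro g hg i hi
    have hneg := (norm_weightN9_neg_iff h i).mpr hi
    have hneg' : B (g (weightN9 v i)) (g (weightN9 v i)) < 0 := by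
      rwa [reflGroup_isometry hs hL.norm g hg]
    have h1 := hcon _ ((mem_coxeterPackingN9 h).mpr ⟨g, hg, i, hi, rfl⟩)
    rw [norm_normalize hneg', mul_neg_one, normalize, map_smul, smul_eq_mul,
      reflGroup_isometry hs hL.norm g hg] at h1
    have hd : 0 < √(-B (weightN9 v i) (weightN9 v i)) := Real.sqrt_pos.mpr (by linarith)
    rw [hedef, normalize, map_smul, LinearMap.smul_apply, smul_eq_mul]
    rw [inv_mul_eq_div, le_div_iff₀ hd] at h1
    rw [inv_mul_eq_div, le_div_iff₀ hc]
    linarith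
  -- a vector deep inside the half-space of `e`
  set D' := D + B D e • e with hD'
  have hD'e : B D' e = 0 := by
    simp only [hD', map_add, map_smul, LinearMap.add_apply, LinearMap.smul_apply, smul_eq_mul, he]
    ring
  have hD'D' : B D' D' = B D D + B D e ^ 2 := by
    conv_lhs => rw [hD', map_add, map_smul, ← hD', hD'e]
    simp only [hD', map_add, map_smul, LinearMap.add_apply, LinearMap.smul_apply, smul_eq_mul,
      hs e D]
    ring
  have hD'D : B D' D = B D D + B D e ^ 2 := by
    simp only [hD', map_add, map_smul, LinearMap.add_apply, LinearMap.smul_apply, smul_eq_mul,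
      hs e D]
    ring
  have hpos : 0 < B D' D' := by rw [hD'D']; positivity
  set c := √(B D' D') with hcdef
  have hc0 : 0 < c := Real.sqrt_pos.mpr hpos
  have hcc : c * c = B D' D' := Real.mul_self_sqrt hpos.le
  -- The first summand is a unit vector orthogonal to `e`, so `y·e = -99/100` and `y·y = 1 -
  -- (99/100)²`: a point far behind the plane of `e`, whose norm is positive but small.
  set y := c⁻¹ • D' + (99 / 100 : ℝ) • e with hy
  have hye : B y e = -(99 / 100) := by
    simp only [hy, map_add, map_smul, LinearMap.add_apply, LinearMap.smul_apply, smul_eq_mul, he,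
      hD'e]
    ring
  have hyD' : B y D' = c := by
    simp only [hy, map_add, map_smul, LinearMap.add_apply, LinearMap.smul_apply, smul_eq_mul,
      hs e D', hD'e, ← hcc]
    field_simp
    ring
  have hyy : B y y = 199 / 10000 := by
    conv_lhs => rw [hy, map_add, map_smul, map_smul, ← hy, smul_eq_mul, smul_eq_mul, hyD', hye]
    rw [inv_mul_cancel₀ hc0.ne']
    norm_num
  have hyy0 : 0 < B y y := by rw [hyy]; norm_num
  have hyD : 0 < B y D := by
    refine hB.pos_of_forward hpos hyy0 hD.le (by rw [hyD']; exact hc0) ?_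
    rw [hs, hD'D, ← hD'D']; exact hpos
  obtain ⟨g, hg, hdom⟩ := exists_dominantN9 h hyy0 hyD
  have hiso := reflGroup_isometry hs hL.norm g hg
  have hge : B (g e) (g e) = -1 := by rw [hiso, he]
  have hgcut : ∀ k ∈ reflGroup B (Set.range v), ∀ i, i = 2 ∨ i = 3 ∨ i = 8 →
      √(-B (weightN9 v i) (weightN9 v i)) ≤ B (g e) (k (weightN9 v i)) := by
    intro k hk i hi
    have := hcut (g⁻¹ * k) (mul_mem (inv_mem hg) hk) i hi
    rw [LinearEquiv.mul_apply, ← hiso e] at this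
    have e1 : g (g⁻¹ (k (weightN9 v i))) = k (weightN9 v i) := g.apply_symm_apply _
    rwa [e1] at this
  have hgy : 0 < B (g y) (g y) := by rwa [hiso]
  have hgyD : 0 < B (g y) D := reflGroup_forward hB hL.norm hD hyy0 hyD g hg
  have hgye : B (g y) (g e) = -(99 / 100) := by rw [hiso, hye]
  -- Here `w'` is a packing sphere tangent to `w_i`: `w_2` and `w_3` serve each other, and `w_8` is
  -- paired with its reflection in `v_8`. The common lengths `√(3/14)` and `√(1/2)` exceed `2/5`,
  -- and `99/100 · 2/5 = 99/250`.
  have hfar : ∀ i w' a, (i = 2 ∨ i = 3 ∨ i = 8) → 2 / 5 ≤ a →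
      B (weightN9 v i) (weightN9 v i) = -a ^ 2 → B w' w' = -a ^ 2 →
      B (weightN9 v i) w' = a ^ 2 → 0 < B (weightN9 v i + w') D → a ≤ B (g e) w' →
      99 / 250 ≤ B (g y) (weightN9 v i) := by
    intro i w' a hi ha h1 h2 h3 h4 h5
    have ha0 : 0 < a := by linarith
    have h6 := hgcut 1 (one_mem _) i hi
    rw [h1, neg_neg, Real.sqrt_sq ha0.le] at h6
    have := hB.nonneg_bilin_add hD ha0 hge h1 h2 h3 h4 h6 h5 hgy hgyD
    rw [map_add, map_smul, smul_eq_mul, hgye] at this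
    linarith
  have ha2 : √(3 / 14 : ℝ) ^ 2 = 3 / 14 := Real.sq_sqrt (by norm_num)
  have ha8 : √(1 / 2 : ℝ) ^ 2 = 1 / 2 := Real.sq_sqrt (by norm_num)
  have hl2 : 2 / 5 ≤ √(3 / 14 : ℝ) := Real.le_sqrt_of_sq_le (by norm_num)
  have hl8 : 2 / 5 ≤ √(1 / 2 : ℝ) := Real.le_sqrt_of_sq_le (by norm_num)
  have n22 : B (weightN9 v 2) (weightN9 v 2) = -(3 / 14) := by
    rw [bilin_weightN9 h]; norm_num [show dualN9 2 2 = -3 from rfl]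
  have n33 : B (weightN9 v 3) (weightN9 v 3) = -(3 / 14) := by
    rw [bilin_weightN9 h]; norm_num [show dualN9 3 3 = -3 from rfl]
  have n23 : B (weightN9 v 2) (weightN9 v 3) = 3 / 14 := by
    rw [bilin_weightN9 h]; norm_num [show dualN9 2 3 = 3 from rfl]
  have n88 : B (weightN9 v 8) (weightN9 v 8) = -(1 / 2) := by
    rw [bilin_weightN9 h]; norm_num [show dualN9 8 8 = -7 from rfl]
  have n88' : B (v 8) (weightN9 v 8) = 1 := by rw [bilin_node_weightN9 h, if_pos rfl]
  have n20 : B (weightN9 v 2) D = 13 / 14 := by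
    rw [hDdef, bilin_weightN9 h]; norm_num [show dualN9 2 0 = 13 from rfl]
  have n30 : B (weightN9 v 3) D = 15 / 14 := by
    rw [hDdef, bilin_weightN9 h]; norm_num [show dualN9 3 0 = 15 from rfl]
  have n80 : B (weightN9 v 8) D = 1 / 2 := by
    rw [hDdef, bilin_weightN9 h]; norm_num [show dualN9 8 0 = 7 from rfl]
  have n80' : B (v 8) D = 0 := by rw [hDdef, bilin_node_weightN9 h, if_neg (by decide)]
  have c2 := hgcut 1 (one_mem _) 2 (by simp)
  have c3 := hgcut 1 (one_mem _) 3 (by simp)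
  have c8 := hgcut (reflEquiv (hL.norm 8)) (reflEquiv_mem _ ⟨8, rfl⟩) 8 (by simp)
  rw [n22, neg_neg] at c2
  rw [n33, neg_neg] at c3
  rw [n88, neg_neg] at c8
  have f2 := hfar 2 (weightN9 v 3) _ (by simp) hl2 (by rw [n22, ha2]) (by rw [n33, ha2])
    (by rw [n23, ha2]) (by rw [map_add, LinearMap.add_apply, n20, n30]; norm_num) c3
  have f3 := hfar 3 (weightN9 v 2) _ (by simp) hl2 (by rw [n33, ha2]) (by rw [n22, ha2])
    (by rw [hs, n23, ha2]) (by rw [map_add, LinearMap.add_apply, n20, n30]; norm_num) c2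
  have f8 := hfar 8 _ _ (by simp) hl8 (by rw [n88, ha8])
    (by rw [reflGroup_isometry hs hL.norm _ (reflEquiv_mem (hL.norm 8) ⟨8, rfl⟩), n88, ha8])
    (by rw [reflEquiv_apply, map_add, map_smul, hs _ (v 8), n88, n88', ha8]; norm_num)
    (by rw [reflEquiv_apply, n88', map_add, map_add, map_smul]
        simp only [LinearMap.add_apply, LinearMap.smul_apply, n80, n80']; norm_num) c8
  -- The contradiction is numerical: `2/7 · (99/250)²` exceeds `199/10000`.
  have := le_norm_of_dominantN9 h hdom (by norm_num) f2 f3 f8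
  rw [hiso, hyy] at this
  norm_num at this

end GraphN9

/-! ### Tangency criterion, an irrationality and lattices -/

section Tangency

variable {V : Type*} [AddCommGroup V] [Module ℝ V] {B : LinearMap.BilinForm ℝ V}

/-- The vector `D`, on the positive side of both planes, is needed to exclude `m = -n`, which
satisfies the same product equations. -/
theorem areTangent_of_bilin {n m D : V} {k : ℝ} (hk : 0 < k)
    (hn : B n n = -k) (hm : B m m = -k) (hnm : B n m = k) (hnD : 0 < B n D) (hmD : 0 < B m D) :
    AreTangent B n m := by
  refine ⟨LinearIndependent.pair_iff.mpr fun a b hab => ?_, ?_⟩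
  · have h1 : B n (a • n + b • m) = 0 := by rw [hab, map_zero]
    have h2 : B (a • n + b • m) D = 0 := by rw [hab, map_zero, LinearMap.zero_apply]
    simp only [map_add, map_smul, LinearMap.add_apply, LinearMap.smul_apply, smul_eq_mul, hn,
      hnm] at h1 h2
    have hba : b = a := by
      have : (b - a) * k = 0 := by linarith
      rcases mul_eq_zero.mp this with h | h
      · linarith
      · exact absurd h hk.ne'
    subst hba
    have : b * (B n D + B m D) = 0 := by linarith
    rcases mul_eq_zero.mp this with h | h
    · exact ⟨h, h⟩
    · linarith
  · rw [hn, hm, hnm, abs_of_pos hk, neg_mul_neg, Real.sqrt_mul_self hk.le]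

theorem AreTangent.ne {n m : V} (h : AreTangent B n m) : n ≠ m := by
  rintro rfl
  have := LinearIndependent.pair_iff.mp h.1 1 (-1) (by simp)
  norm_num at this

/-- Otherwise `3a/b` would be a rational square root of `21`. -/
theorem eq_zero_of_three_mul_sq_eq {a b : ℤ} (h : 3 * a ^ 2 = 7 * b ^ 2) : b = 0 := by
  by_contra hb
  have hirr : Irrational (√(21 : ℕ)) := by
    rw [irrational_sqrt_natCast_iff]
    rintro ⟨r, hr⟩
    have : r ≤ 4 := by nlinarith
    interval_cases r <;> omega
  refine hirr ⟨|3 * (a : ℚ) / b|, ?_⟩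
  have hbR : (b : ℝ) ≠ 0 := by exact_mod_cast hb
  have hR : (3 : ℝ) * a ^ 2 = 7 * b ^ 2 := by exact_mod_cast h
  push_cast
  rw [← Real.sqrt_sq_eq_abs, div_pow, mul_pow]
  congr 1
  field_simp
  linarith

theorem intComb_intComb {ι κ : Type*} [Fintype ι] [Fintype κ] (v : ι → V) (A : Matrix κ ι ℤ)
    (X : κ → ℤ) : intComb (fun k => intComb v (A k)) X = intComb v (Matrix.vecMul X A) := by
  simp only [intComb, Finset.smul_sum, smul_smul, Matrix.vecMul, dotProduct, Int.cast_sum,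
    Int.cast_mul, Finset.sum_smul]
  exact Finset.sum_comm

theorem isLattice_closure_range {n : ℕ} (v : Module.Basis (Fin n) ℝ V) :
    IsLattice (AddSubgroup.closure (Set.range v)) := by
  have hn : n = Module.finrank ℝ V := by rw [Module.finrank_eq_card_basis v, Fintype.card_fin]
  refine ⟨v.reindex (finCongr hn), ?_⟩
  rw [Module.Basis.range_reindex]

end Tangency

/-! ### The nine-node packing: crystallographic, weakly Apollonian, lattice properties -/

section GraphN9

variable {V : Type*} [AddCommGroup V] [Module ℝ V] {B : LinearMap.BilinForm ℝ V}

theorem dualN9_zero_pos : ∀ i, 0 < dualN9 i 0 := by decide +kernel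

/-- The difference `g w_i - w_i` lies in the positive cone, where `w_0` is non-negative, and
`w_i·w_0 > 0` by the table. So `w_0` is on the positive side of every sphere of the packing. -/
theorem bilin_weightN9_zero_pos {v : Module.Basis (Fin 9) ℝ V} (h : HasCoxeterGraph B v graphN9)
    {g : V ≃ₗ[ℝ] V} (hg : g ∈ reflGroup B (Set.range v)) (i : Fin 9) :
    0 < B (g (weightN9 v i)) (weightN9 v 0) := by
  have hL := h.isSimplyLaced
  have h1 := sub_mem_posCone hL (z := weightN9 v i)
    (fun k => by rw [bilin_node_weightN9 h]; split_ifs <;> norm_num) g hg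
  have h2 := bilin_nonneg_of_mem_posCone (B := B) (y := weightN9 v 0) h1
    (fun k => by rw [hL.symm, bilin_node_weightN9 h]; split_ifs <;> norm_num)
  rw [map_sub, hL.symm _ (g _), hL.symm _ (weightN9 v i), bilin_weightN9 h] at h2
  have h3 : (0 : ℝ) < dualN9 i 0 := by exact_mod_cast dualN9_zero_pos i
  linarith

theorem bilin_weightN9_zero_pos_of_mem {v : Module.Basis (Fin 9) ℝ V}
    (h : HasCoxeterGraph B v graphN9) {n : V} (hn : n ∈ coxeterPacking B v) :
    0 < B n (weightN9 v 0) := by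
  obtain ⟨g, hg, i, hi, rfl⟩ := (mem_coxeterPackingN9 h).mp hn
  rw [normalize, map_smul, LinearMap.smul_apply, smul_eq_mul]
  refine mul_pos (inv_pos.mpr (Real.sqrt_pos.mpr ?_)) (bilin_weightN9_zero_pos h hg i)
  rw [reflGroup_isometry h.isSimplyLaced.symm h.isSimplyLaced.norm g hg]
  linarith [(norm_weightN9_neg_iff h i).mpr hi]

theorem image_eq_of_forall_mem {G : Subgroup (V ≃ₗ[ℝ] V)} {s : Set V}
    (hG : ∀ g ∈ G, ∀ x ∈ s, g x ∈ s) {g : V ≃ₗ[ℝ] V} (hg : g ∈ G) : g '' s = s := by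
  apply Set.Subset.antisymm
  · rintro _ ⟨x, hx, rfl⟩
    exact hG g hg x hx
  · exact fun x hx => ⟨g⁻¹ x, hG _ (inv_mem hg) x hx, g.apply_symm_apply x⟩

/-- The chamber of the nine nodes is the fundamental domain: `exists_dominantN9` gives the covering,
`eq_one_of_strictlyDominant` the disjointness of the interiors. -/
theorem isGeometricallyFiniteN9 {v : Module.Basis (Fin 9) ℝ V}
    (h : HasCoxeterGraph B v graphN9) :
    IsGeometricallyFinite B (weightN9 v 0) (reflGroup B (Set.range v)) := by
  classical
  have hL := h.isSimplyLaced
  refine ⟨Finset.univ.image v, ?_, ?_, ?_⟩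
  · intro x hx
    obtain ⟨i, -, rfl⟩ := Finset.mem_image.mp hx
    rw [hL.norm]; norm_num
  · rintro x ⟨hx1, hx2⟩
    obtain ⟨g, hg, hd⟩ := exists_dominantN9 h (by rw [hx1]; norm_num) hx2
    refine ⟨g, hg, fun x hx => ?_⟩
    obtain ⟨i, -, rfl⟩ := Finset.mem_image.mp hx
    exact hd i
  · intro g hg hg1 x _ hpos hpos'
    have hm : ∀ i, v i ∈ Finset.univ.image v :=
      fun i => Finset.mem_image_of_mem v (Finset.mem_univ i)
    exact hg1 (eq_one_of_strictlyDominant hL (fun i => hpos _ (hm i)) hg fun i => hpos' _ (hm i))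

theorem weightN9_smul (v : Fin 9 → V) (i : Fin 9) :
    intComb v (dualN9 i) = (14 : ℝ) • weightN9 v i := by
  rw [weightN9, smul_smul, mul_inv_cancel₀ (by norm_num), one_smul]

theorem isCrystallographicN9 {v : Module.Basis (Fin 9) ℝ V} (h : HasCoxeterGraph B v graphN9) :
    IsCrystallographic B (coxeterPacking B v) := by
  classical
  have hL := h.isSimplyLaced
  have hB := h.isLorentzN9.isHyperbolic
  have hD := norm_weightN9_zero h
  -- The weights are multiplied by `14` to land in the root lattice; normalization removes the
  -- factor.
  refine ⟨weightN9 v 0, AddSubgroup.closure (Set.range v), reflGroup B (Set.range v),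
    {intComb v (dualN9 2), intComb v (dualN9 3), intComb v (dualN9 8)}, hD,
    isLattice_closure_range v, fun g hg => ⟨?_, ?_, ?_⟩, isGeometricallyFiniteN9 h, ?_, ?_⟩
  · exact reflGroup_isometry hL.symm hL.norm g hg
  · refine image_eq_of_forall_mem (s := sheet B (weightN9 v 0)) (fun g hg x hx => ⟨?_, ?_⟩) hg
    · rw [reflGroup_isometry hL.symm hL.norm g hg]; exact hx.1
    · exact reflGroup_forward hB hL.norm hD (by rw [hx.1]; norm_num) hx.2 g hg
  · exact image_eq_of_forall_mem (fun g hg x hx => map_mem_closure hL hx hg) hg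
  · intro n hn
    have : ∃ i, (i = 2 ∨ i = 3 ∨ i = 8) ∧ n = intComb v (dualN9 i) := by
      simp only [Finset.mem_insert, Finset.mem_singleton] at hn
      rcases hn with rfl | rfl | rfl
      exacts [⟨2, by simp⟩, ⟨3, by simp⟩, ⟨8, by simp⟩]
    obtain ⟨i, hi, rfl⟩ := this
    refine ⟨intComb_mem_closure _ _, ?_⟩
    have := (norm_weightN9_neg_iff h i).mpr hi
    simp only [weightN9_smul, map_smul, LinearMap.smul_apply, smul_eq_mul]
    linarith
  · ext x
    rw [mem_coxeterPackingN9 h]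
    constructor
    · rintro ⟨g, hg, i, hi, rfl⟩
      refine ⟨g (intComb v (dualN9 i)), ⟨g, hg, _, ?_, rfl⟩, ?_⟩
      · simp only [Finset.coe_insert, Finset.coe_singleton]
        rcases hi with rfl | rfl | rfl <;> simp
      · rw [weightN9_smul, map_smul, normalize_smul (by norm_num)]
    · rintro ⟨_, ⟨g, hg, n, hn, rfl⟩, rfl⟩
      simp only [Finset.coe_insert, Finset.coe_singleton, Set.mem_insert_iff,
        Set.mem_singleton_iff] at hn
      have : ∃ i, (i = 2 ∨ i = 3 ∨ i = 8) ∧ n = intComb v (dualN9 i) := by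
        rcases hn with rfl | rfl | rfl
        exacts [⟨2, by simp⟩, ⟨3, by simp⟩, ⟨8, by simp⟩]
      obtain ⟨i, hi, rfl⟩ := this
      exact ⟨g, hg, i, hi, by rw [weightN9_smul, map_smul, normalize_smul (by norm_num)]⟩

/-- The coordinates of nine mutually tangent spheres in the orbit of twice the last weight. -/
def seqN9 : Matrix (Fin 9) (Fin 9) ℤ := Matrix.of fun k j =>
  (if j < 7 then 1 else if j = 7 then 0 else -1) + if 8 < k.val + j.val then 2 else 0

theorem seqN9_zero : (14 : ℤ) • seqN9 0 = (2 : ℤ) • dualN9 8 := by decide +kernel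

/-- The reflection in node `8 - k` carries each member of the sequence to the next, so all of them
lie in the orbit of `2 w_8`. -/
theorem seqN9_succ : ∀ k : Fin 8, seqN9 k.succ =
    seqN9 k.castSucc + gramN9.mulVec (seqN9 k.castSucc) k.rev.succ • Pi.single k.rev.succ 1 := by
  decide +kernel

theorem seqN9_gram :
    ∀ i j, seqN9 i ⬝ᵥ gramN9.mulVec (seqN9 j) = if i = j then -2 else 2 := by
  decide +kernel

theorem exists_seqN9_eq {v : Module.Basis (Fin 9) ℝ V} (h : HasCoxeterGraph B v graphN9)
    (k : Fin 9) : ∃ g ∈ reflGroup B (Set.range v),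
      intComb v (seqN9 k) = (2 : ℝ) • g (weightN9 v 8) := by
  have hL := h.isSimplyLaced
  induction k using Fin.induction with
  | zero =>
    refine ⟨1, one_mem _, ?_⟩
    have := congrArg (intComb v) seqN9_zero
    rw [intComb_smul, intComb_smul, weightN9_smul] at this
    rw [LinearEquiv.coe_one, id]
    have h14 : (14 : ℝ) • intComb v (seqN9 0) = (14 : ℝ) • (2 : ℝ) • weightN9 v 8 := by
      rw [smul_comm (14 : ℝ)]; exact_mod_cast this
    exact smul_right_injective V (by norm_num : (14 : ℝ) ≠ 0) h14
  | succ k ih =>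
    obtain ⟨g, hg, hk⟩ := ih
    refine ⟨reflEquiv (hL.norm k.rev.succ) * g, mul_mem (reflEquiv_mem _ ⟨_, rfl⟩) hg, ?_⟩
    rw [LinearEquiv.mul_apply, ← map_smul, ← hk, reflEquiv_intComb h.gramN9, ← seqN9_succ]

theorem normalize_seqN9_mem {v : Module.Basis (Fin 9) ℝ V} (h : HasCoxeterGraph B v graphN9)
    (k : Fin 9) : normalize B (intComb v (seqN9 k)) ∈ coxeterPacking B v := by
  obtain ⟨g, hg, hk⟩ := exists_seqN9_eq h k
  rw [hk, normalize_smul (by norm_num)]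
  exact (mem_coxeterPackingN9 h).mpr ⟨g, hg, 8, by simp, rfl⟩

theorem normalize_seqN9 {v : Module.Basis (Fin 9) ℝ V} (h : HasCoxeterGraph B v graphN9)
    (k : Fin 9) : normalize B (intComb v (seqN9 k)) = (√2)⁻¹ • intComb v (seqN9 k) := by
  rw [normalize, bilin_intComb h.gramN9, seqN9_gram, if_pos rfl]
  norm_num

theorem isCluster_seqN9 {v : Module.Basis (Fin 9) ℝ V} (h : HasCoxeterGraph B v graphN9) :
    IsCluster B (coxeterPacking B v) fun k : Fin 9 => normalize B (intComb v (seqN9 k)) := by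
  refine ⟨normalize_seqN9_mem h, fun i j hij => ?_⟩
  have hprod : ∀ i j, B (normalize B (intComb v (seqN9 i))) (normalize B (intComb v (seqN9 j))) =
      if i = j then -1 else 1 := by
    intro i j
    simp only [normalize_seqN9 h, map_smul, LinearMap.smul_apply, smul_eq_mul,
      bilin_intComb h.gramN9, seqN9_gram]
    rw [← mul_assoc, ← mul_inv, Real.mul_self_sqrt (by norm_num)]
    split_ifs <;> norm_num
  refine areTangent_of_bilin (D := weightN9 v 0) one_pos ?_ ?_ ?_
    (bilin_weightN9_zero_pos_of_mem h (normalize_seqN9_mem h i))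
    (bilin_weightN9_zero_pos_of_mem h (normalize_seqN9_mem h j))
  · rw [hprod, if_pos rfl]
  · rw [hprod, if_pos rfl]
  · rw [hprod, if_neg hij]

theorem hasWeakApollonianPropertyN9 {v : Module.Basis (Fin 9) ℝ V}
    (h : HasCoxeterGraph B v graphN9) : HasWeakApollonianProperty B (coxeterPacking B v) := by
  have hn : Module.finrank ℝ V = 9 := by rw [Module.finrank_eq_card_basis v, Fintype.card_fin]
  obtain ⟨h1, h2⟩ := isCluster_seqN9 h
  refine ⟨fun k => normalize B (intComb v (seqN9 (Fin.cast hn k))), fun i => h1 _,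
    fun i j hij => ?_⟩
  exact h2 _ _ fun h => hij (Fin.cast_injective hn h)

/-- Twice the inverse of `seqN9`. -/
def seqN9Inv : Matrix (Fin 9) (Fin 9) ℤ := Matrix.of fun j k =>
  if j = 0 then (if k ≤ 2 then 1 else if k = 8 then -1 else 0)
  else (if k.val + j.val = 9 then 1 else 0) - (if k.val + j.val = 8 then 1 else 0)

theorem seqN9Inv_mul : ∀ j, Matrix.vecMul (seqN9Inv j) seqN9 = (2 : ℤ) • Pi.single j 1 := by
  decide +kernel

theorem isGeneralLatticeTypeN9 {v : Module.Basis (Fin 9) ℝ V} (h : HasCoxeterGraph B v graphN9) :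
    IsGeneralLatticeType (coxeterPacking B v) := by
  have hL := h.isSimplyLaced
  refine ⟨⟨_, isLattice_closure_range v, fun n hn => ?_⟩, ?_⟩
  · obtain ⟨g, hg, i, hi, rfl⟩ := (mem_coxeterPackingN9 h).mp hn
    have hneg := (norm_weightN9_neg_iff h i).mpr hi
    rw [← reflGroup_isometry hL.symm hL.norm g hg] at hneg
    set c := √(-(B (g (weightN9 v i)) (g (weightN9 v i)))) with hc
    have hc0 : 0 < c := Real.sqrt_pos.mpr (by linarith)
    refine ⟨14 * c, by positivity, ?_⟩
    rw [normalize, ← hc, smul_smul, mul_assoc, mul_inv_cancel₀ hc0.ne', mul_one, ← map_smul,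
      ← weightN9_smul]
    exact map_mem_closure hL (intComb_mem_closure _ _) hg
  · rw [eq_top_iff, ← v.span_eq, Submodule.span_le]
    rintro _ ⟨j, rfl⟩
    have h1 : ∀ k, intComb v (seqN9 k) ∈ Submodule.span ℝ (coxeterPacking B v) := by
      intro k
      have h2 := Submodule.smul_mem _ (√2) (Submodule.subset_span (R := ℝ)
        (normalize_seqN9_mem h k))
      rwa [normalize_seqN9 h, smul_smul, mul_inv_cancel₀ (by positivity), one_smul] at h2
    have h3 : (2 : ℝ) • v j ∈ Submodule.span ℝ (coxeterPacking B v) := by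
      have h4 := intComb_intComb v seqN9 (seqN9Inv j)
      rw [seqN9Inv_mul, intComb_smul, intComb_single] at h4
      have h5 : intComb (fun k => intComb v (seqN9 k)) (seqN9Inv j) ∈
          Submodule.span ℝ (coxeterPacking B v) :=
        Submodule.sum_mem _ fun k _ => Submodule.smul_mem _ _ (h1 k)
      rw [h4] at h5
      exact_mod_cast h5
    have h6 := Submodule.smul_mem _ (2 : ℝ)⁻¹ h3
    rwa [smul_smul, inv_mul_cancel₀ (by norm_num), one_smul] at h6

theorem norm_weightN9_two {v : Fin 9 → V} (h : HasCoxeterGraph B v graphN9) :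
    B (weightN9 v 2) (weightN9 v 2) = -(3 / 14) := by
  rw [bilin_weightN9 h]; norm_num [show dualN9 2 2 = -3 from rfl]

/-- Differences of normalized spheres in two orbits give the multiples `√2` and `√(14/3)` of the
same node `v_2`. Their ratio is irrational, which is impossible in a lattice. -/
theorem not_isLatticeTypeN9 {v : Module.Basis (Fin 9) ℝ V} (h : HasCoxeterGraph B v graphN9) :
    ¬ IsLatticeType (coxeterPacking B v) := by
  rintro ⟨b, hb⟩
  have hL := h.isSimplyLaced
  have h1 : √2 • v 2 ∈ AddSubgroup.closure (coxeterPacking B v) := by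
    have h2 := sub_mem (AddSubgroup.subset_closure (normalize_seqN9_mem h 7))
      (AddSubgroup.subset_closure (normalize_seqN9_mem h 6))
    have h3 : seqN9 7 = seqN9 6 + (2 : ℤ) • Pi.single 2 1 := by decide +kernel
    rw [normalize_seqN9 h, normalize_seqN9 h, h3, intComb_add, intComb_smul, intComb_single,
      smul_add, add_sub_cancel_left, smul_smul] at h2
    have h4 : (√2)⁻¹ * ((2 : ℤ) : ℝ) = √2 := by
      rw [inv_mul_eq_iff_eq_mul₀ (by positivity), Real.mul_self_sqrt (by norm_num)]
      norm_num
    rwa [h4] at h2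
  have h2 : (√(3 / 14))⁻¹ • v 2 ∈ AddSubgroup.closure (coxeterPacking B v) := by
    have hmem : ∀ g ∈ reflGroup B (Set.range v), (√(3 / 14))⁻¹ • g (weightN9 v 2) ∈
        AddSubgroup.closure (coxeterPacking B v) := by
      intro g hg
      have : (√(3 / 14))⁻¹ • g (weightN9 v 2) = normalize B (g (weightN9 v 2)) := by
        rw [normalize, reflGroup_isometry hL.symm hL.norm g hg, norm_weightN9_two h, neg_neg]
      rw [this]
      exact AddSubgroup.subset_closure ((mem_coxeterPackingN9 h).mpr ⟨g, hg, 2, by simp, rfl⟩)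
    have h3 := sub_mem (hmem _ (reflEquiv_mem (hL.norm 2) ⟨2, rfl⟩)) (hmem 1 (one_mem _))
    rwa [reflEquiv_apply, bilin_node_weightN9 h, if_pos rfl, one_smul, LinearEquiv.coe_one, id,
      smul_add, add_sub_cancel_left] at h3
  rw [hb] at h1 h2
  obtain ⟨i, hi⟩ : ∃ i, b.repr (v 2) i ≠ 0 := by
    by_contra! hcon
    exact v.ne_zero 2 (b.repr.injective (Finsupp.ext fun i => by simp [hcon i]))
  obtain ⟨k, hk⟩ := exists_int_repr_of_mem_closure h1 i
  obtain ⟨l, hl⟩ := exists_int_repr_of_mem_closure h2 i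
  rw [map_smul, Finsupp.smul_apply, smul_eq_mul] at hk hl
  set c := b.repr (v 2) i
  have hk2 : 2 * c ^ 2 = (k : ℝ) ^ 2 := by
    rw [← hk, mul_pow, Real.sq_sqrt (by norm_num)]
  have hl2 : 14 / 3 * c ^ 2 = (l : ℝ) ^ 2 := by
    rw [← hl, mul_pow, inv_pow, Real.sq_sqrt (by norm_num)]; norm_num
  have hkl : 3 * l ^ 2 = 7 * k ^ 2 := by
    have : (3 : ℝ) * (l : ℝ) ^ 2 = 7 * (k : ℝ) ^ 2 := by linarith
    exact_mod_cast this
  have hk0 := eq_zero_of_three_mul_sq_eq hkl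
  rw [hk0] at hk2
  apply hi
  have : c ^ 2 = 0 := by
    push_cast at hk2
    linarith
  exact pow_eq_zero_iff two_ne_zero |>.mp this

/-- The orbit of a weight stays in one class modulo the root lattice, and weights pair integrally
with that lattice; products between two orbits are therefore known modulo `1`. -/
theorem exists_int_bilin_weightN9 {v : Module.Basis (Fin 9) ℝ V}
    (h : HasCoxeterGraph B v graphN9) {g g' : V ≃ₗ[ℝ] V} (hg : g ∈ reflGroup B (Set.range v))
    (hg' : g' ∈ reflGroup B (Set.range v)) (i j : Fin 9) :
    ∃ k : ℤ, B (g (weightN9 v i)) (g' (weightN9 v j)) = (dualN9 i j : ℝ) / 14 + k := by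
  have hL := h.isSimplyLaced
  have h1 := sub_mem_closure_of_int hL (z := weightN9 v j)
    (fun k => ⟨if k = j then 1 else 0, by rw [bilin_node_weightN9 h]; push_cast; rfl⟩)
    (g⁻¹ * g') (mul_mem (inv_mem hg) hg')
  obtain ⟨k, hk⟩ := exists_int_repr_of_mem_closure h1 i
  refine ⟨k, ?_⟩
  rw [repr_eq_bilin_weightN9 h, hL.symm, map_sub, bilin_weightN9 h] at hk
  rw [hL.symm, ← inv_apply_bilin hL.symm hL.norm hg, hL.symm]
  rw [LinearEquiv.mul_apply] at hk
  linarith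

/-- A sphere in the orbit of `w_2` can be tangent only to spheres in the orbit of `w_3`, and no two
of the latter are tangent to each other, so its clusters have at most two members. -/
theorem not_hasApollonianPropertyN9 {v : Module.Basis (Fin 9) ℝ V}
    (h : HasCoxeterGraph B v graphN9)
    (hP : ∀ n ∈ coxeterPacking B v, ∀ m ∈ coxeterPacking B v, m ≠ n → 1 ≤ B n m) :
    ¬ HasApollonianProperty B (coxeterPacking B v) := by
  have hL := h.isSimplyLaced
  have hiso := reflGroup_isometry hL.symm hL.norm
  have htan : ∀ g ∈ reflGroup B (Set.range v), ∀ g' ∈ reflGroup B (Set.range v), ∀ i j,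
      (i = 2 ∨ i = 3 ∨ i = 8) → (j = 2 ∨ j = 3 ∨ j = 8) →
      AreTangent B (normalize B (g (weightN9 v i))) (normalize B (g' (weightN9 v j))) →
      ∃ k : ℤ, ((dualN9 i j : ℝ) / 14 + k) =
        √(-(dualN9 i i : ℝ) / 14) * √(-(dualN9 j j : ℝ) / 14) := by
    intro g hg g' hg' i j hi hj ht
    have hin := (norm_weightN9_neg_iff h i).mpr hi
    have hjn := (norm_weightN9_neg_iff h j).mpr hj
    have hin' := hin
    have hjn' := hjn
    rw [← hiso g hg] at hin'
    rw [← hiso g' hg'] at hjn'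
    have h1 := hP _ ((mem_coxeterPackingN9 h).mpr ⟨g, hg, i, hi, rfl⟩)
      _ ((mem_coxeterPackingN9 h).mpr ⟨g', hg', j, hj, rfl⟩) ht.ne.symm
    have h2 := ht.2
    rw [norm_normalize hin', norm_normalize hjn', abs_of_pos (by linarith)] at h2
    norm_num at h2
    obtain ⟨k, hk⟩ := exists_int_bilin_weightN9 h hg hg' i j
    refine ⟨k, ?_⟩
    simp only [normalize, map_smul, LinearMap.smul_apply, smul_eq_mul, hiso g hg, hiso g' hg', hk,
      bilin_weightN9 h] at h2
    rw [bilin_weightN9 h] at hin hjn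
    rw [neg_div, neg_div]
    have hi0 : 0 < √(-((dualN9 i i : ℝ) / 14)) := Real.sqrt_pos.mpr (by linarith)
    have hj0 : 0 < √(-((dualN9 j j : ℝ) / 14)) := Real.sqrt_pos.mpr (by linarith)
    field_simp at h2
    linarith
  have hsame : ∀ g ∈ reflGroup B (Set.range v), ∀ g' ∈ reflGroup B (Set.range v), ∀ i,
      (i = 2 ∨ i = 3) →
      ¬ AreTangent B (normalize B (g (weightN9 v i))) (normalize B (g' (weightN9 v i))) := by
    intro g hg g' hg' i hi ht
    obtain ⟨k, hk⟩ := htan g hg g' hg' i i (by tauto) (by tauto) ht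
    have hd : (dualN9 i i : ℝ) = -3 := by
      rcases hi with rfl | rfl
      · norm_num [show dualN9 2 2 = -3 from rfl]
      · norm_num [show dualN9 3 3 = -3 from rfl]
    rw [hd, Real.mul_self_sqrt (by norm_num)] at hk
    -- Tangency within one of these orbits means `-3/14 + k = 3/14`.
    have : (7 * k : ℝ) = 3 := by linarith
    have : 7 * k = 3 := by exact_mod_cast this
    omega
  have hlast : ∀ g ∈ reflGroup B (Set.range v), ∀ g' ∈ reflGroup B (Set.range v),
      ¬ AreTangent B (normalize B (g (weightN9 v 2))) (normalize B (g' (weightN9 v 8))) := by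
    intro g hg g' hg' ht
    obtain ⟨k, hk⟩ := htan g hg g' hg' 2 8 (by simp) (by simp) ht
    have h2 := congrArg (fun x : ℝ => x ^ 2) hk
    simp only [mul_pow] at h2
    rw [show dualN9 2 2 = -3 from rfl, show dualN9 8 8 = -7 from rfl,
      show dualN9 2 8 = 7 from rfl, Real.sq_sqrt (by norm_num), Real.sq_sqrt (by norm_num)] at h2
    push_cast at h2
    -- Tangency between the orbits of `w_2` and `w_8` means `(1/2 + k)² = 3/14 · 1/2`.
    have h3 : ((7 + 14 * k : ℤ) : ℝ) ^ 2 = 21 := by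
      push_cast
      linarith
    have h4 : (7 + 14 * k) ^ 2 = 21 := by exact_mod_cast h3
    have h5 : 7 + 14 * k < 5 := by nlinarith
    have h6 : -5 < 7 + 14 * k := by nlinarith
    have : k = 0 ∨ k ≤ -1 := by omega
    omega
  intro hA
  have hn : Module.finrank ℝ V = 9 := by rw [Module.finrank_eq_card_basis v, Fintype.card_fin]
  obtain ⟨c, ⟨hc, hct⟩, i, hi⟩ := hA _
    ((mem_coxeterPackingN9 h).mpr ⟨1, one_mem _, 2, by simp, rfl⟩)
  have hthree : ∀ a, a ≠ i → ∃ g ∈ reflGroup B (Set.range v),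
      c a = normalize B (g (weightN9 v 3)) := by
    intro a ha
    obtain ⟨g, hg, j, hj, hcj⟩ := (mem_coxeterPackingN9 h).mp (hc a)
    have ht := hct i a ha.symm
    rw [hi, hcj] at ht
    rcases hj with rfl | rfl | rfl
    · exact absurd ht (hsame _ (one_mem _) g hg 2 (by simp))
    · exact ⟨g, hg, hcj⟩
    · exact absurd ht (hlast _ (one_mem _) g hg)
  obtain ⟨a, b, ha, hb, hab⟩ : ∃ a b : Fin (Module.finrank ℝ V), a ≠ i ∧ b ≠ i ∧ a ≠ b := by
    have : ∀ n, n = 9 → ∀ i : Fin n, ∃ a b : Fin n, a ≠ i ∧ b ≠ i ∧ a ≠ b := by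
      rintro _ rfl
      decide
    exact this _ hn i
  obtain ⟨g, hg, hga⟩ := hthree a ha
  obtain ⟨g', hg', hgb⟩ := hthree b hb
  have ht := hct a b hab
  rw [hga, hgb] at ht
  exact hsame g hg g' hg' 3 (by simp) ht

end GraphN9

/-! ### The packing `P_β` and the spheres `s_0, …, s_9` -/

section Beta

/-- The Gram matrix of the nodes of `graphT246`. -/
def gramβ : Matrix (Fin 10) (Fin 10) ℤ := Matrix.of fun i j =>
  if i = j then -2 else
    if ((1 ≤ i.val ∧ i.val + 1 = j.val) ∨ (i = 0 ∧ j = 4)) ∨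
      ((1 ≤ j.val ∧ j.val + 1 = i.val) ∨ (j = 0 ∧ i = 4)) then 1 else 0

/-- Twice the inverse of `gramβ`. -/
def dualβ : Matrix (Fin 10) (Fin 10) ℤ :=
  !![5, 3, 6, 9, 12, 10, 8, 6, 4, 2;
    3, 0, 2, 4, 6, 5, 4, 3, 2, 1;
    6, 2, 4, 8, 12, 10, 8, 6, 4, 2;
    9, 4, 8, 12, 18, 15, 12, 9, 6, 3;
    12, 6, 12, 18, 24, 20, 16, 12, 8, 4;
    10, 5, 10, 15, 20, 15, 12, 9, 6, 3;
    8, 4, 8, 12, 16, 12, 8, 6, 4, 2;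
    6, 3, 6, 9, 12, 9, 6, 3, 2, 1;
    4, 2, 4, 6, 8, 6, 4, 2, 0, 0;
    2, 1, 2, 3, 4, 3, 2, 1, 0, -1]

/-- The coefficients of an orthogonal basis. -/
def orthoβ : Matrix (Fin 10) (Fin 10) ℤ := Matrix.of fun i j =>
  if i = 0 then dualβ 0 j else if j ≤ i then (j.val : ℤ) else 0

theorem gramβ_mulVec_dual : ∀ i k, gramβ.mulVec (dualβ i) k = if k = i then 2 else 0 := by
  decide +kernel

theorem dualβ_gram : ∀ i j, dualβ i ⬝ᵥ gramβ.mulVec (dualβ j) = 2 * dualβ i j := by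
  decide +kernel

/-- As for the nine-node graph: the Gram-Schmidt vectors of the path `β_1, …, β_9`, together with a
multiple of `w_0`. -/
theorem gramβ_ortho : ∀ i j, i ≠ j → orthoβ i ⬝ᵥ gramβ.mulVec (orthoβ j) = 0 := by
  decide +kernel

theorem gramβ_ortho_zero : 0 < orthoβ 0 ⬝ᵥ gramβ.mulVec (orthoβ 0) := by decide +kernel

theorem gramβ_ortho_neg : ∀ i, i ≠ 0 → orthoβ i ⬝ᵥ gramβ.mulVec (orthoβ i) < 0 := by
  decide +kernel

theorem incidenceMatrix_graphT246 (i j : Fin 10) :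
    incidenceMatrix graphT246 i j = ((gramβ i j : ℤ) : ℝ) := by
  simp only [incidenceMatrix, gramβ, Matrix.of_apply, graphT246, SimpleGraph.fromRel_adj]
  by_cases hij : i = j
  · simp [hij]
  · simp only [ne_eq, hij, not_false_eq_true, true_and]
    push_cast
    rfl

/-- The nodes of `graphT246` as a basis. -/
noncomputable abbrev basisβ : Module.Basis (Fin 10) ℝ (Fin 10 → ℝ) := Pi.basisFun ℝ (Fin 10)

theorem coe_basisβ : ⇑basisβ = β := by
  ext i
  simp [basisβ, β]

theorem hasCoxeterGraph_β : HasCoxeterGraph formβ basisβ graphT246 := by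
  intro i j
  rw [coe_basisβ, β, β, formβ]
  exact Matrix.toBilin'_single _ i j

theorem bilin_β (i j : Fin 10) : formβ (β i) (β j) = ((gramβ i j : ℤ) : ℝ) := by
  rw [← incidenceMatrix_graphT246, ← hasCoxeterGraph_β, coe_basisβ]

theorem isSimplyLaced_β : IsSimplyLaced formβ β := by
  rw [← coe_basisβ]; exact hasCoxeterGraph_β.isSimplyLaced

theorem norm_β (i : Fin 10) : formβ (β i) (β i) = -2 := isSimplyLaced_β.norm i

theorem formβ_symm (x y : Fin 10 → ℝ) : formβ x y = formβ y x := isSimplyLaced_β.symm x y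

theorem isHyperbolic_formβ : IsHyperbolic formβ := by
  refine IsLorentz.isHyperbolic (m := 9) (isLorentz_of_orthogonal (by simp)
    (fun i => intComb β (orthoβ i)) (fun i j hij => ?_) ?_ (fun i hi => ?_))
  · rw [bilin_intComb bilin_β, gramβ_ortho i j hij, Int.cast_zero]
  · rw [bilin_intComb bilin_β]
    exact_mod_cast gramβ_ortho_zero
  · rw [bilin_intComb bilin_β]
    exact_mod_cast gramβ_ortho_neg i hi

theorem intComb_β (X : Fin 10 → ℤ) : intComb β X = fun i => (X i : ℝ) := by
  ext j
  have := repr_intComb basisβ X j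
  rw [coe_basisβ] at this
  simpa [basisβ] using this

/-- The weights of the Coxeter graph `graphT246`. -/
noncomputable def weightβ (i : Fin 10) : Fin 10 → ℝ := (2 : ℝ)⁻¹ • intComb β (dualβ i)

theorem bilin_node_weightβ (i k : Fin 10) :
    formβ (β k) (weightβ i) = if k = i then 1 else 0 := by
  rw [weightβ, map_smul, bilin_single_intComb bilin_β, gramβ_mulVec_dual]
  split_ifs <;> simp

theorem bilin_weightβ (i j : Fin 10) :
    formβ (weightβ i) (weightβ j) = (dualβ i j : ℝ) / 2 := by
  simp only [weightβ, map_smul, LinearMap.smul_apply, bilin_intComb bilin_β, dualβ_gram,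
    smul_eq_mul]
  push_cast
  ring

theorem bilin_weightβ_right (x : Fin 10 → ℝ) (i : Fin 10) : formβ x (weightβ i) = x i := by
  have := repr_eq_bilin_dual (B := formβ) (v := basisβ) (w := weightβ)
    (by rw [coe_basisβ]; exact bilin_node_weightβ) x i
  rw [← this]
  simp [basisβ]

theorem eq_zero_of_forall_bilin_β {x : Fin 10 → ℝ} (h : ∀ i, formβ (β i) x = 0) : x = 0 := by
  ext i
  rw [← bilin_weightβ_right x i, formβ_symm, weightβ, map_smul, LinearMap.smul_apply, intComb]
  simp [h]

/-- The coordinates of `ν`. -/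
def νZ : Fin 10 → ℤ := ![2, 1, 2, 3, 4, 3, 2, 1, 0, -1]

theorem ν_eq : ν = intComb β νZ := by
  rw [intComb_β]
  ext i
  fin_cases i <;> simp [ν, νZ]

theorem ν_eq_weight : ν = (2 : ℝ) • weightβ 9 := by
  rw [weightβ, smul_smul, mul_inv_cancel₀ (by norm_num), one_smul, ν_eq]
  congr 1

theorem Γβ_eq : Γβ = reflGroup formβ (Set.range basisβ) := by rw [coe_basisβ, Γβ]

theorem Γβ_isometry {g : (Fin 10 → ℝ) ≃ₗ[ℝ] (Fin 10 → ℝ)} (hg : g ∈ Γβ) (x y : Fin 10 → ℝ) :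
    formβ (g x) (g y) = formβ x y :=
  reflGroup_isometry formβ_symm norm_β g hg x y

theorem mem_Pβ {t : Fin 10 → ℝ} : t ∈ Pβ ↔ ∃ g ∈ Γβ, t = g ν := by
  simp [Pβ, orbit]

theorem map_mem_Pβ {t : Fin 10 → ℝ} (ht : t ∈ Pβ) {g : (Fin 10 → ℝ) ≃ₗ[ℝ] (Fin 10 → ℝ)}
    (hg : g ∈ Γβ) : g t ∈ Pβ := by
  obtain ⟨k, hk, rfl⟩ := mem_Pβ.mp ht
  exact mem_Pβ.mpr ⟨g * k, mul_mem hg hk, rfl⟩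

theorem norm_ν : formβ ν ν = -2 := by
  rw [ν_eq, bilin_intComb bilin_β]
  have : νZ ⬝ᵥ gramβ.mulVec νZ = -2 := by decide +kernel
  rw [this]; norm_num

theorem norm_of_mem_Pβ {t : Fin 10 → ℝ} (ht : t ∈ Pβ) : formβ t t = -2 := by
  obtain ⟨g, hg, rfl⟩ := mem_Pβ.mp ht
  rw [Γβ_isometry hg, norm_ν]

/-- The members of `Pβ` are obtained from `ν` by adding even non-negative multiples of the nodes. -/
theorem exists_coords_of_mem_Pβ {t : Fin 10 → ℝ} (ht : t ∈ Pβ) :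
    ∃ m : Fin 10 → ℤ, (∀ i, 0 ≤ m i) ∧ t = ν + (2 : ℝ) • intComb β m := by
  obtain ⟨g, hg, rfl⟩ := mem_Pβ.mp ht
  have h1 := sub_mem_closure_of_int isSimplyLaced_β (z := weightβ 9)
    (fun k => ⟨if k = 9 then 1 else 0, by rw [bilin_node_weightβ]; push_cast; rfl⟩) g hg
  have h2 := sub_mem_posCone hasCoxeterGraph_β.isSimplyLaced (z := weightβ 9)
    (fun k => by rw [coe_basisβ, bilin_node_weightβ]; split_ifs <;> norm_num) g (Γβ_eq ▸ hg)
  rw [← coe_basisβ] at h1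
  choose m hm using exists_int_repr_of_mem_closure h1
  refine ⟨m, fun i => ?_, ?_⟩
  · have := h2 i
    rw [hm i] at this
    exact_mod_cast this
  · have h3 : intComb β m = g (weightβ 9) - weightβ 9 := by
      rw [← coe_basisβ, intComb]
      simp only [← hm]
      exact basisβ.sum_repr _
    rw [h3, ν_eq_weight, map_smul, smul_sub]
    abel

theorem bilin_intComb_β (y : Fin 10 → ℝ) (m : Fin 10 → ℤ) :
    formβ y (intComb β m) = ∑ i, (m i : ℝ) * formβ (β i) y := by
  rw [intComb, map_sum]
  exact Finset.sum_congr rfl fun i _ => by rw [map_smul, smul_eq_mul, formβ_symm y]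

theorem bilin_ν_intComb (m : Fin 10 → ℤ) : formβ ν (intComb β m) = 2 * m 9 := by
  rw [ν_eq_weight, map_smul, LinearMap.smul_apply, formβ_symm, bilin_weightβ_right, intComb_β,
    smul_eq_mul]

/-- Twice the sum of the weights, in integral coordinates. -/
def rhoβ (j : Fin 10) : ℤ := ∑ i, dualβ i j

theorem bilin_β_rho (i : Fin 10) : formβ (β i) (intComb β rhoβ) = 2 := by
  rw [bilin_single_intComb bilin_β]
  have : ∀ i, gramβ.mulVec rhoβ i = 2 := by decide +kernel
  rw [this]; norm_num

theorem norm_rhoβ : 0 < formβ (intComb β rhoβ) (intComb β rhoβ) := by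
  rw [bilin_intComb bilin_β]
  have : 0 < rhoβ ⬝ᵥ gramβ.mulVec rhoβ := by decide +kernel
  exact_mod_cast this

/-- Write `t = ν + 2u` with `u` a non-negative integral combination of the nodes; then `ν·t = -2 + 4
m_9`. Only `m_9 = 0` is in question, and it makes `u` isotropic. -/
theorem two_le_bilin_ν {t : Fin 10 → ℝ} (ht : t ∈ Pβ) (hne : t ≠ ν) : 2 ≤ formβ ν t := by
  obtain ⟨m, hm0, hm⟩ := exists_coords_of_mem_Pβ ht
  have hνt : formβ ν t = -2 + 4 * m 9 := by
    rw [hm, map_add, map_smul, norm_ν, bilin_ν_intComb, smul_eq_mul]; ring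
  rcases (hm0 9).lt_or_eq with h9 | h9
  · have : (1 : ℝ) ≤ m 9 := by exact_mod_cast h9
    linarith
  exfalso
  obtain ⟨g, hg, rfl⟩ := mem_Pβ.mp ht
  rw [← h9] at hνt
  norm_num at hνt
  set u := intComb β m with hu
  have hu2 : (2 : ℝ) • u = g ν - ν := by rw [hm]; abel
  have huu : formβ u u = 0 := by
    have : formβ ((2 : ℝ) • u) ((2 : ℝ) • u) = 0 := by
      rw [hu2]
      simp only [map_sub, LinearMap.sub_apply, Γβ_isometry hg, norm_ν, hνt, formβ_symm (g ν) ν]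
      norm_num
    simp only [map_smul, LinearMap.smul_apply, smul_eq_mul] at this
    linarith
  set ρ := intComb β rhoβ with hρ
  have hρu : 0 < formβ u ρ := by
    rw [formβ_symm, bilin_intComb_β]
    simp only [hρ, bilin_β_rho]
    obtain ⟨i, hi⟩ : ∃ i, m i ≠ 0 := by
      by_contra! hcon
      apply hne
      have hm' : m = 0 := funext hcon
      rw [hm, hu, hm', intComb]
      simp
    refine Finset.sum_pos' (fun j _ => ?_) ⟨i, Finset.mem_univ _, ?_⟩
    · have : (0 : ℝ) ≤ m j := by exact_mod_cast hm0 j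
      linarith
    · have : (0 : ℝ) < m i := by exact_mod_cast lt_of_le_of_ne (hm0 i) hi.symm
      linarith
  have hgρ : 0 < formβ (g ρ) u :=
    isHyperbolic_formβ.pos_of_forward norm_rhoβ (by rw [Γβ_isometry hg]; exact norm_rhoβ) huu.ge
      (reflGroup_forward isHyperbolic_formβ norm_β norm_rhoβ norm_rhoβ norm_rhoβ g hg) hρu
  -- Apply the same decomposition to `g⁻¹ν`: its non-negative part is carried by `g` to `-u`, so
  -- `gρ·u ≤ 0`. But `gρ` is forward and `u` is forward isotropic.
  obtain ⟨m', hm0', hm'⟩ := exists_coords_of_mem_Pβ (mem_Pβ.mpr ⟨g⁻¹, inv_mem hg, rfl⟩)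
  have h1 : 0 ≤ formβ ρ (intComb β m') := by
    rw [bilin_intComb_β]
    refine Finset.sum_nonneg fun j _ => ?_
    have : (0 : ℝ) ≤ m' j := by exact_mod_cast hm0' j
    rw [hρ, bilin_β_rho]
    linarith
  have h2 : g (intComb β m') = -u := by
    have h3 : (2 : ℝ) • g (intComb β m') = (2 : ℝ) • -u := by
      have h4 : (2 : ℝ) • intComb β m' = g⁻¹ ν - ν := by rw [hm']; abel
      have h5 : g (g⁻¹ ν) = ν := g.apply_symm_apply ν
      rw [← map_smul, h4, map_sub, h5, smul_neg, hu2]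
      abel
    exact smul_right_injective _ (by norm_num : (2 : ℝ) ≠ 0) h3
  rw [← Γβ_isometry hg, h2, map_neg] at h1
  linarith

theorem two_le_bilin_Pβ {t t' : Fin 10 → ℝ} (ht : t ∈ Pβ) (ht' : t' ∈ Pβ) (hne : t' ≠ t) :
    2 ≤ formβ t t' := by
  obtain ⟨g, hg, rfl⟩ := mem_Pβ.mp ht
  have h1 : formβ (g ν) t' = formβ ν (g⁻¹ t') := by
    rw [← Γβ_isometry hg ν]
    congr 1
    exact (g.apply_symm_apply t').symm
  rw [h1]
  refine two_le_bilin_ν (map_mem_Pβ ht' (inv_mem hg)) fun h => hne ?_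
  rw [← h]
  exact (g.apply_symm_apply t').symm

theorem bilin_weightβ_zero_pos {t : Fin 10 → ℝ} (ht : t ∈ Pβ) : 0 < formβ t (weightβ 0) := by
  obtain ⟨m, hm0, rfl⟩ := exists_coords_of_mem_Pβ ht
  have : (0 : ℝ) ≤ m 0 := by exact_mod_cast hm0 0
  rw [bilin_weightβ_right, intComb_β]
  simp only [Pi.add_apply, Pi.smul_apply, smul_eq_mul]
  have h2 : ν 0 = 2 := by simp [ν]
  linarith

/-- The coordinates of the spheres `s_0, …, s_9`. -/
def seqβ : Matrix (Fin 10) (Fin 10) ℤ := Matrix.of fun k j =>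
  νZ j + if 10 ≤ k.val + j.val then 2 else 0

theorem seqβ_succ : ∀ k : Fin 9, seqβ k.succ = seqβ k.castSucc +
    gramβ.mulVec (seqβ k.castSucc) (Fin.ofNat 10 (9 - k.val)) •
      Pi.single (Fin.ofNat 10 (9 - k.val)) 1 := by
  decide +kernel

theorem seqβ_gram : ∀ i j, seqβ i ⬝ᵥ gramβ.mulVec (seqβ j) = if i = j then -2 else 2 := by
  decide +kernel

theorem s_succ (k : Fin 9) :
    s k.succ = refl formβ (β (Fin.ofNat 10 (9 - k.val))) (s k.castSucc) := rfl

theorem s_eq (k : Fin 10) : s k = intComb β (seqβ k) := by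
  induction k using Fin.induction with
  | zero =>
    have : seqβ 0 = νZ := by decide +kernel
    rw [this, ← ν_eq]
    rfl
  | succ k ih =>
    rw [s_succ, ih, refl_eq (norm_β _), ← reflEquiv_apply (norm_β _), reflEquiv_intComb bilin_β,
      ← seqβ_succ]

theorem s_mem (k : Fin 10) : s k ∈ Pβ := by
  induction k using Fin.induction with
  | zero => exact mem_Pβ.mpr ⟨1, one_mem _, rfl⟩
  | succ k ih =>
    rw [s_succ, refl_eq (norm_β _), ← reflEquiv_apply (norm_β _)]
    exact map_mem_Pβ ih (reflEquiv_mem _ ⟨_, rfl⟩)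

theorem bilin_s (i j : Fin 10) : formβ (s i) (s j) = if i = j then -2 else 2 := by
  rw [s_eq, s_eq, bilin_intComb bilin_β, seqβ_gram]
  push_cast
  rfl

theorem isCluster_s : IsCluster formβ Pβ s := by
  refine ⟨s_mem, fun i j hij => ?_⟩
  refine areTangent_of_bilin (D := weightβ 0) two_pos ?_ ?_ ?_
    (bilin_weightβ_zero_pos (s_mem i)) (bilin_weightβ_zero_pos (s_mem j))
  · rw [bilin_s, if_pos rfl]
  · rw [bilin_s, if_pos rfl]
  · rw [bilin_s, if_neg hij]

end Beta

/-! ### Classification of the clusters of `P_β` -/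

section Clusters

/-- Ten vectors with the products of a cluster form a basis. -/
theorem linearIndependent_of_cluster {t : Fin 10 → Fin 10 → ℝ}
    (ht : ∀ i j, formβ (t i) (t j) = if i = j then -2 else 2) : LinearIndependent ℝ t := by
  rw [Fintype.linearIndependent_iff]
  intro a ha
  have h1 : ∀ i, a i = (∑ j, a j) / 2 := by
    intro i
    have h2 : formβ (t i) (∑ j, a j • t j) = 0 := by rw [ha, map_zero]
    have h3 : ∀ j, a j * (if i = j then (-2 : ℝ) else 2) =
        2 * a j - if i = j then 4 * a j else 0 := by
      intro j; split_ifs <;> ring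
    simp only [map_sum, map_smul, smul_eq_mul, ht, h3, Finset.sum_sub_distrib,
      Finset.sum_ite_eq, Finset.mem_univ, if_true, ← Finset.mul_sum] at h2
    linarith
  have h4 : ∑ j, a j = 0 := by
    have : ∑ j : Fin 10, a j = ∑ _j : Fin 10, (∑ j, a j) / 2 := Finset.sum_congr rfl fun i _ => h1 i
    rw [Finset.sum_const, Finset.card_univ, Fintype.card_fin, nsmul_eq_mul] at this
    push_cast at this
    linarith
  intro i
  rw [h1, h4, zero_div]

theorem eq_zero_of_forall_bilin_cluster {t : Fin 10 → Fin 10 → ℝ}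
    (ht : ∀ i j, formβ (t i) (t j) = if i = j then -2 else 2) {z : Fin 10 → ℝ}
    (hz : ∀ i, formβ z (t i) = 0) : z = 0 := by
  have hb : formβ z = 0 := by
    refine (basisOfLinearIndependentOfCardEqFinrank (linearIndependent_of_cluster ht)
      (by simp)).ext fun i => ?_
    rw [coe_basisOfLinearIndependentOfCardEqFinrank, hz, LinearMap.zero_apply]
  refine eq_zero_of_forall_bilin_β fun i => ?_
  rw [formβ_symm, hb, LinearMap.zero_apply]

theorem exists_eq_single_of_sum_sq {ι : Type*} [Fintype ι] [DecidableEq ι] {a : ι → ℤ}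
    (h1 : ∑ i, a i = 1) (h2 : ∑ i, a i ^ 2 = 1) : ∃ k, a = Pi.single k 1 := by
  obtain ⟨k, hk⟩ : ∃ k, a k ≠ 0 := by
    by_contra! hcon
    simp [hcon] at h1
  have hk1 : 1 ≤ a k ^ 2 := by
    have := sq_nonneg (a k)
    have h3 : a k ^ 2 ≠ 0 := pow_ne_zero 2 hk
    omega
  rw [← Finset.add_sum_erase _ _ (Finset.mem_univ k)] at h2
  have h4 : ∑ i ∈ Finset.univ.erase k, a i ^ 2 = 0 :=
    le_antisymm (by linarith) (Finset.sum_nonneg fun i _ => sq_nonneg _)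
  have h5 : ∀ i, i ≠ k → a i = 0 := fun i hi => by
    have := (Finset.sum_eq_zero_iff_of_nonneg fun i _ => sq_nonneg _).mp h4 i (by simp [hi])
    exact pow_eq_zero_iff two_ne_zero |>.mp this
  refine ⟨k, funext fun i => ?_⟩
  by_cases hi : i = k
  · subst hi
    rw [Pi.single_eq_same, ← h1]
    exact (Finset.sum_eq_single i (fun j _ hj => h5 j hj) (by simp)).symm
  · rw [h5 i hi, Pi.single_eq_of_ne hi]

theorem bilin_intComb_s (a : Fin 10 → ℤ) :
    formβ (intComb s a) (intComb s a) = ((2 * (∑ i, a i) ^ 2 - 4 * ∑ i, a i ^ 2 : ℤ) : ℝ) := by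
  rw [bilin_intComb (G := Matrix.of fun i j => if i = j then -2 else 2)
    (fun i j => by rw [bilin_s, Matrix.of_apply]; push_cast; rfl)]
  congr 1
  have h3 : ∀ i j, (if i = j then (-2 : ℤ) else 2) * a j =
      2 * a j - if i = j then 4 * a j else 0 := by
    intro i j; split_ifs <;> ring
  simp only [dotProduct, Matrix.mulVec, Matrix.of_apply, h3, Finset.sum_sub_distrib,
    Finset.sum_ite_eq, Finset.mem_univ, if_true, ← Finset.mul_sum, mul_sub, ← Finset.sum_mul]
  congr 1
  · ring
  · rw [Finset.mul_sum]
    exact Finset.sum_congr rfl fun i _ => by ring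

theorem eq_s_of_coords {m : Fin 10 → ℤ} (h0 : m 0 = 0)
    (hm : formβ (ν + (2 : ℝ) • intComb β m) (ν + (2 : ℝ) • intComb β m) = -2) :
    ∃ k, ν + (2 : ℝ) • intComb β m = s k := by
  -- Since `2β_{10-k} = s_k - s_{k-1}` and `m_0 = 0`, summation by parts writes the vector as `∑ a_k
  -- s_k` with `∑ a_k = 1`. Norm `-2` then means `∑ a_k² = 1`.
  set a : Fin 10 → ℤ := ![1 - m 9, m 9 - m 8, m 8 - m 7, m 7 - m 6, m 6 - m 5, m 5 - m 4,
    m 4 - m 3, m 3 - m 2, m 2 - m 1, m 1] with ha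
  have hsum : ∑ i, a i = 1 := by
    simp [ha, Fin.sum_univ_succ]
  have hvec : Matrix.vecMul a seqβ = νZ + (2 : ℤ) • m := by
    have h1 : ∀ j, Matrix.vecMul a seqβ j =
        νZ j + ∑ i, a i * (if 10 ≤ i.val + j.val then 2 else 0) := by
      intro j
      simp only [Matrix.vecMul, dotProduct, seqβ, Matrix.of_apply, mul_add, Finset.sum_add_distrib,
        ← Finset.sum_mul, hsum, one_mul]
    ext j
    rw [h1, Pi.add_apply, Pi.smul_apply, smul_eq_mul]
    congr 1
    fin_cases j <;> simp [Fin.sum_univ_succ, ha, h0] <;> ring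
  have heq : ν + (2 : ℝ) • intComb β m = intComb s a := by
    have : s = fun k => intComb β (seqβ k) := funext s_eq
    rw [this, intComb_intComb, hvec, intComb_add, intComb_smul, ← ν_eq]
    norm_num
  rw [heq, bilin_intComb_s, hsum] at hm
  have hsq : ∑ i, a i ^ 2 = 1 := by
    have : (2 * 1 ^ 2 - 4 * ∑ i, a i ^ 2 : ℤ) = -2 := by exact_mod_cast hm
    linarith
  obtain ⟨k, hk⟩ := exists_eq_single_of_sum_sq hsum hsq
  exact ⟨k, by rw [heq, hk, intComb_single]⟩

/-- Tangency gives the product up to sign, and the packing inequality fixes the sign. -/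
theorem bilin_of_isCluster {t : Fin 10 → Fin 10 → ℝ} (ht : IsCluster formβ Pβ t) (i j : Fin 10) :
    formβ (t i) (t j) = if i = j then -2 else 2 := by
  split_ifs with hij
  · rw [hij, norm_of_mem_Pβ (ht.1 j)]
  · have h1 := ht.2 i j hij
    have h2 := two_le_bilin_Pβ (ht.1 i) (ht.1 j) h1.ne.symm
    have h3 := h1.2
    rw [norm_of_mem_Pβ (ht.1 i), norm_of_mem_Pβ (ht.1 j), abs_of_pos (by linarith),
      Real.sqrt_mul_self_eq_abs] at h3
    rw [h3]; norm_num

/-- If the cluster sum is `c w_j`, its products `c ν_j = 16` with `ν` and `c² (w_j·w_j) = 160` with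
itself yield this equation; it singles out `w_0`. -/
theorem dualβ_diag : ∀ j, 4 * dualβ j j = 5 * νZ j ^ 2 → j = 0 ∨ νZ j = 0 := by decide +kernel

theorem νZ_eq_zero : ∀ i j, νZ i = 0 → νZ j = 0 → i = j := by decide +kernel

theorem ν_apply (j : Fin 10) : ν j = νZ j := by rw [ν_eq, intComb_β]

/-- A cluster whose sum lies in the chamber consists of the spheres `s_k`. -/
theorem exists_eq_s_of_dominant {t : Fin 10 → Fin 10 → ℝ} (htP : ∀ i, t i ∈ Pβ)
    (ht : ∀ i j, formβ (t i) (t j) = if i = j then -2 else 2)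
    (hdom : ∀ k, 0 ≤ formβ (β k) (∑ i, t i)) (i : Fin 10) : ∃ k, t i = s k := by
  obtain ⟨x, hx⟩ : ∃ x, x = ∑ i, t i := ⟨_, rfl⟩
  rw [← hx] at hdom
  -- `16 = -2 + 9·2`, whence `x·x = 10·16`.
  have hxt : ∀ i, formβ x (t i) = 16 := by
    intro i
    have h3 : ∀ j, (if j = i then (-2 : ℝ) else 2) = 2 - if j = i then 4 else 0 := by
      intro j; split_ifs <;> ring
    rw [hx, map_sum, LinearMap.sum_apply]
    simp only [ht, h3, Finset.sum_sub_distrib, Finset.sum_ite_eq', Finset.mem_univ, if_true,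
      Finset.sum_const, Finset.card_univ, Fintype.card_fin]
    norm_num
  have hxx : formβ x x = 160 := by
    have : formβ x x = formβ x (∑ i, t i) := by rw [← hx]
    rw [this, map_sum]
    simp only [hxt, Finset.sum_const, Finset.card_univ, Fintype.card_fin]
    norm_num
  choose m hm0 hm using fun i => exists_coords_of_mem_Pβ (htP i)
  have hmR : ∀ i j, (0 : ℝ) ≤ m i j := fun i j => by exact_mod_cast hm0 i j
  have hsum : ∀ i, 16 = formβ x ν + 2 * ∑ j, (m i j : ℝ) * formβ (β j) x := by
    intro i
    rw [← hxt i, hm i, map_add, map_smul, bilin_intComb_β, smul_eq_mul]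
  have hnn : ∀ i, 0 ≤ ∑ j, (m i j : ℝ) * formβ (β j) x := fun i =>
    Finset.sum_nonneg fun j _ => mul_nonneg (hmR i j) (hdom j)
  -- The upper bound comes from dominance. For the lower bound, either `ν` is in the cluster, or
  -- each of the ten members has product at least `2` with `ν`. Equality forces every term `m_ij
  -- (β_j·x)` to vanish.
  have hxν : formβ x ν = 16 := by
    refine le_antisymm (by linarith [hsum 0, hnn 0]) ?_
    by_cases hex : ∃ i, t i = ν
    · obtain ⟨i, hi⟩ := hex
      rw [← hi, hxt]
    · push Not at hex
      have : ∑ _i : Fin 10, (2 : ℝ) ≤ formβ x ν := by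
        rw [formβ_symm, hx, map_sum]
        exact Finset.sum_le_sum fun i _ => two_le_bilin_ν (htP i) (hex i)
      simp only [Finset.sum_const, Finset.card_univ, Fintype.card_fin] at this
      norm_num at this
      linarith
  have hzero : ∀ i j, (m i j : ℝ) * formβ (β j) x = 0 := by
    intro i j
    have h1 : ∑ j, (m i j : ℝ) * formβ (β j) x = 0 := by linarith [hsum i]
    exact (Finset.sum_eq_zero_iff_of_nonneg
      fun j _ => mul_nonneg (hmR i j) (hdom j)).mp h1 j (Finset.mem_univ j)
  have hcoord : ∀ j, formβ (β j) x ≠ 0 → ∀ i, t i j = ν j := by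
    intro j hj i
    rcases mul_eq_zero.mp (hzero i j) with h | h
    · rw [hm i, intComb_β]
      simp [h]
    · exact absurd h hj
  obtain ⟨j, hj⟩ : ∃ j, formβ (β j) x ≠ 0 := by
    by_contra! hcon
    rw [eq_zero_of_forall_bilin_β hcon] at hxx
    norm_num at hxx
  -- If `x` were positive on two nodes, all members would share the `j`-th and `k`-th coordinates of
  -- `ν`. So `ν_k w_j - ν_j w_k` would be orthogonal to a basis, although `ν` has only one zero
  -- coordinate.
  have huniq : ∀ k, k ≠ j → formβ (β k) x = 0 := by
    intro k hkj
    by_contra hk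
    have hz := eq_zero_of_forall_bilin_cluster ht (z := ν k • weightβ j - ν j • weightβ k) (by
      intro i
      rw [formβ_symm, map_sub, map_smul, map_smul, bilin_weightβ_right, bilin_weightβ_right,
        hcoord j hj, hcoord k hk, smul_eq_mul, smul_eq_mul]
      ring)
    have h1 : formβ (β j) (ν k • weightβ j - ν j • weightβ k) = 0 := by rw [hz, map_zero]
    have h2 : formβ (β k) (ν k • weightβ j - ν j • weightβ k) = 0 := by rw [hz, map_zero]
    simp only [map_sub, map_smul, bilin_node_weightβ, smul_eq_mul, if_pos, if_neg hkj,
      if_neg hkj.symm, ν_apply] at h1 h2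
    refine hkj (νZ_eq_zero k j ?_ ?_)
    · have : (νZ k : ℝ) = 0 := by linarith
      exact_mod_cast this
    · have : (νZ j : ℝ) = 0 := by linarith
      exact_mod_cast this
  set c := formβ (β j) x with hc
  have hxw : x = c • weightβ j := by
    refine sub_eq_zero.mp (eq_zero_of_forall_bilin_β fun k => ?_)
    rw [map_sub, map_smul, bilin_node_weightβ, smul_eq_mul]
    by_cases hk : k = j
    · rw [if_pos hk, hk, ← hc]; ring
    · rw [if_neg hk, huniq k hk]; ring
  have hcν : c * νZ j = 16 := by
    rw [hxw, formβ_symm, map_smul, bilin_weightβ_right, ν_apply, smul_eq_mul] at hxν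
    exact hxν
  have hcc : c ^ 2 * dualβ j j = 320 := by
    rw [hxw] at hxx
    simp only [map_smul, LinearMap.smul_apply, smul_eq_mul, bilin_weightβ] at hxx
    linarith
  have hj0 : j = 0 := by
    have h1 : 4 * dualβ j j = 5 * νZ j ^ 2 := by
      have h2 : (c * νZ j) ^ 2 = 256 := by rw [hcν]; norm_num
      have h3 : c ^ 2 * (4 * dualβ j j) = c ^ 2 * (5 * νZ j ^ 2 : ℝ) := by linarith
      have h4 := mul_left_cancel₀ (pow_ne_zero 2 hj) h3
      exact_mod_cast h4
    rcases dualβ_diag j h1 with h | h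
    · exact h
    · rw [h] at hcν; norm_num at hcν
  have hmi : m i 0 = 0 := by
    have := hzero i j
    rw [← hc] at this
    rcases mul_eq_zero.mp this with h | h
    · rw [hj0] at h; exact_mod_cast h
    · exact absurd h hj
  have hnorm := norm_of_mem_Pβ (htP i)
  rw [hm i] at hnorm ⊢
  exact eq_s_of_coords hmi hnorm

theorem exists_map_of_isCluster {t : Fin 10 → Fin 10 → ℝ} (ht : IsCluster formβ Pβ t) :
    ∃ g ∈ Γβ, ∃ σ : Equiv.Perm (Fin 10), ∀ i, t i = g (s (σ i)) := by
  have htt := bilin_of_isCluster ht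
  set x := ∑ i, t i with hx
  have hpos : 0 < formβ x (weightβ 0) := by
    rw [hx, map_sum, LinearMap.sum_apply]
    exact Finset.sum_pos (fun i _ => bilin_weightβ_zero_pos (ht.1 i)) Finset.univ_nonempty
  have hxx : 0 < formβ x x := by
    have h3 : ∀ i j : Fin 10, (if j = i then (-2 : ℝ) else 2) = 2 - if j = i then 4 else 0 := by
      intro i j; split_ifs <;> ring
    rw [hx]
    simp only [map_sum, LinearMap.sum_apply, htt, h3, Finset.sum_sub_distrib, Finset.sum_ite_eq',
      Finset.mem_univ, if_true, Finset.sum_const, Finset.card_univ, Fintype.card_fin]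
    norm_num
  have hw0 : 0 < formβ (weightβ 0) (weightβ 0) := by
    rw [bilin_weightβ]; norm_num [show dualβ 0 0 = 5 from rfl]
  have hρ : 0 < formβ (intComb β rhoβ) (weightβ 0) := by
    rw [bilin_weightβ_right, intComb_β]
    have : 0 < rhoβ 0 := by decide +kernel
    exact Int.cast_pos.mpr this
  obtain ⟨g, hg, hd⟩ := exists_dominant isHyperbolic_formβ hasCoxeterGraph_β.isSimplyLaced
    (w := weightβ) (by rw [coe_basisβ]; exact bilin_node_weightβ) (ρ := intComb β rhoβ)
    (by rw [coe_basisβ]; exact intComb_mem_closure _ _) norm_rhoβ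
    (by rw [coe_basisβ]; intro i; rw [bilin_β_rho]; norm_num) hxx
    (isHyperbolic_formβ.pos_of_forward hw0 hxx norm_rhoβ.le hpos hρ)
  rw [← Γβ_eq] at hg
  rw [coe_basisβ, hx, map_sum] at hd
  choose σ hσ using exists_eq_s_of_dominant (t := fun i => g (t i))
    (fun i => map_mem_Pβ (ht.1 i) hg) (fun i j => by rw [Γβ_isometry hg, htt]) hd
  have hinj : Function.Injective σ := by
    intro i j hij
    by_contra hne
    have h1 : g (t i) = g (t j) := by rw [hσ i, hσ j, hij]
    exact (ht.2 i j hne).ne (g.injective h1)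
  refine ⟨g⁻¹, inv_mem hg, Equiv.ofBijective σ (Finite.injective_iff_bijective.mp hinj),
    fun i => ?_⟩
  rw [Equiv.ofBijective_apply, ← hσ i]
  exact (g.symm_apply_apply (t i)).symm

/-- The reflection in `β_{9-k}` exchanges `s_k` and `s_{k+1}` and fixes the other eight spheres;
adjacent transpositions generate the symmetric group. -/
theorem seqβ_swap : ∀ (k : Fin 9) (i : Fin 10),
    seqβ i + gramβ.mulVec (seqβ i) k.rev.succ • Pi.single k.rev.succ 1 =
      seqβ (Equiv.swap k.castSucc k.succ i) := by
  decide +kernel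

/-- All permutations of the spheres `s_k` are induced by the group. -/
theorem exists_map_s_eq (σ : Equiv.Perm (Fin 10)) : ∃ g ∈ Γβ, ∀ i, g (s i) = s (σ i) := by
  have hσ : σ ∈ Submonoid.closure
      (Set.range fun i : Fin 9 => Equiv.swap i.castSucc i.succ) := by
    rw [Equiv.Perm.mclosure_swap_castSucc_succ]; trivial
  induction hσ using Submonoid.closure_induction with
  | mem σ hσ =>
    obtain ⟨k, rfl⟩ := hσ
    refine ⟨reflEquiv (norm_β k.rev.succ), reflEquiv_mem _ ⟨_, rfl⟩, fun i => ?_⟩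
    rw [s_eq, reflEquiv_intComb bilin_β, seqβ_swap, ← s_eq]
  | one => exact ⟨1, one_mem _, fun i => rfl⟩
  | mul σ τ _ _ hσ hτ =>
    obtain ⟨g, hg, h1⟩ := hσ
    obtain ⟨k, hk, h2⟩ := hτ
    exact ⟨g * k, mul_mem hg hk, fun i => by
      rw [LinearEquiv.mul_apply, h2, h1, Equiv.Perm.mul_apply]⟩

/-- Up to the group, the hyperplane through nine spheres of a cluster is the one orthogonal to
`s_0, …, s_8`. -/
theorem exists_map_orthogonal {t : Fin 10 → Fin 10 → ℝ} (ht : IsCluster formβ Pβ t) (j : Fin 10)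
    {h : Fin 10 → ℝ} (hh : ∀ i, i ≠ j → formβ h (t i) = 0) :
    ∃ g ∈ Γβ, ∀ i, i ≠ 9 → formβ h (g (s i)) = 0 := by
  obtain ⟨g, hg, σ, hσ⟩ := exists_map_of_isCluster ht
  -- The transposition makes `s_9` correspond to the omitted member `t_j`.
  obtain ⟨k, hk, hks⟩ := exists_map_s_eq (Equiv.swap 9 (σ j))
  refine ⟨g * k, mul_mem hg hk, fun i hi => ?_⟩
  have h1 := hσ (σ.symm (Equiv.swap 9 (σ j) i))
  rw [σ.apply_symm_apply] at h1
  rw [LinearEquiv.mul_apply, hks, ← h1]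
  refine hh _ fun h2 => hi ?_
  rw [Equiv.symm_apply_eq, Equiv.swap_apply_eq_iff, Equiv.swap_apply_right] at h2
  exact h2

end Clusters

/-! ### Reflection groups of a subspace and of the whole space -/

section Restriction

variable {V : Type*} [AddCommGroup V] [Module ℝ V] {B : LinearMap.BilinForm ℝ V} {ι : Type*}

/-- A reflection in a vector of `H`, taken in the whole space, restricts to the corresponding
reflection of `H`; so words extend, and conversely restrict, letter by letter. -/
theorem exists_extension_reflGroup {H : Submodule ℝ V} {v : ι → H}
    (hv : ∀ i, B.restrict H (v i) (v i) = -2) :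
    ∀ g ∈ reflGroup (B.restrict H) (Set.range v),
      ∃ k ∈ reflGroup B (Set.range fun i => (v i : V)), ∀ x : H, k x = g x := by
  have hv' : ∀ i, B (v i : V) (v i) = -2 := hv
  refine reflGroup_induction hv ⟨1, one_mem _, fun x => rfl⟩ ?_
  rintro i g ⟨k, hk, h⟩
  refine ⟨reflEquiv (hv' i) * k,
    mul_mem (reflEquiv_mem _ ⟨i, rfl⟩) hk, fun x => ?_⟩
  rw [LinearEquiv.mul_apply, LinearEquiv.mul_apply, h, reflEquiv_apply, reflEquiv_apply]
  rfl

theorem exists_restriction_reflGroup {H : Submodule ℝ V} {v : ι → H}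
    (hv : ∀ i, B.restrict H (v i) (v i) = -2) :
    ∀ k ∈ reflGroup B (Set.range fun i => (v i : V)),
      ∃ g ∈ reflGroup (B.restrict H) (Set.range v), ∀ x : H, k x = g x := by
  have hv' : ∀ i, B (v i : V) (v i) = -2 := hv
  refine reflGroup_induction hv' ⟨1, one_mem _, fun x => rfl⟩ ?_
  rintro i k ⟨g, hg, h⟩
  refine ⟨reflEquiv (hv i) * g, mul_mem (reflEquiv_mem _ ⟨i, rfl⟩) hg, fun x => ?_⟩
  rw [LinearEquiv.mul_apply, LinearEquiv.mul_apply, h, reflEquiv_apply, reflEquiv_apply]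
  rfl

theorem reflEquiv_map {g : V ≃ₗ[ℝ] V} (hg : ∀ x y, B (g x) (g y) = B x y) {n : V}
    (hn : B n n = -2) (hgn : B (g n) (g n) = -2) : reflEquiv hgn = g * reflEquiv hn * g⁻¹ := by
  ext x
  have h1 : B (g n) x = B n (g⁻¹ x) := by
    rw [← hg n]
    congr 1
    exact (g.apply_symm_apply x).symm
  have h2 : g (g⁻¹ x) = x := g.apply_symm_apply x
  rw [LinearEquiv.mul_apply, LinearEquiv.mul_apply, reflEquiv_apply, reflEquiv_apply, map_add,
    map_smul, h1, h2]

theorem coe_normalize {H : Submodule ℝ V} (x : H) :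
    ((normalize (B.restrict H) x : H) : V) = normalize B (x : V) := rfl

theorem coe_intComb {H : Submodule ℝ V} [Fintype ι] (v : ι → H) (X : ι → ℤ) :
    ((intComb v X : H) : V) = intComb (fun i => (v i : V)) X := by
  simp [intComb]

theorem map_intComb {W : Type*} [AddCommGroup W] [Module ℝ W] [Fintype ι] (g : V ≃ₗ[ℝ] W)
    (v : ι → V) (X : ι → ℤ) : g (intComb v X) = intComb (fun i => g (v i)) X := by
  simp [intComb]

end Restriction

/-! ### The hyperplane of a cluster and its cross section -/

section CrossSection

/-- The coordinates of the nodes `β'`. -/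
def nodesZ : Matrix (Fin 9) (Fin 10) ℤ := Matrix.of fun i j =>
  if i = 0 then (![2, 1, 1, 2, 3, 2, 1, 0, 0, 0] : Fin 10 → ℤ) j else if j = i.succ then 1 else 0

theorem β'_eq (i : Fin 9) : β' i = intComb β (nodesZ i) := by
  rw [intComb_β]
  ext j
  by_cases hi : i = 0
  · subst hi
    simp only [β', if_true, nodesZ, Matrix.of_apply]
    fin_cases j <;> simp
  · simp [β', hi, nodesZ, β, Pi.single_apply]

theorem nodesZ_gram (i j : Fin 9) :
    nodesZ i ⬝ᵥ gramβ.mulVec (nodesZ j) = gramN9 i j := by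
  have : ∀ i j : Fin 9, nodesZ i ⬝ᵥ gramβ.mulVec (nodesZ j) - gramN9 i j = 0 := by decide +kernel
  exact sub_eq_zero.mp (this i j)

theorem hasCoxeterGraph_β' : HasCoxeterGraph formβ β' graphN9 := by
  intro i j
  rw [incidenceMatrix_graphN9, β'_eq, β'_eq, bilin_intComb bilin_β, nodesZ_gram]

theorem norm_β' (i : Fin 9) : formβ (β' i) (β' i) = -2 := by
  rw [hasCoxeterGraph_β', incidenceMatrix]
  simp

/-- The effect of a word in the simple reflections on integral coordinates. -/
def reflWordZ : List (Fin 10) → (Fin 10 → ℤ) → Fin 10 → ℤ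
  | [], X => X
  | i :: l, X => reflWordZ l X + gramβ.mulVec (reflWordZ l X) i • Pi.single i 1

theorem exists_map_intComb (l : List (Fin 10)) (X : Fin 10 → ℤ) :
    ∃ g ∈ Γβ, intComb β (reflWordZ l X) = g (intComb β X) := by
  induction l with
  | nil => exact ⟨1, one_mem _, rfl⟩
  | cons i l ih =>
    obtain ⟨g, hg, h⟩ := ih
    refine ⟨reflEquiv (norm_β i) * g, mul_mem (reflEquiv_mem _ ⟨i, rfl⟩) hg, ?_⟩
    rw [LinearEquiv.mul_apply, ← h, reflEquiv_intComb bilin_β]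
    rfl

theorem exists_β'_eq_map (i : Fin 9) : ∃ g ∈ Γβ, ∃ k, β' i = g (β k) := by
  by_cases hi : i = 0
  -- This word carries `β_6` to `β_1'`, which is therefore a root, and its reflection is conjugate
  -- to that of `β_6`.
  · obtain ⟨g, hg, h⟩ := exists_map_intComb [0, 1, 4, 3, 2, 5, 4, 0, 3, 4, 5] (Pi.single 6 1)
    refine ⟨g, hg, 6, ?_⟩
    rw [← intComb_single β, ← h, β'_eq, hi]
    congr 1
    decide +kernel
  · exact ⟨1, one_mem _, i.succ, by rw [β', if_neg hi]; rfl⟩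

theorem reflGroup_map_β'_le {g : (Fin 10 → ℝ) ≃ₗ[ℝ] (Fin 10 → ℝ)} (hg : g ∈ Γβ) :
    reflGroup formβ (Set.range fun i => g (β' i)) ≤ Γβ := by
  have hn : ∀ i, formβ (g (β' i)) (g (β' i)) = -2 := fun i => by rw [Γβ_isometry hg, norm_β']
  refine reflGroup_induction hn (one_mem _) fun i k hk => mul_mem ?_ hk
  obtain ⟨γ, hγ, j, hj⟩ := exists_β'_eq_map i
  have hgγ := mul_mem hg hγ
  have h1 : g (β' i) = (g * γ) (β j) := by rw [hj]; rfl
  have h2 : formβ ((g * γ) (β j)) ((g * γ) (β j)) = -2 := h1 ▸ hn i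
  have h3 : reflEquiv (hn i) = reflEquiv h2 := by
    ext x
    rw [reflEquiv_apply, reflEquiv_apply, h1]
  rw [h3, reflEquiv_map (Γβ_isometry hgγ) (norm_β j) h2]
  exact mul_mem (mul_mem hgγ (reflEquiv_mem _ ⟨j, rfl⟩)) (inv_mem hgγ)

/-- The coordinates of a normal vector of the hyperplane through `s_0, …, s_8`. -/
def normalZ : Fin 10 → ℤ := ![1, -3, -2, -1, 0, 0, 0, 0, 0, 0]

theorem bilin_normal_s (i : Fin 10) (hi : i ≠ 9) : formβ (intComb β normalZ) (s i) = 0 := by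
  rw [s_eq, bilin_intComb bilin_β]
  have : ∀ i, i ≠ 9 → normalZ ⬝ᵥ gramβ.mulVec (seqβ i) = 0 := by decide +kernel
  rw [this i hi, Int.cast_zero]

theorem bilin_normal_s_nine : formβ (intComb β normalZ) (s 9) = 8 := by
  rw [s_eq, bilin_intComb bilin_β]
  have : normalZ ⬝ᵥ gramβ.mulVec (seqβ 9) = 8 := by decide +kernel
  rw [this]; norm_num

theorem norm_normal : formβ (intComb β normalZ) (intComb β normalZ) = -14 := by
  rw [bilin_intComb bilin_β]
  have : normalZ ⬝ᵥ gramβ.mulVec normalZ = -14 := by decide +kernel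
  rw [this]; norm_num

theorem bilin_normal_β' (i : Fin 9) : formβ (intComb β normalZ) (β' i) = 0 := by
  rw [β'_eq, bilin_intComb bilin_β]
  have : ∀ i, normalZ ⬝ᵥ gramβ.mulVec (nodesZ i) = 0 := by decide +kernel
  rw [this, Int.cast_zero]

/-- The normal vector is orthogonal to `ν` and even on all nodes, and `t - ν` is twice an integral
combination of nodes. -/
theorem exists_bilin_normal {t : Fin 10 → ℝ} (ht : t ∈ Pβ) :
    ∃ k : ℤ, formβ t (intComb β normalZ) = 4 * k := by
  obtain ⟨m, -, rfl⟩ := exists_coords_of_mem_Pβ ht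
  have h1 : formβ (intComb β normalZ) ν = 0 := bilin_normal_s 0 (by decide)
  refine ⟨-m 0 + 2 * m 1, ?_⟩
  rw [formβ_symm, map_add, h1, map_smul, bilin_intComb_β]
  have h2 : ∀ i, formβ (β i) (intComb β normalZ) =
      ((if i = 0 then -2 else if i = 1 then 4 else 0 : ℤ) : ℝ) := by
    intro i
    rw [bilin_single_intComb bilin_β]
    congr 1
    revert i
    decide +kernel
  simp only [h2, Fin.sum_univ_succ]
  simp
  ring

theorem eq_smul_normal {h : Fin 10 → ℝ} (hh : ∀ i, i ≠ 9 → formβ h (s i) = 0) :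
    h = (formβ h (s 9) / 8) • intComb β normalZ := by
  refine sub_eq_zero.mp (eq_zero_of_forall_bilin_cluster bilin_s fun i => ?_)
  rw [map_sub, map_smul, LinearMap.sub_apply, LinearMap.smul_apply, smul_eq_mul]
  by_cases hi : i = 9
  · rw [hi, bilin_normal_s_nine]; ring
  · rw [hh i hi, bilin_normal_s i hi]; ring

/-- A hyperplane orthogonal to the images of `s_0, …, s_8` under an element of the group. -/
structure IsClusterHyperplane (g : (Fin 10 → ℝ) ≃ₗ[ℝ] (Fin 10 → ℝ)) (h : Fin 10 → ℝ) : Prop where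
  mem : g ∈ Γβ
  ne_zero : h ≠ 0
  orthogonal : ∀ i, i ≠ 9 → formβ h (g (s i)) = 0

variable {g : (Fin 10 → ℝ) ≃ₗ[ℝ] (Fin 10 → ℝ)} {h : Fin 10 → ℝ}

namespace IsClusterHyperplane

theorem exists_eq_smul (H : IsClusterHyperplane g h) :
    ∃ c : ℝ, c ≠ 0 ∧ h = c • g (intComb β normalZ) := by
  have h1 := eq_smul_normal (h := g⁻¹ h) fun i hi => by
    rw [inv_apply_bilin formβ_symm norm_β H.mem]; exact H.orthogonal i hi
  set c := formβ (g⁻¹ h) (s 9) / 8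
  have h2 : h = c • g (intComb β normalZ) := by
    rw [← map_smul, ← h1]
    exact (g.apply_symm_apply h).symm
  refine ⟨c, fun hc => H.ne_zero ?_, h2⟩
  rw [h2, hc, zero_smul]

theorem mem_iff (H : IsClusterHyperplane g h) (x : Fin 10 → ℝ) :
    x ∈ hyperplane formβ h ↔ formβ (g (intComb β normalZ)) x = 0 := by
  obtain ⟨c, hc, rfl⟩ := H.exists_eq_smul
  rw [LinearMap.mem_ker, map_smul, LinearMap.smul_apply, smul_eq_mul, mul_eq_zero]
  simp [hc]

theorem map_β'_mem (H : IsClusterHyperplane g h) (i : Fin 9) :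
    g (β' i) ∈ hyperplane formβ h := by
  rw [H.mem_iff, Γβ_isometry H.mem, bilin_normal_β']

theorem exists_basis (H : IsClusterHyperplane g h) :
    ∃ v : Module.Basis (Fin 9) ℝ (hyperplane formβ h),
      (∀ i, (v i : Fin 10 → ℝ) = g (β' i)) ∧
      HasCoxeterGraph (hyperplaneForm formβ h) v graphN9 := by
  let u : Fin 9 → hyperplane formβ h := fun i => ⟨g (β' i), H.map_β'_mem i⟩
  have hu : HasCoxeterGraph (hyperplaneForm formβ h) u graphN9 := by
    intro i j
    rw [← hasCoxeterGraph_β', ← Γβ_isometry H.mem]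
    rfl
  have hli : LinearIndependent ℝ u := by
    rw [Fintype.linearIndependent_iff]
    intro a ha i
    have h1 : hyperplaneForm formβ h (∑ j, a j • u j) (weightN9 u i) = 0 := by
      rw [ha, map_zero, LinearMap.zero_apply]
    rw [map_sum, LinearMap.sum_apply] at h1
    simp only [map_smul, LinearMap.smul_apply, bilin_node_weightN9 hu, smul_eq_mul, mul_ite,
      mul_one, mul_zero, Finset.sum_ite_eq', Finset.mem_univ, if_true] at h1
    exact h1
  have hne : formβ h ≠ 0 := by
    intro h0
    exact H.ne_zero (eq_zero_of_forall_bilin_β fun i => by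
      rw [formβ_symm, h0, LinearMap.zero_apply])
  have hfin : Module.finrank ℝ (hyperplane formβ h) = 9 := by
    have h1 : Module.finrank ℝ (hyperplane formβ h) + 1 = Module.finrank ℝ (Fin 10 → ℝ) :=
      Module.Dual.finrank_ker_add_one_of_ne_zero (f := formβ h) hne
    rw [Module.finrank_fin_fun] at h1
    omega
  refine ⟨basisOfLinearIndependentOfCardEqFinrank hli (by simp [hfin]), fun i => ?_, ?_⟩
  · rw [coe_basisOfLinearIndependentOfCardEqFinrank]
  · rw [coe_basisOfLinearIndependentOfCardEqFinrank]
    exact hu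

theorem norm_map_normal (H : IsClusterHyperplane g h) :
    formβ (g (intComb β normalZ)) (g (intComb β normalZ)) = -14 := by
  rw [Γβ_isometry H.mem, norm_normal]

theorem exists_bilin_map_normal (H : IsClusterHyperplane g h) {t : Fin 10 → ℝ} (ht : t ∈ Pβ) :
    ∃ k : ℤ, formβ t (g (intComb β normalZ)) = 4 * k := by
  obtain ⟨k, hk⟩ := exists_bilin_normal (map_mem_Pβ ht (inv_mem H.mem))
  exact ⟨k, by rw [← hk, inv_apply_bilin formβ_symm norm_β H.mem]⟩

/-- The members of the cross section are the normalized projections of the spheres `t` whose product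
with the normal vector is `0` or `±4`. -/
theorem exists_eq_projection (H : IsClusterHyperplane g h) {n : hyperplane formβ h}
    (hn : n ∈ crossSection formβ Pβ h) :
    ∃ t ∈ Pβ, ∃ a κ : ℝ, 0 < a ∧ (κ = 0 ∨ κ = 4 ∨ κ = -4) ∧ a ^ 2 * (2 - κ ^ 2 / 14) = 1 ∧
      formβ t (g (intComb β normalZ)) = κ ∧
      (n : Fin 10 → ℝ) = a • (t + (κ / 14) • g (intComb β normalZ)) := by
  obtain ⟨hnn, t, ht, hx⟩ := hn
  set N := g (intComb β normalZ) with hN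
  have hNN : formβ N N = -14 := H.norm_map_normal
  have hNn : formβ N n = 0 := (H.mem_iff _).mp n.2
  -- Since `n·n = -1`, the point `-n` lies in the half-space of `n`, so `q > 0`. Functionals on `H`
  -- with the same positive half-space are proportional, and evaluation at `-n` gives the factor
  -- `q`.
  set q := formβ t (-n : hyperplane formβ h) with hq
  have hq0 : 0 < q := by
    rw [hq, ← hx]
    simp [hnn]
  have hprop : ∀ x : hyperplane formβ h, formβ n x = q⁻¹ * formβ t x := by
    intro x
    have key : ∀ z : hyperplane formβ h, formβ t z = 0 → formβ n z = 0 := by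
      intro z hz
      have h1 : ¬ 0 < formβ n z := by rw [hx, hz]; exact lt_irrefl 0
      have h2 : ¬ 0 < formβ n (-z : hyperplane formβ h) := by
        rw [hx]; simp [hz]
      have h3 : formβ n (-z : hyperplane formβ h) = -formβ n z := by simp
      rw [h3] at h2
      linarith
    have h4 := key (x - (formβ t x / q) • (-n)) (by
      rw [Submodule.coe_sub, Submodule.coe_smul, map_sub, map_smul, ← hq, smul_eq_mul,
        div_mul_cancel₀ _ hq0.ne', sub_self])
    rw [Submodule.coe_sub, Submodule.coe_smul, map_sub, map_smul, Submodule.coe_neg, map_neg, hnn,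
      smul_eq_mul] at h4
    rw [inv_mul_eq_div]
    linarith
  set κ := formβ t N with hκ
  have heq : (n : Fin 10 → ℝ) = q⁻¹ • (t + (κ / 14) • N) := by
    refine sub_eq_zero.mp (eq_zero_of_forall_bilin_β fun i => ?_)
    rw [formβ_symm]
    -- The projection of `β_i` to the hyperplane, because `N·N = -14`.
    set y : Fin 10 → ℝ := β i + (formβ N (β i) / 14) • N with hy
    have hyH : y ∈ hyperplane formβ h := by
      rw [H.mem_iff, hy, map_add, map_smul, hNN, smul_eq_mul]; ring
    have h1 := hprop ⟨y, hyH⟩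
    simp only [hy, map_add, map_smul, smul_eq_mul, formβ_symm n N, hNn, ← hκ] at h1
    simp only [map_sub, map_smul, map_add, LinearMap.sub_apply, LinearMap.smul_apply,
      LinearMap.add_apply, smul_eq_mul]
    linarith
  have hnorm : (q⁻¹) ^ 2 * (2 - κ ^ 2 / 14) = 1 := by
    have h1 := hnn
    rw [heq] at h1
    simp only [map_smul, map_add, LinearMap.smul_apply, LinearMap.add_apply, smul_eq_mul, hNN,
      norm_of_mem_Pβ ht, formβ_symm N t, ← hκ] at h1
    linarith
  refine ⟨t, ht, q⁻¹, κ, inv_pos.mpr hq0, ?_, hnorm, rfl, heq⟩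
  obtain ⟨k, hk⟩ := H.exists_bilin_map_normal ht
  rw [← hN, ← hκ] at hk
  -- The projection of `t` has norm `-(2 - κ²/14)`, which must be negative; with `κ ∈ 4ℤ` only `0`
  -- and `±4` remain.
  have h5 : κ ^ 2 < 28 := by
    have : 0 < (q⁻¹) ^ 2 := by positivity
    by_contra! hcon
    nlinarith
  have h6 : ((16 * k ^ 2 : ℤ) : ℝ) < 28 := by
    push_cast
    rw [hk] at h5
    linarith
  have h7 : 16 * k ^ 2 < 28 := by exact_mod_cast h6
  have h8 : k < 2 := by nlinarith
  have h9 : -2 < k := by nlinarith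
  have h10 : k = 0 ∨ k = 1 ∨ k = -1 := by omega
  rcases h10 with rfl | rfl | rfl <;> simp [hk]

theorem one_le_bilin (H : IsClusterHyperplane g h) {n n' : hyperplane formβ h}
    (hn : n ∈ crossSection formβ Pβ h) (hn' : n' ∈ crossSection formβ Pβ h) (hne : n' ≠ n) :
    1 ≤ formβ n n' := by
  obtain ⟨t, ht, a, κ, ha, hκ, hak, htN, hnt⟩ := H.exists_eq_projection hn
  obtain ⟨t', ht', a', κ', ha', hκ', hak', htN', hnt'⟩ := H.exists_eq_projection hn'
  have htt : 2 ≤ formβ t t' := by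
    refine two_le_bilin_Pβ ht ht' fun h => hne (Subtype.ext ?_)
    subst h
    have hk : κ' = κ := by rw [← htN, ← htN']
    subst hk
    have h1 : a' = a := by
      have h2 : 2 - κ' ^ 2 / 14 ≠ 0 := fun h0 => by rw [h0, mul_zero] at hak; norm_num at hak
      have h3 : a' ^ 2 = a ^ 2 := mul_right_cancel₀ h2 (hak'.trans hak.symm)
      exact (pow_left_inj₀ ha'.le ha.le two_ne_zero).mp h3
    rw [hnt, hnt', h1]
  have hprod : formβ n n' = a * a' * (formβ t t' + κ * κ' / 14) := by
    rw [hnt, hnt']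
    simp only [map_smul, map_add, LinearMap.smul_apply, LinearMap.add_apply, smul_eq_mul,
      H.norm_map_normal, htN, formβ_symm _ t', htN']
    rw [formβ_symm t' t]
    ring
  have haa : 0 < a * a' := mul_pos ha ha'
  have hlow : 1 ≤ a * a' * (2 + κ * κ' / 14) := by
    have hsq : (a * a') ^ 2 * ((2 - κ ^ 2 / 14) * (2 - κ' ^ 2 / 14)) = 1 := by
      rw [mul_pow, mul_mul_mul_comm, hak, hak', one_mul]
    -- A finite check, sharp for `κ = κ' = 0` and for `κ = -κ' = ±4`.
    have hc : 0 ≤ 2 + κ * κ' / 14 ∧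
        (2 - κ ^ 2 / 14) * (2 - κ' ^ 2 / 14) ≤ (2 + κ * κ' / 14) ^ 2 := by
      rcases hκ with rfl | rfl | rfl <;> rcases hκ' with rfl | rfl | rfl <;> norm_num
    have h1 : 1 ≤ (a * a' * (2 + κ * κ' / 14)) ^ 2 := by
      rw [mul_pow, ← hsq]
      exact mul_le_mul_of_nonneg_left hc.2 (sq_nonneg _)
    have h2 : 0 ≤ a * a' * (2 + κ * κ' / 14) := mul_nonneg haa.le hc.1
    exact (one_le_sq_iff₀ h2).mp h1
  rw [hprod]
  refine hlow.trans (mul_le_mul_of_nonneg_left ?_ haa.le)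
  linarith

end IsClusterHyperplane

/-- The spheres whose projections are the weights of negative norm, with their products with the
normal vector. -/
theorem exists_projection_weightN9 (i : Fin 9) (hi : i = 2 ∨ i = 3 ∨ i = 8) :
    ∃ t ∈ Pβ, ∃ κ : ℝ, (2 : ℝ) • weightN9 β' i = t + κ • intComb β normalZ := by
  have key : ∀ (i : Fin 9) (l : List (Fin 10)) (c : ℤ),
      (2 : ℤ) • Matrix.vecMul (dualN9 i) nodesZ =
        (14 : ℤ) • reflWordZ l νZ + c • normalZ →
      ∃ t ∈ Pβ, ∃ κ : ℝ, (2 : ℝ) • weightN9 β' i = t + κ • intComb β normalZ := by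
    intro i l c hc
    obtain ⟨k, hk, hkl⟩ := exists_map_intComb l νZ
    refine ⟨intComb β (reflWordZ l νZ), mem_Pβ.mpr ⟨k, hk, by rw [hkl, ν_eq]⟩, c / 14, ?_⟩
    have h1 := congrArg (intComb β) hc
    rw [intComb_smul, intComb_add, intComb_smul, intComb_smul, ← intComb_intComb] at h1
    have h2 : β' = fun k => intComb β (nodesZ k) := funext β'_eq
    rw [← h2, weightN9_smul] at h1
    have h3 : (14 : ℝ) • (2 : ℝ) • weightN9 β' i = (14 : ℝ) •
        (intComb β (reflWordZ l νZ) + ((c : ℝ) / 14) • intComb β normalZ) := by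
      rw [smul_add, smul_smul (14 : ℝ) ((c : ℝ) / 14),
        mul_div_cancel₀ _ (by norm_num : (14 : ℝ) ≠ 0), smul_comm (14 : ℝ) (2 : ℝ)]
      exact_mod_cast h1
    exact smul_right_injective _ (by norm_num : (14 : ℝ) ≠ 0) h3
  rcases hi with rfl | rfl | rfl
  -- The word, read from right to left, carries `ν` to a sphere with product `-4` with the normal
  -- vector; the next word gives product `4`, and `ν` itself lies in the hyperplane.
  · exact key 2 [0, 4, 5, 6, 7, 8, 9] (-4) (by decide +kernel)
  · exact key 3 [0, 1, 2, 3, 4, 5, 6, 7, 8, 9] 4 (by decide +kernel)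
  · exact key 8 [] 0 (by decide +kernel)

end CrossSection

/-! ### Identification of the cross section -/

section CrossSection

variable {g : (Fin 10 → ℝ) ≃ₗ[ℝ] (Fin 10 → ℝ)} {h : Fin 10 → ℝ}

theorem map_weightN9 {V W : Type*} [AddCommGroup V] [Module ℝ V] [AddCommGroup W] [Module ℝ W]
    (g : V ≃ₗ[ℝ] W) (v : Fin 9 → V) (i : Fin 9) :
    g (weightN9 v i) = weightN9 (fun i => g (v i)) i := by
  rw [weightN9, weightN9, map_smul, map_intComb]

theorem coe_weightN9 {V : Type*} [AddCommGroup V] [Module ℝ V] {H : Submodule ℝ V}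
    (v : Fin 9 → H) (i : Fin 9) :
    ((weightN9 v i : H) : V) = weightN9 (fun i => (v i : V)) i := by
  rw [weightN9, weightN9, Submodule.coe_smul, coe_intComb]

namespace IsClusterHyperplane

theorem map_normal_eq (H : IsClusterHyperplane g h) :
    ∀ k ∈ reflGroup formβ (Set.range fun i => g (β' i)),
      k (g (intComb β normalZ)) = g (intComb β normalZ) := by
  refine reflGroup_induction (fun i => by rw [Γβ_isometry H.mem, norm_β']) rfl fun i k hk => ?_
  rw [LinearEquiv.mul_apply, hk, reflEquiv_apply, Γβ_isometry H.mem, formβ_symm, bilin_normal_β',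
    zero_smul, add_zero]

/-- Each generating weight is half the projection of a sphere of `P_β`. The group of the nodes lies
in `Γ` and fixes the normal vector, so this persists along the orbits, and a sphere has the same
trace as its projection. -/
theorem coxeterPacking_subset (H : IsClusterHyperplane g h)
    {v : Module.Basis (Fin 9) ℝ (hyperplane formβ h)} (hv : ∀ i, (v i : Fin 10 → ℝ) = g (β' i))
    (hG : HasCoxeterGraph (hyperplaneForm formβ h) v graphN9) :
    coxeterPacking (hyperplaneForm formβ h) v ⊆ crossSection formβ Pβ h := by
  intro n hn
  have hL := hG.isSimplyLaced
  obtain ⟨γ, hγ, i, hi, rfl⟩ := (mem_coxeterPackingN9 hG).mp hn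
  have hneg : hyperplaneForm formβ h (γ (weightN9 v i)) (γ (weightN9 v i)) < 0 := by
    rw [reflGroup_isometry hL.symm hL.norm γ hγ]
    exact (norm_weightN9_neg_iff hG i).mpr hi
  refine ⟨norm_normalize hneg, ?_⟩
  obtain ⟨k, hk, hkγ⟩ := exists_extension_reflGroup hL.norm γ hγ
  simp only [hv] at hk
  obtain ⟨t, ht, κ, htκ⟩ := exists_projection_weightN9 i hi
  have hkΓ := reflGroup_map_β'_le H.mem hk
  refine ⟨k (g t), map_mem_Pβ (map_mem_Pβ ht H.mem) hkΓ, fun x => ?_⟩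
  have h1 : (2 : ℝ) • ((γ (weightN9 v i) : hyperplane formβ h) : Fin 10 → ℝ) =
      k (g t) + κ • g (intComb β normalZ) := by
    have h2 : ((weightN9 v i : hyperplane formβ h) : Fin 10 → ℝ) = g (weightN9 β' i) := by
      rw [coe_weightN9, map_weightN9]
      simp only [hv]
    rw [← hkγ, h2, ← map_smul, ← map_smul, htκ, map_add, map_add, map_smul, map_smul,
      H.map_normal_eq k hk]
  have h3 : formβ (g (intComb β normalZ)) x = 0 := (H.mem_iff _).mp x.2
  have h4 : 2 * formβ (γ (weightN9 v i) : hyperplane formβ h) x = formβ (k (g t)) x := by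
    rw [← smul_eq_mul, ← LinearMap.smul_apply, ← map_smul, h1, map_add, map_smul,
      LinearMap.add_apply, LinearMap.smul_apply, h3, smul_zero, add_zero]
  rw [← h4, coe_normalize, normalize, map_smul, LinearMap.smul_apply, smul_eq_mul]
  have h5 : 0 < (√(-(formβ (γ (weightN9 v i) : hyperplane formβ h)
      (γ (weightN9 v i) : hyperplane formβ h))))⁻¹ :=
    inv_pos.mpr (Real.sqrt_pos.mpr (neg_pos.mpr hneg))
  rw [mul_pos_iff_of_pos_left h5, mul_pos_iff_of_pos_left two_pos]

/-- The packing with the Coxeter graph is maximal, and the cross section is a packing that contains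
it. -/
theorem crossSection_eq (H : IsClusterHyperplane g h)
    {v : Module.Basis (Fin 9) ℝ (hyperplane formβ h)} (hv : ∀ i, (v i : Fin 10 → ℝ) = g (β' i))
    (hG : HasCoxeterGraph (hyperplaneForm formβ h) v graphN9) :
    crossSection formβ Pβ h = coxeterPacking (hyperplaneForm formβ h) v := by
  have hsub := H.coxeterPacking_subset hv hG
  refine Set.Subset.antisymm (fun n hn => ?_) hsub
  by_contra hcon
  have hnn : hyperplaneForm formβ h n n = -1 := hn.1
  obtain ⟨m, hm, hlt⟩ := isMaximal_coxeterPackingN9 hG n (by rw [hnn]; norm_num)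
  have hmm : hyperplaneForm formβ h m m = -1 := (hsub hm).1
  have h1 : 1 ≤ hyperplaneForm formβ h n m :=
    H.one_le_bilin hn (hsub hm) (by rintro rfl; exact hcon hm)
  rw [hnn, hmm, neg_mul_neg, one_mul, Real.sqrt_one] at hlt
  linarith

theorem coe_image_crossSection (H : IsClusterHyperplane g h)
    {v : Module.Basis (Fin 9) ℝ (hyperplane formβ h)} (hv : ∀ i, (v i : Fin 10 → ℝ) = g (β' i))
    (hG : HasCoxeterGraph (hyperplaneForm formβ h) v graphN9) (x : Fin 10 → ℝ) :
    x ∈ Subtype.val '' crossSection formβ Pβ h ↔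
      ∃ k ∈ reflGroup formβ (Set.range fun i => g (β' i)), ∃ i,
        (i = 2 ∨ i = 3 ∨ i = 8) ∧ x = normalize formβ (k (g (weightN9 β' i))) := by
  have hL := hG.isSimplyLaced
  have hw : ∀ i, ((weightN9 v i : hyperplane formβ h) : Fin 10 → ℝ) = g (weightN9 β' i) := by
    intro i
    rw [coe_weightN9, map_weightN9]
    simp only [hv]
  have hr : (Set.range fun i => (v i : Fin 10 → ℝ)) = Set.range fun i => g (β' i) := by
    simp only [hv]
  rw [H.crossSection_eq hv hG]
  constructor
  · rintro ⟨n, hn, rfl⟩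
    obtain ⟨γ, hγ, i, hi, rfl⟩ := (mem_coxeterPackingN9 hG).mp hn
    obtain ⟨k, hk, hkγ⟩ := exists_extension_reflGroup hL.norm γ hγ
    rw [hr] at hk
    exact ⟨k, hk, i, hi, by rw [coe_normalize, ← hkγ, hw]⟩
  · rintro ⟨k, hk, i, hi, rfl⟩
    rw [← hr] at hk
    obtain ⟨γ, hγ, hkγ⟩ := exists_restriction_reflGroup hL.norm k hk
    exact ⟨_, (mem_coxeterPackingN9 hG).mpr ⟨γ, hγ, i, hi, rfl⟩, by
      rw [coe_normalize, ← hkγ, hw]⟩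

theorem isSpherePacking (H : IsClusterHyperplane g h)
    {v : Module.Basis (Fin 9) ℝ (hyperplane formβ h)} (hv : ∀ i, (v i : Fin 10 → ℝ) = g (β' i))
    (hG : HasCoxeterGraph (hyperplaneForm formβ h) v graphN9) :
    IsSpherePacking 7 (hyperplaneForm formβ h) (crossSection formβ Pβ h) := by
  have heq := H.crossSection_eq hv hG
  refine ⟨hG.isLorentzN9, ⟨_, H.coxeterPacking_subset hv hG (normalize_seqN9_mem hG 0)⟩,
    ⟨1, one_pos, fun n hn => ⟨hn.1, fun n' hn' hne => H.one_le_bilin hn hn' hne⟩⟩,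
    fun n hn hn' => ?_⟩
  rw [heq] at hn hn'
  have h1 := bilin_weightN9_zero_pos_of_mem hG hn
  have h2 := bilin_weightN9_zero_pos_of_mem hG hn'
  rw [map_neg, LinearMap.neg_apply] at h2
  linarith

theorem isWeaklyApollonian (H : IsClusterHyperplane g h)
    {v : Module.Basis (Fin 9) ℝ (hyperplane formβ h)} (hv : ∀ i, (v i : Fin 10 → ℝ) = g (β' i))
    (hG : HasCoxeterGraph (hyperplaneForm formβ h) v graphN9) :
    IsWeaklyApollonian (hyperplaneForm formβ h) (crossSection formβ Pβ h) := by
  have hsub := H.coxeterPacking_subset hv hG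
  rw [H.crossSection_eq hv hG]
  exact ⟨isCrystallographicN9 hG, isMaximal_coxeterPackingN9 hG, hasWeakApollonianPropertyN9 hG,
    not_hasApollonianPropertyN9 hG fun n hn m hm hne =>
      H.one_le_bilin (hsub hn) (hsub hm) hne⟩

end IsClusterHyperplane

theorem s_zero_eq : s 0 = (2 : ℝ) • weightN9 β' 8 := by
  have h1 : (2 : ℤ) • Matrix.vecMul (dualN9 8) nodesZ = (14 : ℤ) • νZ := by decide +kernel
  have h2 := congrArg (intComb β) h1
  rw [intComb_smul, intComb_smul, ← intComb_intComb, ← ν_eq,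
    ← (funext β'_eq : β' = fun k => intComb β (nodesZ k)), weightN9_smul] at h2
  have h3 : (14 : ℝ) • s 0 = (14 : ℝ) • (2 : ℝ) • weightN9 β' 8 := by
    rw [smul_comm (14 : ℝ) (2 : ℝ)]
    exact_mod_cast h2.symm
  exact smul_right_injective _ (by norm_num : (14 : ℝ) ≠ 0) h3

end CrossSection

end SpherePacking

open SpherePacking in
/-- Part 1: `s_0, …, s_9` is a cluster of ten mutually tangent spheres in `P_β`.
Part 2: for every such cluster `t` in `P_β` and every nine of its spheres, the cross section by the
hyperplane orthogonal to the nine is the packing in `ℝ^7` with the `N = 9` Coxeter graph, and it has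
the asserted properties.
Part 3: for the spheres `s_0, …, s_8` the cross section is `Γ_7({s_0, w_3', w_4'})`, normalized.
(The index `i : Fin 9` of `w'` stands for the node `β_{i+1}`, and `0` for `β_1'`.) -/
theorem mainTheorem5 :
    IsCluster formβ Pβ s ∧
    (∀ t : Fin 10 → (Fin 10 → ℝ), IsCluster formβ Pβ t →
      ∀ (j : Fin 10) (h : Fin 10 → ℝ), h ≠ 0 → (∀ i, i ≠ j → formβ h (t i) = 0) →
        (∃ v : Module.Basis (Fin 9) ℝ (hyperplane formβ h),
          HasCoxeterGraph (hyperplaneForm formβ h) v graphN9 ∧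
          crossSection formβ Pβ h = coxeterPacking (hyperplaneForm formβ h) v) ∧
        IsSpherePacking 7 (hyperplaneForm formβ h) (crossSection formβ Pβ h) ∧
        IsWeaklyApollonian (hyperplaneForm formβ h) (crossSection formβ Pβ h) ∧
        IsGeneralLatticeType (crossSection formβ Pβ h) ∧
        ¬ IsLatticeType (crossSection formβ Pβ h)) ∧
    (∀ h : Fin 10 → ℝ, h ≠ 0 → (∀ i, i ≠ 9 → formβ h (s i) = 0) →
      (∀ i, β' i ∈ hyperplane formβ h) ∧
      HasCoxeterGraph formβ β' graphN9 ∧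
      ∃ w' : Fin 9 → (Fin 10 → ℝ),
        (∀ i, w' i ∈ hyperplane formβ h ∧ IsWeight formβ β' i (w' i)) ∧
        (∀ i, formβ (w' i) (w' i) < 0 ↔ i = 2 ∨ i = 3 ∨ i = 8) ∧
        s 0 = (2 : ℝ) • w' 8 ∧
        Subtype.val '' crossSection formβ Pβ h =
          normalize formβ '' orbit Γ7 {s 0, w' 2, w' 3}) := by
  refine ⟨isCluster_s, fun t ht j h hh hperp => ?_, fun h hh hperp => ?_⟩
  · obtain ⟨g, hg, hgs⟩ := exists_map_orthogonal ht j hperp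
    have H : IsClusterHyperplane g h := ⟨hg, hh, hgs⟩
    obtain ⟨v, hv, hG⟩ := H.exists_basis
    have heq := H.crossSection_eq hv hG
    refine ⟨⟨v, hG, heq⟩, H.isSpherePacking hv hG, H.isWeaklyApollonian hv hG, ?_, ?_⟩
    · rw [heq]; exact isGeneralLatticeTypeN9 hG
    · rw [heq]; exact not_isLatticeTypeN9 hG
  · have H : IsClusterHyperplane 1 h := ⟨one_mem _, hh, hperp⟩
    obtain ⟨v, hv, hG⟩ := H.exists_basis
    refine ⟨fun i => H.map_β'_mem i, hasCoxeterGraph_β', weightN9 β', fun i => ⟨?_, ?_, ?_⟩,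
      norm_weightN9_neg_iff hasCoxeterGraph_β', s_zero_eq, ?_⟩
    · exact Submodule.smul_mem _ _ (Submodule.sum_mem _ fun k _ =>
        Submodule.smul_mem _ _ (H.map_β'_mem k))
    · rw [formβ_symm, bilin_node_weightN9 hasCoxeterGraph_β', if_pos rfl]
    · intro k hk
      rw [formβ_symm, bilin_node_weightN9 hasCoxeterGraph_β', if_neg hk]
    · ext x
      rw [H.coe_image_crossSection hv hG]
      constructor
      · rintro ⟨k, hk, i, hi, rfl⟩
        rcases hi with rfl | rfl | rfl
        · exact ⟨_, ⟨k, hk, weightN9 β' 2, by simp, rfl⟩, rfl⟩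
        · exact ⟨_, ⟨k, hk, weightN9 β' 3, by simp, rfl⟩, rfl⟩
        · refine ⟨_, ⟨k, hk, s 0, by simp, rfl⟩, ?_⟩
          rw [s_zero_eq, map_smul, normalize_smul two_pos]
          rfl
      · rintro ⟨_, ⟨k, hk, y, hy, rfl⟩, rfl⟩
        rcases hy with rfl | rfl | rfl
        · refine ⟨k, hk, 8, by simp, ?_⟩
          rw [s_zero_eq, map_smul, normalize_smul two_pos]
          rfl
        · exact ⟨k, hk, 2, by simp, rfl⟩
        · exact ⟨k, hk, 3, by simp, rfl⟩
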